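/- **Theorem 3.1.** Let $A$ and $B$ be unital AF-algebras (unital $\mathrm C^*$-algebras that are the closure of the union of an increasing sequence of finite-dimensional $*$-subalgebras) and let $\alpha<\omega_1$. If Player II has a winning strategy in $\mathrm{EFD}_{\omega\cdot\alpha}(K_0(A),K_0(B))$, then Player II has a winning strategy in $\mathrm{PI}_\alpha(A,B)$. Here the following notions are used. * *$K_0$.* Projections $p\in M_m(A)$ and $q\in M_n(A)$ are Murray-von Neumann equivalent if there is an $m\times n$ matrix $w$ over $A$ with $ww^*=p$ and $w^*w=q$. $V(A)$ is the monoid of classes of projections in $\bigcup_n M_n(A)$ (equivalently, in $A\otimes\mathcal K$) under $[p]+[q]=[\mathrm{diag}(p,q)]$. $K_0(A)$ is the Grothendieck group of $V(A)$ and $K_0(A)_+$ is the image of $V(A)$ in it. $K_0(A)$ is regarded as a structure in the language $\{+,\le,u\}$, where $x\le y$ means $y-x\in K_0(A)_+$ and the constant $u$ is $[1_A]$. * *$\mathrm{EFD}_\gamma(M,N)$*, for structures $M,N$ in a language $\mathcal L$ and an ordinal $\gamma$. Put $\gamma_{-1}=\gamma$. In round $k=0,1,2,\dots$, if $\gamma_{k-1}>0$,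 Player I plays an ordinal $\gamma_k<\gamma_{k-1}$ together with an element $a_k\in M$ or an element $b_k\in N$, and Player II answers with an element $b_k\in N$, respectively $a_k\in M$. If $\gamma_{k-1}=0$ the game ends, and Player II wins if and only if $a_i\mapsto b_i$ $(i<k)$ induces an isomorphism between the $\mathcal L$-substructures generated by $a_0,\dots,a_{k-1}$ and by $b_0,\dots,b_{k-1}$. * *$\mathrm{PI}_\alpha(A,B)$*, for unital $\mathrm C^*$-algebras $A,B$. Put $\alpha_{-1}=\alpha$. In round $k=0,1,2,\dots$, if $\alpha_{k-1}>0$, Player I plays $(\alpha_k,c_k,\varepsilon_k)$ with $\alpha_k<\alpha_{k-1}$, $\varepsilon_k>0$ and $c_k\in A\sqcup B$, and Player II answers with a pair $(a_k,b_k)\in A\times B$ such that $\|a_k-c_k\|<\varepsilon_k$ if $c_k\in A$, and $\|b_k-c_k\|<\varepsilon_k$ if $c_k\in B$. If $\alpha_{k-1}=0$ the game ends, and Player II wins if and only if $a_i\mapsto b_i$ $(i<k)$ induces a $*$-isomorphism between the $\mathrm C^*$-subalgebras generated by $1_A,a_0,\dots,a_{k-1}$ and by $1_B,b_0,\dots,b_{k-1}$.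 -/

import Mathlib

universe u v

namespace AFK0

open Matrix

/-! ### Murray-von Neumann classes of projections and the `K₀`-group -/

section KTheory

variable {R : Type u} [Ring R] [StarRing R]

/-- Murray-von Neumann equivalence of projections `p`, `q` in (possibly different) matrix algebras
over `R`: there is a rectangular matrix `w` with `w w* = p` and `w* w = q`. -/
def MvN {m n : Type} [Fintype m] [Fintype n] (p : Matrix m m R) (q : Matrix n n R) : Prop :=
  ∃ w : Matrix m n R, w * wᴴ = p ∧ wᴴ * w = q

theorem MvN.refl {m : Type} [Fintype m] {p : Matrix m m R} (hp : IsStarProjection p) :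
    MvN p p := by
  have h1 : pᴴ = p := hp.isSelfAdjoint
  have h2 : p * p = p := hp.isIdempotentElem
  exact ⟨p, by rw [h1, h2], by rw [h1, h2]⟩

theorem MvN.symm {m n : Type} [Fintype m] [Fintype n] {p : Matrix m m R} {q : Matrix n n R}
    (h : MvN p q) : MvN q p := by
  obtain ⟨w, h1, h2⟩ := h
  exact ⟨wᴴ, by simpa using h2, by simpa using h1⟩

theorem MvN.trans {l m n : Type} [Fintype l] [Fintype m] [Fintype n] {p : Matrix l l R}
    {q : Matrix m m R} {r : Matrix n n R} (hp : IsStarProjection p) (hr : IsStarProjection r)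
    (h : MvN p q) (h' : MvN q r) : MvN p r := by
  obtain ⟨w, h1, h2⟩ := h
  obtain ⟨z, h3, h4⟩ := h'
  have hp2 : p * p = p := hp.isIdempotentElem
  have hr2 : r * r = r := hr.isIdempotentElem
  refine ⟨w * z, ?_, ?_⟩
  · calc w * z * (w * z)ᴴ = w * (z * zᴴ) * wᴴ := by
          rw [conjTranspose_mul]; simp only [Matrix.mul_assoc]
      _ = w * wᴴ * (w * wᴴ) := by rw [h3, ← h2]; simp only [Matrix.mul_assoc]
      _ = p := by rw [h1, hp2]
  · calc (w * z)ᴴ * (w * z) = zᴴ * (wᴴ * w) * z := by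
          rw [conjTranspose_mul]; simp only [Matrix.mul_assoc]
      _ = zᴴ * z * (zᴴ * z) := by rw [h2, ← h3]; simp only [Matrix.mul_assoc]
      _ = r := by rw [h4, hr2]

/-- Relabelling the index set does not change the Murray-von Neumann class. -/
theorem MvN.submatrix {m n : Type} [Fintype m] [Fintype n] {p : Matrix m m R}
    (hp : IsStarProjection p) (e : n ≃ m) : MvN p (p.submatrix e e) := by
  have h1 : pᴴ = p := hp.isSelfAdjoint
  have h2 : p * p = p := hp.isIdempotentElem
  refine ⟨p.submatrix id e, ?_, ?_⟩
  · rw [conjTranspose_submatrix, h1, submatrix_mul_equiv, h2, submatrix_id_id]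
  · have := (submatrix_mul p p e id e Function.bijective_id).symm
    rw [conjTranspose_submatrix, h1, this, h2]

theorem MvN.fromBlocks {k l m n : Type} [Fintype k] [Fintype l] [Fintype m] [Fintype n]
    {p : Matrix k k R} {q : Matrix l l R} {p' : Matrix m m R} {q' : Matrix n n R}
    (h : MvN p p') (h' : MvN q q') :
    MvN (Matrix.fromBlocks p 0 0 q) (Matrix.fromBlocks p' 0 0 q') := by
  obtain ⟨w, h1, h2⟩ := h
  obtain ⟨z, h3, h4⟩ := h'
  refine ⟨Matrix.fromBlocks w 0 0 z, ?_, ?_⟩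
  · simp [fromBlocks_conjTranspose, fromBlocks_multiply, h1, h3]
  · simp [fromBlocks_conjTranspose, fromBlocks_multiply, h2, h4]

theorem isStarProjection_fromBlocks {m n : Type} [Fintype m] [Fintype n]
    {p : Matrix m m R} {q : Matrix n n R} (hp : IsStarProjection p) (hq : IsStarProjection q) :
    IsStarProjection (Matrix.fromBlocks p 0 0 q) := by
  have h1 : pᴴ = p := hp.isSelfAdjoint
  have h2 : p * p = p := hp.isIdempotentElem
  have h3 : qᴴ = q := hq.isSelfAdjoint
  have h4 : q * q = q := hq.isIdempotentElem
  constructor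
  · simp [IsIdempotentElem, fromBlocks_multiply, h2, h4]
  · simp [IsSelfAdjoint, star_eq_conjTranspose, fromBlocks_conjTranspose, h1, h3]

theorem isStarProjection_submatrix {m n : Type} [Fintype m] [Fintype n]
    {p : Matrix m m R} (hp : IsStarProjection p) (e : n ≃ m) :
    IsStarProjection (p.submatrix e e) := by
  have h1 : pᴴ = p := hp.isSelfAdjoint
  have h2 : p * p = p := hp.isIdempotentElem
  constructor
  · rw [IsIdempotentElem, submatrix_mul_equiv, h2]
  · rw [IsSelfAdjoint, star_eq_conjTranspose, conjTranspose_submatrix, h1]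

variable (R) in
/-- The projections in the square matrix algebras `M_n(R)`, `n ∈ ℕ`. -/
structure MatProj where
  size : ℕ
  mat : Matrix (Fin size) (Fin size) R
  isProj : IsStarProjection mat

/-- Murray-von Neumann equivalence on the projections in matrix algebras over `R`. -/
instance matProjSetoid : Setoid (MatProj R) where
  r p q := MvN p.mat q.mat
  iseqv :=
    { refl := fun p => MvN.refl p.isProj
      symm := fun h => h.symm
      trans := fun {p _ r} h h' => h.trans p.isProj r.isProj h' }

/-- The diagonal sum `diag(p, q)`. -/
def MatProj.diag (p q : MatProj R) : MatProj R where
  size := p.size + q.size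
  mat := (Matrix.fromBlocks p.mat 0 0 q.mat).submatrix finSumFinEquiv.symm finSumFinEquiv.symm
  isProj := isStarProjection_submatrix (isStarProjection_fromBlocks p.isProj q.isProj) _

theorem MatProj.mvN_diag (p q : MatProj R) :
    MvN (Matrix.fromBlocks p.mat 0 0 q.mat) (p.diag q).mat :=
  MvN.submatrix (isStarProjection_fromBlocks p.isProj q.isProj) _

variable (R) in
/-- `V(R)`: Murray-von Neumann classes of projections in matrix algebras over `R`. -/
def V : Type u := Quotient (matProjSetoid (R := R))

/-- The class of a projection in a matrix algebra over `R`. -/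
def V.mk (p : MatProj R) : V R := Quotient.mk _ p

theorem V.mk_eq {p q : MatProj R} (h : MvN p.mat q.mat) : V.mk p = V.mk q := Quotient.sound h

theorem MatProj.diag_congr {p q p' q' : MatProj R} (h : MvN p.mat p'.mat)
    (h' : MvN q.mat q'.mat) : MvN (p.diag q).mat (p'.diag q').mat := by
  have a := p.mvN_diag q
  have b := p'.mvN_diag q'
  have c := MvN.fromBlocks h h'
  exact (a.symm.trans (p.diag q).isProj
    (isStarProjection_fromBlocks p'.isProj q'.isProj) c).trans (p.diag q).isProj
      (p'.diag q').isProj b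

/-- Addition on `V(R)` is given by the diagonal sum. -/
instance : Add (V R) where
  add := Quotient.map₂ MatProj.diag fun _ _ h _ _ h' => MatProj.diag_congr h h'

/-- The zero element of `V(R)` is the class of the zero projection. -/
instance : Zero (V R) where
  zero := V.mk ⟨0, 0, IsStarProjection.zero _⟩

instance : AddCommMonoid (V R) where
  nsmul := nsmulRec
  zero_add := by
    rintro ⟨p⟩
    refine V.mk_eq (MvN.symm ?_)
    refine MvN.trans p.isProj (MatProj.isProj _) ?_ (MatProj.mvN_diag _ _)
    refine MvN.trans (q := p.mat.submatrix (Equiv.emptySum (Fin 0) _) (Equiv.emptySum (Fin 0) _))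
      p.isProj (isStarProjection_fromBlocks (IsStarProjection.zero _) p.isProj)
      (MvN.submatrix p.isProj _) ?_
    have : p.mat.submatrix (Equiv.emptySum (Fin 0) (Fin p.size))
        (Equiv.emptySum (Fin 0) (Fin p.size)) = Matrix.fromBlocks 0 0 0 p.mat := by
      ext i j
      rcases i with i | i
      · exact i.elim0
      rcases j with j | j
      · exact j.elim0
      rfl
    rw [this]
    exact MvN.refl (isStarProjection_fromBlocks (IsStarProjection.zero _) p.isProj)
  add_zero := by
    rintro ⟨p⟩
    refine V.mk_eq (MvN.symm ?_)
    refine MvN.trans p.isProj (MatProj.isProj _) ?_ (MatProj.mvN_diag _ _)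
    refine MvN.trans (q := p.mat.submatrix (Equiv.sumEmpty _ (Fin 0)) (Equiv.sumEmpty _ (Fin 0)))
      p.isProj (isStarProjection_fromBlocks p.isProj (IsStarProjection.zero _))
      (MvN.submatrix p.isProj _) ?_
    have : p.mat.submatrix (Equiv.sumEmpty (Fin p.size) (Fin 0))
        (Equiv.sumEmpty (Fin p.size) (Fin 0)) = Matrix.fromBlocks p.mat 0 0 0 := by
      ext i j
      rcases i with i | i
      · rcases j with j | j
        · rfl
        · exact j.elim0
      · exact i.elim0
    rw [this]
    exact MvN.refl (isStarProjection_fromBlocks p.isProj (IsStarProjection.zero _))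
  add_comm := by
    rintro ⟨p⟩ ⟨q⟩
    refine V.mk_eq ?_
    refine MvN.trans (MatProj.isProj _) (MatProj.isProj _) (MatProj.mvN_diag p q).symm ?_
    refine MvN.trans (isStarProjection_fromBlocks p.isProj q.isProj) (MatProj.isProj _) ?_
      (MatProj.mvN_diag q p)
    have : Matrix.fromBlocks q.mat 0 0 p.mat =
        (Matrix.fromBlocks p.mat 0 0 q.mat).submatrix (Equiv.sumComm _ _) (Equiv.sumComm _ _) := by
      ext i j
      rcases i with i | i <;> rcases j with j | j <;> rfl
    rw [this]
    exact MvN.submatrix (isStarProjection_fromBlocks p.isProj q.isProj) _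
  add_assoc := by
    rintro ⟨p⟩ ⟨q⟩ ⟨r⟩
    refine V.mk_eq ?_
    have hpq := isStarProjection_fromBlocks p.isProj q.isProj
    have hqr := isStarProjection_fromBlocks q.isProj r.isProj
    refine MvN.trans (MatProj.isProj _) (MatProj.isProj _) (MatProj.mvN_diag _ r).symm ?_
    refine MvN.trans (isStarProjection_fromBlocks (MatProj.isProj _) r.isProj) (MatProj.isProj _)
      (MvN.fromBlocks (MatProj.mvN_diag p q).symm (MvN.refl r.isProj)) ?_
    refine MvN.trans (isStarProjection_fromBlocks hpq r.isProj) (MatProj.isProj _) ?_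
      (MatProj.mvN_diag p _)
    refine MvN.trans (isStarProjection_fromBlocks hpq r.isProj)
      (isStarProjection_fromBlocks p.isProj (MatProj.isProj _)) ?_
      (MvN.fromBlocks (MvN.refl p.isProj) (MatProj.mvN_diag q r))
    have : Matrix.fromBlocks p.mat 0 0 (Matrix.fromBlocks q.mat 0 0 r.mat) =
        (Matrix.fromBlocks (Matrix.fromBlocks p.mat 0 0 q.mat) 0 0 r.mat).submatrix
          (Equiv.sumAssoc _ _ _).symm (Equiv.sumAssoc _ _ _).symm := by
      ext i j
      rcases i with i | i | i <;> rcases j with j | j | j <;> rfl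
    rw [this]
    exact MvN.submatrix (isStarProjection_fromBlocks hpq r.isProj) _

variable (R) in
/-- `K₀(R)`, the Grothendieck group of `V(R)`. -/
abbrev K0 : Type u := Algebra.GrothendieckAddGroup (V R)

variable (R) in
/-- The positive cone `K₀(R)₊`, the image of `V(R)` in `K₀(R)`. -/
def K0Pos : Set (K0 R) := Set.range (Algebra.GrothendieckAddGroup.of (M := V R))

variable (R) in
/-- The class `[1]` of the unit of `R`, i.e. of the unit of `M_1(R)`, in `K₀(R)`. -/
def K0Unit : K0 R := Algebra.GrothendieckAddGroup.of (V.mk ⟨1, 1, IsStarProjection.one _⟩)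

end KTheory

/-! ### The language `{+, ≤, u}` of pointed ordered groups -/

/-- The function symbols: a constant `u` and a binary operation `+`. -/
inductive K0Func : ℕ → Type
  | unit : K0Func 0
  | add : K0Func 2

/-- The relation symbols: a binary relation `≤`. -/
inductive K0Rel : ℕ → Type
  | le : K0Rel 2

/-- The language `{+, ≤, u}`. -/
abbrev K0Lang : FirstOrder.Language.{0, 0} := ⟨K0Func, K0Rel⟩

/-- `K₀(R)` as a structure: `x ≤ y` means `y - x ∈ K₀(R)₊`, and `u` is `[1]`. -/
instance K0Structure (R : Type u) [Ring R] [StarRing R] : K0Lang.Structure (K0 R) where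
  funMap {_} f := match f with
    | K0Func.unit => fun _ => K0Unit R
    | K0Func.add => fun x => x 0 + x 1
  RelMap {_} r := match r with
    | K0Rel.le => fun x => x 1 - x 0 ∈ K0Pos R

/-! ### The dynamic Ehrenfeucht-Fraïssé game -/

/-- A completed round `(α_k, a_k, b_k)` of the EFD game. -/
structure EFDRound (A : Type u) (B : Type v) where
  clock : Ordinal.{0}
  left : A
  right : B

namespace EFD

variable {A : Type u} {B : Type v}

/-- The current clock in a position of the game starting with clock `α`. Positions are lists of
completed rounds, the most recent round first. -/
def clock (α : Ordinal.{0}) : List (EFDRound A B) → Ordinal.{0}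
  | [] => α
  | r :: _ => r.clock

/-- A strategy for Player II. Given the position, and a clock value `β` smaller than the current
one, it answers any move `(β, a)` of Player I by an element of `B` and any move `(β, b)` by an
element of `A`. -/
structure Strategy (α : Ordinal.{0}) (A : Type u) (B : Type v) where
  answerLeft : ∀ (p : List (EFDRound A B)) (β : Ordinal.{0}), β < clock α p → A → B
  answerRight : ∀ (p : List (EFDRound A B)) (β : Ordinal.{0}), β < clock α p → B → A

/-- The positions that arise in matches in which Player II follows the strategy `σ`. -/
inductive Follows {α : Ordinal.{0}} (σ : Strategy α A B) : List (EFDRound A B) → Prop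
  | nil : Follows σ []
  | left {p : List (EFDRound A B)} (hp : Follows σ p) (β : Ordinal.{0}) (hβ : β < clock α p)
      (a : A) : Follows σ (⟨β, a, σ.answerLeft p β hβ a⟩ :: p)
  | right {p : List (EFDRound A B)} (hp : Follows σ p) (β : Ordinal.{0}) (hβ : β < clock α p)
      (b : B) : Follows σ (⟨β, σ.answerRight p β hβ b, b⟩ :: p)

variable (L : FirstOrder.Language.{0, 0})

/-- The substructure of `A` generated by the elements of `A` chosen in the rounds of `p`. -/
def genLeft [L.Structure A] (p : List (EFDRound A B)) : L.Substructure A :=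
  FirstOrder.Language.Substructure.closure L {x | ∃ r ∈ p, r.left = x}

/-- The substructure of `B` generated by the elements of `B` chosen in the rounds of `p`. -/
def genRight [L.Structure B] (p : List (EFDRound A B)) : L.Substructure B :=
  FirstOrder.Language.Substructure.closure L {x | ∃ r ∈ p, r.right = x}

theorem left_mem [L.Structure A] {p : List (EFDRound A B)} {r : EFDRound A B} (hr : r ∈ p) :
    r.left ∈ genLeft L p :=
  FirstOrder.Language.Substructure.subset_closure ⟨r, hr, rfl⟩

/-- The winning condition for Player II: `a_i ↦ b_i` induces an isomorphism between the generated
substructures. -/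
def InducesIso [L.Structure A] [L.Structure B] (p : List (EFDRound A B)) : Prop :=
  ∃ f : FirstOrder.Language.Equiv L (genLeft L p) (genRight L p),
    ∀ (r : EFDRound A B) (hr : r ∈ p), (f ⟨r.left, left_mem L hr⟩ : B) = r.right

/-- Player II has a winning strategy in `EFD_α(A, B)`. -/
def IIWins (α : Ordinal.{0}) (A : Type u) (B : Type v) [L.Structure A] [L.Structure B] : Prop :=
  ∃ σ : Strategy α A B, ∀ p : List (EFDRound A B),
    Follows σ p → clock α p = 0 → InducesIso L p

end EFD

/-! ### The partial isomorphism game for unital C*-algebras -/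

/-- A completed round `(α_k, c_k, ε_k, a_k, b_k)` of the partial isomorphism game. -/
structure PIRound (A : Type u) (B : Type v) where
  clock : Ordinal.{0}
  played : A ⊕ B
  eps : ℝ
  left : A
  right : B

namespace PI

/-- The answer `(a, b)` is allowed for the move `(c, ε)`: `d(a, c) < ε` if `c ∈ A`, and
`d(b, c) < ε` if `c ∈ B`. -/
def Allowed {A : Type u} {B : Type v} [PseudoMetricSpace A] [PseudoMetricSpace B]
    (c : A ⊕ B) (ε : ℝ) (a : A) (b : B) : Prop :=
  match c with
  | Sum.inl a₀ => dist a a₀ < ε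
  | Sum.inr b₀ => dist b b₀ < ε

/-- The current clock in a position (most recent round first) of the game starting with `α`. -/
def clock {A : Type u} {B : Type v} (α : Ordinal.{0}) : List (PIRound A B) → Ordinal.{0}
  | [] => α
  | r :: _ => r.clock

/-- A strategy for Player II: an allowed answer `(a, b)` to every move `(β, c, ε)` of Player I in
every position. -/
structure Strategy (α : Ordinal.{0}) (A : Type u) (B : Type v)
    [PseudoMetricSpace A] [PseudoMetricSpace B] where
  answer : ∀ (p : List (PIRound A B)) (β : Ordinal.{0}), β < clock α p →
    A ⊕ B → ∀ ε : ℝ, 0 < ε → A × B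
  allowed : ∀ p β hβ c ε hε, Allowed c ε (answer p β hβ c ε hε).1 (answer p β hβ c ε hε).2

/-- The positions that arise in matches in which Player II follows the strategy `σ`. -/
inductive Follows {α : Ordinal.{0}} {A : Type u} {B : Type v} [PseudoMetricSpace A]
    [PseudoMetricSpace B] (σ : Strategy α A B) : List (PIRound A B) → Prop
  | nil : Follows σ []
  | step {p : List (PIRound A B)} (hp : Follows σ p) (β : Ordinal.{0}) (hβ : β < clock α p)
      (c : A ⊕ B) (ε : ℝ) (hε : 0 < ε) :
      Follows σ (⟨β, c, ε, (σ.answer p β hβ c ε hε).1, (σ.answer p β hβ c ε hε).2⟩ :: p)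

variable {A : Type u} {B : Type v}

/-- The C*-subalgebra of `A` generated by `1` and the elements `a_i`. -/
noncomputable def genLeft [CStarAlgebra A] (p : List (PIRound A B)) : StarSubalgebra ℂ A :=
  (StarAlgebra.adjoin ℂ {x : A | ∃ r ∈ p, r.left = x}).topologicalClosure

/-- The C*-subalgebra of `B` generated by `1` and the elements `b_i`. -/
noncomputable def genRight [CStarAlgebra B] (p : List (PIRound A B)) : StarSubalgebra ℂ B :=
  (StarAlgebra.adjoin ℂ {x : B | ∃ r ∈ p, r.right = x}).topologicalClosure

theorem left_mem [CStarAlgebra A] {p : List (PIRound A B)} {r : PIRound A B} (hr : r ∈ p) :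
    r.left ∈ genLeft p :=
  StarSubalgebra.le_topologicalClosure _ (StarAlgebra.subset_adjoin ℂ _ ⟨r, hr, rfl⟩)

/-- The winning condition for Player II: `a_i ↦ b_i` induces a (unital, automatically isometric)
*-isomorphism between the generated C*-subalgebras. -/
def InducesIso [CStarAlgebra A] [CStarAlgebra B] (p : List (PIRound A B)) : Prop :=
  ∃ f : genLeft p ≃⋆ₐ[ℂ] genRight p,
    ∀ (r : PIRound A B) (hr : r ∈ p), (f ⟨r.left, left_mem hr⟩ : B) = r.right

/-- Player II has a winning strategy in `PI_α(A, B)`. -/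
def IIWins (α : Ordinal.{0}) (A : Type u) (B : Type v) [CStarAlgebra A] [CStarAlgebra B] : Prop :=
  ∃ σ : Strategy α A B, ∀ p : List (PIRound A B),
    Follows σ p → clock α p = 0 → InducesIso p

end PI

/-- A (unital) C*-algebra is AF if it is the closure of the union of an increasing sequence of
finite-dimensional *-subalgebras, which are not assumed to contain the unit. -/
def IsAF (A : Type u) [CStarAlgebra A] : Prop :=
  ∃ S : ℕ → NonUnitalStarSubalgebra ℂ A,
    Monotone S ∧ (∀ n, FiniteDimensional ℂ (S n)) ∧ Dense (⋃ n, (S n : Set A))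

end AFK0

/-! An AF-algebra has a dense unital star subalgebra `R` in which every finite set lies in a
finite-dimensional star subalgebra, and each of the latter is spanned by matrix units with minimal
diagonal projections. Such a system is determined up to unitary conjugacy by the `K₀`-classes of its
diagonal entries, and prescribed positive classes that are constant on each part and add up to `[1]`
are realized by matrix units in `R`. So finite-dimensional pieces of the algebra can be coded by
finitely many elements of `K₀`.

In the PI game Player II runs an auxiliary EFD match along the given strategy and keeps a
finite-dimensional `Γ ⊆ A × B`, the graph of an isomorphism between subalgebras of `RA` and `RB`.
The classes of any two nonzero projections matched by `Γ` form a pair in the additive semigroup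
generated by the unit pair and the pairs of the EFD match. When Player I plays `c ∈ A`, it is
approximated by some `a' ∈ RA`, and a finite-dimensional `T ⊆ RA` is taken that contains `a'` and
the left half of `Γ`. The classes of the minimal projections in a system of matrix units of `T` are
fed to the EFD strategy. This takes finitely many rounds, which the clock allows: `ω·β + n ≤ ω·γ`
whenever `β < γ`. The answers have the same order relations and the same sum, so they are realized
by matrix units in `RB` and give a copy of `T` there. This copy may disagree with `Γ` on its left
half, but both have the same `K₀`-classes there, so conjugation by a unitary of `RB` repairs it
(`IsMatching.extend`). Moves in `B` are handled by symmetry. At any moment `Γ` exhibits the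
isomorphism wanted (`PI.inducesIso_of_graph`).

The bridge to `K₀` is cancellation. Invertibles are dense, hence complements of equivalent
projections are equivalent (`EqvIn.one_sub`), hence equal classes mean Murray-von Neumann
equivalence (`exists_mvN_of_kclass_eq`); a perturbation puts the partial isometry into `R`
(`EqvIn.of_top`). Realization of classes is `exists_matrixUnits_of_K0`.

The language has neither zero nor negation, so only nonempty sums, equality and order of matched
elements may be transferred. -/

namespace AFK0
-- Polar decomposition and unitary equivalence of close projections
section CStar
variable {C : Type u} [CStarAlgebra C]

/-- The element is `y ^ (-1/2)` from the continuous functional calculus; this is why it stays in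
closed subalgebras containing `y` and commutes with whatever commutes with `y`. -/
theorem exists_inv_sqrt {y : C} (hy : IsSelfAdjoint y) (hpos : ∀ t ∈ spectrum ℝ y, 0 < t) :
    ∃ s : C, IsSelfAdjoint s ∧ s * s * y = 1 ∧ s * y * s = 1 ∧
      (∀ T : StarSubalgebra ℂ C, IsClosed (T : Set C) → y ∈ T → s ∈ T) ∧
      ∀ z, Commute z y → Commute z s := by
  have hne : ∀ t ∈ spectrum ℝ y, Real.sqrt t ≠ 0 := fun t ht => (Real.sqrt_pos.2 (hpos t ht)).ne'
  have hc : ContinuousOn (fun t : ℝ => (Real.sqrt t)⁻¹) (spectrum ℝ y) :=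
    ContinuousOn.inv₀ Real.continuous_sqrt.continuousOn hne
  have hcomm : ∀ z, Commute z y → Commute z (cfc (fun t : ℝ => (Real.sqrt t)⁻¹) y) :=
    fun z hz => (hz.symm.cfc_real _).symm
  have h1 : cfc (fun t : ℝ => (Real.sqrt t)⁻¹) y * cfc (fun t : ℝ => (Real.sqrt t)⁻¹) y * y = 1 := by
    conv_lhs => rw [← cfc_mul _ _ y hc hc]
    conv_lhs =>
      enter [2]
      rw [← cfc_id ℝ y]
    rw [← cfc_mul (fun t : ℝ => (Real.sqrt t)⁻¹ * (Real.sqrt t)⁻¹) id y (hc.mul hc) continuousOn_id,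
      ← cfc_one ℝ y]
    refine cfc_congr fun t ht => ?_
    have := hne t ht
    have h2 := Real.mul_self_sqrt (hpos t ht).le
    simp only [id, Pi.one_apply]
    field_simp
    rw [sq, h2]
  refine ⟨cfc (fun t : ℝ => (Real.sqrt t)⁻¹) y, cfc_predicate _ y, h1, ?_, ?_, hcomm⟩
  · rw [mul_assoc, ← (hcomm y (Commute.refl y)).eq.symm, ← mul_assoc] at *
    exact h1
  · intro T hT hyT
    have := hT
    exact cfc_mem (𝕜' := ℂ) _ hyT

theorem spectrum_pos_of_isUnit {y : C} (hu : IsUnit y) (h0 : ∀ t ∈ spectrum ℝ y, 0 ≤ t) :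
    ∀ t ∈ spectrum ℝ y, 0 < t := by
  intro t ht
  refine lt_of_le_of_ne (h0 t ht) ?_
  rintro rfl
  exact (spectrum.zero_notMem_iff ℝ).2 hu ht

theorem spectrum_pos_of_norm_sub_one_lt {y : C} (h : ‖y - 1‖ < 1) :
    ∀ t ∈ spectrum ℝ y, 0 < t := by
  intro t ht
  have h1 : t - 1 ∈ spectrum ℝ (y - 1) := by
    have := (spectrum.sub_singleton_eq y (1 : ℝ)).symm
    rw [map_one] at this
    rw [this]
    exact Set.sub_mem_sub ht rfl
  have h2 := spectrum.norm_le_norm_mul_of_mem h1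
  have h4 : ‖(1 : C)‖ ≤ 1 := by
    rcases subsingleton_or_nontrivial C with hC | hC
    · simp [Subsingleton.elim (1 : C) 0]
    · simp
  have h3 : ‖y - 1‖ * ‖(1 : C)‖ ≤ ‖y - 1‖ := mul_le_of_le_one_right (norm_nonneg _) h4
  rw [Real.norm_eq_abs, abs_le] at h2
  linarith [h2.1]

/-- Unitary part of the polar decomposition of an invertible element. -/
theorem exists_unitary_of_isUnit {x : C} (hx : IsUnit x) :
    ∃ v s : C, star v * v = 1 ∧ v * star v = 1 ∧ v = x * s ∧ IsSelfAdjoint s ∧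
      (∀ T : StarSubalgebra ℂ C, IsClosed (T : Set C) → x ∈ T → v ∈ T) ∧
      ∀ z, Commute z (star x * x) → Commute z s := by
  obtain ⟨s, hs, h1, h2, h3, h4⟩ := exists_inv_sqrt (IsSelfAdjoint.star_mul_self x)
    (spectrum_pos_of_isUnit (hx.star.mul hx) spectrum_star_mul_self_nonneg)
  have hs' : star s = s := hs
  have hv : star (x * s) * (x * s) = 1 := by
    rw [star_mul, hs', ← h2]; noncomm_ring
  have hss : IsUnit (s * s) := by
    obtain ⟨k, hk⟩ := hx.star.mul hx
    rw [← hk] at h1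
    rw [← Units.inv_eq_of_mul_eq_one_left h1]
    exact k⁻¹.isUnit
  have hus : IsUnit s := ((Commute.refl s).isUnit_mul_iff.1 hss).1
  have huv : IsUnit (x * s) := hx.mul hus
  refine ⟨x * s, s, hv, ?_, rfl, hs, ?_, h4⟩
  · exact huv.mul_right_cancel (by rw [mul_assoc, hv, mul_one, one_mul])
  · intro T hT hxT
    exact mul_mem hxT (h3 T hT (mul_mem (star_mem hxT) hxT))

/-- Taking adjoints, `p` commutes with `star x * x`, hence with its inverse square root, so the
unitary part of `x` intertwines as `x` does. -/
theorem exists_unitary_of_intertwine {x p q : C} (hx : IsUnit x) (hp : IsSelfAdjoint p)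
    (hq : IsSelfAdjoint q) (h : x * p = q * x) :
    ∃ v : C, star v * v = 1 ∧ v * star v = 1 ∧ v * p = q * v := by
  obtain ⟨v, s, h1, h2, h3, -, -, h4⟩ := exists_unitary_of_isUnit hx
  refine ⟨v, h1, h2, ?_⟩
  have hp' : star p = p := hp
  have hq' : star q = q := hq
  have h' : p * star x = star x * q := by
    have := congrArg star h
    rwa [star_mul, star_mul, hp', hq'] at this
  have hc : Commute p (star x * x) := by
    show p * (star x * x) = star x * x * p
    rw [← mul_assoc, h', mul_assoc, mul_assoc, h]
  rw [h3, mul_assoc, ← (h4 p hc).eq, ← mul_assoc, h, mul_assoc]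

theorem isUnit_of_norm_sub_one_lt {y : C} (h : ‖y - 1‖ < 1) : IsUnit y := by
  have := isUnit_one_sub_of_norm_lt_one (x := 1 - y) (by rwa [norm_sub_rev])
  simpa using this

/-- Close projections are unitarily equivalent. -/
theorem exists_unitary_of_norm_sub_lt_one {p q : C} (hp : IsStarProjection p)
    (hq : IsStarProjection q) (h : ‖p - q‖ < 1) :
    ∃ v : C, star v * v = 1 ∧ v * star v = 1 ∧ v * p = q * v := by
  have hp1 : star p = p := hp.isSelfAdjoint
  have hp2 : p * p = p := hp.isIdempotentElem
  have hq1 : star q = q := hq.isSelfAdjoint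
  have hq2 : q * q = q := hq.isIdempotentElem
  have hsq : ‖(p - q) * (p - q)‖ < 1 := by
    refine (norm_mul_le _ _).trans_lt ?_
    nlinarith [norm_nonneg (p - q)]
  have key : IsUnit (1 - (p - q) * (p - q)) := isUnit_one_sub_of_norm_lt_one hsq
  -- The intertwiner is `x = q p + (1 - q)(1 - p)`. Both `star x * x` and `x * star x` equal `1 - (p
  -- - q)²`, which is invertible.
  have e1 : (p * q + (1 - p) * (1 - q)) * (q * p + (1 - q) * (1 - p)) =
      1 - (p - q) * (p - q) := by
    have : (p * q + (1 - p) * (1 - q)) * (q * p + (1 - q) * (1 - p)) =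
      p * (q * q) * p + (1 - p) * (1 - q - q + q * q) * (1 - p)
       + (p * (q - q * q) * (1 - p) + (1 - p) * (q - q * q) * p) := by noncomm_ring
    rw [this, hq2]
    have : p * q * p + (1 - p) * (1 - q - q + q) * (1 - p) +
        (p * (q - q) * (1 - p) + (1 - p) * (q - q) * p) =
        1 - (p * p - p * q - q * p + q * q) + (p * p - p) + (p * p - p) + (q * q - q) := by
      noncomm_ring
    rw [this, hp2, hq2]
    have : (p - q) * (p - q) = p * p - p * q - q * p + q * q := by noncomm_ring
    rw [this, hp2, hq2]
    noncomm_ring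
  have e2 : (q * p + (1 - q) * (1 - p)) * (p * q + (1 - p) * (1 - q)) =
      1 - (p - q) * (p - q) := by
    have : (q * p + (1 - q) * (1 - p)) * (p * q + (1 - p) * (1 - q)) =
      q * (p * p) * q + (1 - q) * (1 - p - p + p * p) * (1 - q)
       + (q * (p - p * p) * (1 - q) + (1 - q) * (p - p * p) * q) := by noncomm_ring
    rw [this, hp2]
    have : q * p * q + (1 - q) * (1 - p - p + p) * (1 - q) +
        (q * (p - p) * (1 - q) + (1 - q) * (p - p) * q) =
        1 - (p * p - p * q - q * p + q * q) + (q * q - q) + (q * q - q) + (p * p - p) := by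
      noncomm_ring
    rw [this, hp2, hq2]
    have : (p - q) * (p - q) = p * p - p * q - q * p + q * q := by noncomm_ring
    rw [this, hp2, hq2]
    noncomm_ring
  have hu : IsUnit (q * p + (1 - q) * (1 - p)) := by
    obtain ⟨k, hk⟩ := key
    refine isUnit_iff_exists_and_exists.2 ⟨⟨(p * q + (1 - p) * (1 - q)) * (↑k⁻¹ : C), ?_⟩,
      ⟨(↑k⁻¹ : C) * (p * q + (1 - p) * (1 - q)), ?_⟩⟩
    · rw [← mul_assoc, e2, ← hk, Units.mul_inv]
    · rw [mul_assoc, e1, ← hk, Units.inv_mul]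
  refine exists_unitary_of_intertwine hu hp.isSelfAdjoint hq.isSelfAdjoint ?_
  have l : (q * p + (1 - q) * (1 - p)) * p = q * (p * p) + (1 - q) * (p - p * p) := by noncomm_ring
  have r : q * (q * p + (1 - q) * (1 - p)) = (q * q) * p + (q - q * q) * (1 - p) := by noncomm_ring
  rw [l, r, hp2, hq2]
  simp

end CStar
-- Equivalence of projections inside a dense locally finite-dimensional subalgebra
section EqvIn
variable {C : Type u} [CStarAlgebra C]

/-- Murray-von Neumann equivalence through an element of the star subalgebra `R`. -/
def EqvIn (R : StarSubalgebra ℂ C) (p q : C) : Prop :=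
  ∃ w ∈ R, w * star w = p ∧ star w * w = q

/-- Every finite subset of `R` lies in a finite-dimensional star subalgebra of `R`. -/
def LocallyFD (R : StarSubalgebra ℂ C) : Prop :=
  ∀ s : Set C, s.Finite → s ⊆ R →
    ∃ T : StarSubalgebra ℂ C, T ≤ R ∧ FiniteDimensional ℂ T ∧ s ⊆ T

theorem EqvIn.symm {R : StarSubalgebra ℂ C} {p q : C} (h : EqvIn R p q) : EqvIn R q p := by
  obtain ⟨w, hw, h1, h2⟩ := h
  exact ⟨star w, star_mem hw, by rwa [star_star], by rwa [star_star]⟩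

theorem EqvIn.refl {R : StarSubalgebra ℂ C} {p : C} (hp : IsStarProjection p) (h : p ∈ R) :
    EqvIn R p p :=
  ⟨p, h, by rw [hp.isSelfAdjoint.star_eq, hp.isIdempotentElem.eq],
    by rw [hp.isSelfAdjoint.star_eq, hp.isIdempotentElem.eq]⟩

theorem mul_eq_self_of_mul_star_eq {p w : C} (hp : IsStarProjection p) (h : w * star w = p) :
    p * w = w := by
  have h0 : (1 - p) * w = 0 := by
    rw [← CStarRing.mul_star_self_eq_zero_iff]
    calc (1 - p) * w * star ((1 - p) * w) = (1 - p) * (w * star w) * star (1 - p) := by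
          rw [star_mul]; noncomm_ring
      _ = 0 := by rw [h, hp.one_sub_mul_self, zero_mul]
  rw [sub_mul, one_mul, sub_eq_zero] at h0
  exact h0.symm

theorem mul_eq_self_of_star_mul_eq {q w : C} (hq : IsStarProjection q) (h : star w * w = q) :
    w * q = w := by
  have := mul_eq_self_of_mul_star_eq (w := star w) hq (by rwa [star_star])
  have := congrArg star this
  rwa [star_mul, star_star, hq.isSelfAdjoint.star_eq] at this

theorem EqvIn.trans {R : StarSubalgebra ℂ C} {p q r : C} (hp : IsStarProjection p)
    (hr : IsStarProjection r) (h : EqvIn R p q) (h' : EqvIn R q r) : EqvIn R p r := by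
  obtain ⟨w, hw, h1, h2⟩ := h
  obtain ⟨z, hz, h3, h4⟩ := h'
  refine ⟨w * z, mul_mem hw hz, ?_, ?_⟩
  · calc w * z * star (w * z) = w * (z * star z) * star w := by rw [star_mul]; noncomm_ring
      _ = (w * star w) * (w * star w) := by rw [h3, ← h2]; noncomm_ring
      _ = p := by rw [h1, hp.isIdempotentElem.eq]
  · calc star (w * z) * (w * z) = star z * (star w * w) * z := by rw [star_mul]; noncomm_ring
      _ = (star z * z) * (star z * z) := by rw [h2, ← h3]; noncomm_ring
      _ = r := by rw [h4, hr.isIdempotentElem.eq]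

theorem EqvIn.add {R : StarSubalgebra ℂ C} {p q p' q' : C} (hp : IsStarProjection p)
    (hq : IsStarProjection q) (hp' : IsStarProjection p') (hq' : IsStarProjection q')
    (h0 : p * q = 0) (h0' : p' * q' = 0) (h : EqvIn R p p') (h' : EqvIn R q q') :
    EqvIn R (p + q) (p' + q') := by
  obtain ⟨w, hw, h1, h2⟩ := h
  obtain ⟨z, hz, h3, h4⟩ := h'
  have a1 := mul_eq_self_of_mul_star_eq hp h1
  have a2 := mul_eq_self_of_star_mul_eq hp' h2
  have a3 := mul_eq_self_of_mul_star_eq hq h3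
  have a4 := mul_eq_self_of_star_mul_eq hq' h4
  have b1 : w * star z = 0 := by
    rw [← a2, ← a4, star_mul, hq'.isSelfAdjoint.star_eq]
    calc w * p' * (q' * star z) = w * (p' * q') * star z := by noncomm_ring
      _ = 0 := by rw [h0']; simp
  have b2 : z * star w = 0 := by have := congrArg star b1; simpa using this
  have b3 : star w * z = 0 := by
    rw [← a1, ← a3, star_mul, hp.isSelfAdjoint.star_eq]
    calc star w * p * (q * z) = star w * (p * q) * z := by noncomm_ring
      _ = 0 := by rw [h0]; simp
  have b4 : star z * w = 0 := by have := congrArg star b3; simpa using this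
  exact ⟨w + z, add_mem hw hz, by rw [star_add, mul_add, add_mul, add_mul, h1, h3, b1, b2]; simp,
    by rw [star_add, mul_add, add_mul, add_mul, h2, h4, b3, b4]; simp⟩

theorem EqvIn.of_unitary {R : StarSubalgebra ℂ C} {p q v : C} (hp : IsStarProjection p)
    (hpR : p ∈ R) (hvR : v ∈ R) (h1 : star v * v = 1) (h2 : v * star v = 1)
    (h : v * p = q * v) : EqvIn R q p := by
  refine ⟨v * p, mul_mem hvR hpR, ?_, ?_⟩
  · calc v * p * star (v * p) = (v * p) * (star p * star v) := by rw [star_mul]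
      _ = v * (p * p) * star v := by rw [hp.isSelfAdjoint.star_eq]; noncomm_ring
      _ = q := by rw [hp.isIdempotentElem.eq, h, mul_assoc, h2, mul_one]
  · calc star (v * p) * (v * p) = star p * (star v * v) * p := by rw [star_mul]; noncomm_ring
      _ = p := by rw [h1, mul_one, hp.isSelfAdjoint.star_eq, hp.isIdempotentElem.eq]

theorem norm_projection_le {p : C} (hp : IsStarProjection p) : ‖p‖ ≤ 1 := by
  have : ‖p‖ * ‖p‖ = ‖p‖ := by
    rw [← CStarRing.norm_star_mul_self, hp.isSelfAdjoint.star_eq, hp.isIdempotentElem.eq]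
  nlinarith [norm_nonneg p]

theorem norm_le_one_of_star_mul_projection {w q : C} (hq : IsStarProjection q)
    (h : star w * w = q) : ‖w‖ ≤ 1 := by
  have h1 : ‖w‖ * ‖w‖ ≤ 1 := by
    rw [← CStarRing.norm_star_mul_self, h]; exact norm_projection_le hq
  nlinarith [norm_nonneg w]

theorem norm_star_mul_self_sub_le {x w : C} (hw : ‖w‖ ≤ 1) :
    ‖star x * x - star w * w‖ ≤ 2 * ‖x - w‖ + ‖x - w‖ ^ 2 := by
  have e : star x * x - star w * w = star w * (x - w) + star (x - w) * w +
      star (x - w) * (x - w) := by rw [star_sub]; noncomm_ring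
  rw [e]
  refine (norm_add₃_le).trans ?_
  have h1 : ‖star w * (x - w)‖ ≤ ‖x - w‖ := by
    refine (norm_mul_le _ _).trans ?_
    rw [norm_star]; nlinarith [norm_nonneg (x - w)]
  have h2 : ‖star (x - w) * w‖ ≤ ‖x - w‖ := by
    refine (norm_mul_le _ _).trans ?_
    rw [norm_star]; nlinarith [norm_nonneg (x - w)]
  have h3 : ‖star (x - w) * (x - w)‖ = ‖x - w‖ ^ 2 := by
    rw [CStarRing.norm_star_mul_self, sq]
  linarith

/-- A partial isometry need not extend to a unitary, but a nearby invertible `x` has a unitary part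
`v`, and conjugation by `v` carries `star x * x ≈ q` to `x * star x ≈ p`. Then `v q v*` is close to
`p`, so `p` and `q` are unitarily equivalent, and the same unitary serves the complements. -/
theorem EqvIn.one_sub {p q : C} (hd : ∀ (w : C) (ε : ℝ), 0 < ε → ∃ x : C, IsUnit x ∧ ‖x - w‖ < ε)
    (hp : IsStarProjection p) (hq : IsStarProjection q) (h : EqvIn ⊤ p q) :
    EqvIn ⊤ (1 - p) (1 - q) := by
  obtain ⟨w, -, h1, h2⟩ := h
  obtain ⟨x, hx, hxw⟩ := hd w (1 / 8) (by norm_num)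
  have hw1 := norm_le_one_of_star_mul_projection hq h2
  have d1 := norm_star_mul_self_sub_le (x := x) hw1
  have d2 := norm_star_mul_self_sub_le (x := star x) (w := star w) (by rwa [norm_star])
  rw [← star_sub, norm_star, star_star, star_star, h1] at d2
  rw [h2] at d1
  -- Each of the two approximation errors must stay below `1 / 2`, so that `v q v*` and `p` are at
  -- distance less than `1`.
  have hb : 2 * ‖x - w‖ + ‖x - w‖ ^ 2 < 1 / 2 := by nlinarith [norm_nonneg (x - w)]
  obtain ⟨v, s, v1, v2, v3, hs, -, hsc⟩ := exists_unitary_of_isUnit hx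
  have hvmem : v ∈ unitary C := ⟨v1, v2⟩
  -- With `v = x s` and `s = (star x * x) ^ (-1/2)`, this is `x s (x* x) s x* = x x*`.
  have e0 : v * (star x * x) * star v = x * star x := by
    have hc := (hsc _ (Commute.refl (star x * x))).eq
    have hvx : v * (star x * x) = x * (star x * x) * s := by
      rw [v3, mul_assoc, ← hc, ← mul_assoc]
    have hs' : star s = s := hs
    have : s * star x * x * s = 1 := by
      have := v1
      rw [v3, star_mul, hs'] at this
      rw [← this]; noncomm_ring
    have h3 : s * star v = s * s * star x := by rw [v3, star_mul, hs', mul_assoc]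
    have hss : s * s * (star x * x) = 1 := by
      have hc' : s * s * (star x * x) = s * (star x * x) * s := by
        rw [mul_assoc, mul_assoc, hc]
      rw [hc', ← this]; noncomm_ring
    have hss' : (star x * x) * (s * s) = 1 := by
      have : (star x * x) * (s * s) = s * s * (star x * x) := by
        rw [← mul_assoc, hc, mul_assoc, hc, mul_assoc]
      rw [this, hss]
    calc v * (star x * x) * star v = x * ((star x * x) * (s * star v)) := by
          rw [hvx]; noncomm_ring
      _ = x * (((star x * x) * (s * s)) * star x) := by rw [h3]; noncomm_ring
      _ = x * star x := by rw [hss', one_mul]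
  have hq' : IsStarProjection (v * q * star v) := by
    constructor
    · show v * q * star v * (v * q * star v) = v * q * star v
      calc v * q * star v * (v * q * star v) = v * (q * (star v * v) * q) * star v := by
            noncomm_ring
        _ = _ := by rw [v1, mul_one, hq.isIdempotentElem.eq]
    · show star (v * q * star v) = _
      rw [star_mul, star_mul, star_star, hq.isSelfAdjoint.star_eq, mul_assoc]
  have hclose : ‖v * q * star v - p‖ < 1 := by
    have e : v * q * star v - p = v * (q - star x * x) * star v + (x * star x - p) := by
      rw [← e0]; noncomm_ring
    rw [e]
    refine (norm_add_le _ _).trans_lt ?_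
    have : ‖v * (q - star x * x) * star v‖ = ‖star x * x - q‖ := by
      rw [CStarRing.norm_mul_mem_unitary _ (Unitary.star_mem hvmem),
        CStarRing.norm_mem_unitary_mul _ hvmem, norm_sub_rev]
    rw [this]
    linarith
  obtain ⟨t, t1, t2, t3⟩ := exists_unitary_of_norm_sub_lt_one hq' hp hclose
  have i1 : star (t * v) * (t * v) = 1 := by
    calc star (t * v) * (t * v) = star v * (star t * t) * v := by rw [star_mul]; noncomm_ring
      _ = 1 := by rw [t1, mul_one, v1]
  have i2 : t * v * star (t * v) = 1 := by
    calc t * v * star (t * v) = t * (v * star v) * star t := by rw [star_mul]; noncomm_ring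
      _ = 1 := by rw [v2, mul_one, t2]
  have i3 : t * v * q = p * (t * v) := by
    calc t * v * q = t * (v * q * star v) * v := by
          rw [show t * (v * q * star v) * v = t * v * q * (star v * v) by noncomm_ring, v1, mul_one]
      _ = p * (t * v) := by rw [t3, mul_assoc]
  refine EqvIn.of_unitary hq.one_sub trivial (v := t * v) trivial i1 i2 ?_
  rw [mul_sub, sub_mul, i3, mul_one, one_mul]

/-- An element of a finite-dimensional algebra is a root of a monic polynomial. As a consequence
every function is continuous on the spectrum of such an element, and step functions are available in
the functional calculus. -/
theorem finite_spectrum_of_mem {T : StarSubalgebra ℂ C} [FiniteDimensional ℂ T] {x : C}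
    (hx : x ∈ T) : (spectrum ℂ x).Finite := by
  rcases subsingleton_or_nontrivial C with hC | hC
  · rw [spectrum.of_subsingleton]; exact Set.finite_empty
  have hi : IsIntegral ℂ (⟨x, hx⟩ : T) := Algebra.IsIntegral.isIntegral _
  have hi' : IsIntegral ℂ x := hi.map T.subtype
  obtain ⟨p, hp, hp0⟩ := hi'
  refine (p.roots.toFinset.finite_toSet).subset fun t ht => ?_
  have h1 := spectrum.subset_polynomial_aeval x p ⟨t, ht, rfl⟩
  rw [Polynomial.aeval_def, hp0, spectrum.zero_eq] at h1
  simp only [Finset.mem_coe, Multiset.mem_toFinset]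
  exact (Polynomial.mem_roots hp.ne_zero).2 h1

theorem finite_real_spectrum_of_mem {T : StarSubalgebra ℂ C} [FiniteDimensional ℂ T] {x : C}
    (hx : x ∈ T) : (spectrum ℝ x).Finite := by
  have h := finite_spectrum_of_mem hx
  rw [← spectrum.preimage_algebraMap (R := ℝ) ℂ]
  exact h.preimage (Set.injOn_of_injective (algebraMap ℝ ℂ).injective)

theorem isClosed_of_finiteDimensional (T : StarSubalgebra ℂ C) [FiniteDimensional ℂ T] :
    IsClosed (T : Set C) := by
  have : FiniteDimensional ℂ (Subalgebra.toSubmodule T.toSubalgebra) :=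
    inferInstanceAs (FiniteDimensional ℂ T)
  exact (Subalgebra.toSubmodule T.toSubalgebra).closed_of_finiteDimensional

variable {R : StarSubalgebra ℂ C}

theorem LocallyFD.exists_mem (hR : LocallyFD R) {x : C} (hx : x ∈ R) :
    ∃ T : StarSubalgebra ℂ C, T ≤ R ∧ FiniteDimensional ℂ T ∧ x ∈ T := by
  obtain ⟨T, h1, h2, h3⟩ := hR {x} (Set.finite_singleton x) (by simpa using hx)
  exact ⟨T, h1, h2, h3 rfl⟩

theorem exists_near (hd : Dense (R : Set C)) (w : C) {ε : ℝ} (hε : 0 < ε) :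
    ∃ a ∈ R, ‖a - w‖ < ε := by
  obtain ⟨a, ha, h⟩ := hd.exists_dist_lt w hε
  exact ⟨a, ha, by rwa [norm_sub_rev, ← dist_eq_norm]⟩

/-- An element of `R` has finite spectrum, so an arbitrarily small real shift makes it invertible.
-/
theorem exists_isUnit_near (hR : LocallyFD R) (hd : Dense (R : Set C)) (w : C) (ε : ℝ)
    (hε : 0 < ε) : ∃ x : C, IsUnit x ∧ ‖x - w‖ < ε := by
  obtain ⟨a, ha, h⟩ := exists_near hd w (half_pos hε)
  obtain ⟨T, -, hT, haT⟩ := hR.exists_mem ha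
  have hinf : (Set.Ioo (0 : ℝ) (ε / 2 / (‖(1 : C)‖ + 1))).Infinite :=
    Set.Ioo_infinite (by positivity)
  obtain ⟨t, ht, htn⟩ := hinf.exists_notMem_finite (finite_real_spectrum_of_mem haT)
  refine ⟨-(algebraMap ℝ C t - a), (spectrum.notMem_iff.1 htn).neg, ?_⟩
  have e : -(algebraMap ℝ C t - a) - w = (a - w) - algebraMap ℝ C t := by abel
  rw [e]
  refine (norm_sub_le _ _).trans_lt ?_
  have h2 : ‖algebraMap ℝ C t‖ ≤ ε / 2 := by
    rw [norm_algebraMap, Real.norm_eq_abs, abs_of_pos ht.1]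
    have := (lt_div_iff₀ (by positivity)).1 ht.2
    nlinarith [norm_nonneg (1 : C), ht.1]
  linarith

/-- A self-adjoint element `h` of `R` near `p` almost satisfies `h² = h`, so its spectrum clusters
at `0` and `1`; cutting it at `1 / 2` gives a projection in the finite-dimensional algebra
containing `h`. -/
theorem exists_projection_near (hR : LocallyFD R) (hd : Dense (R : Set C)) {p : C}
    (hp : IsStarProjection p) : ∃ p' ∈ R, IsStarProjection p' ∧ ‖p - p'‖ < 1 := by
  obtain ⟨a, ha, hap⟩ := exists_near hd p (show (0 : ℝ) < 1 / 16 by norm_num)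
  set h : C := (2⁻¹ : ℂ) • (a + star a) with hh
  have hsa : IsSelfAdjoint h := by
    show star h = h
    rw [hh, star_smul, star_add, star_star, add_comm]
    simp
  have hhR : h ∈ R := R.smul_mem (add_mem ha (star_mem ha)) _
  have hhp : ‖h - p‖ < 1 / 16 := by
    have e : h - p = (2⁻¹ : ℂ) • ((a - p) + star (a - p)) := by
      rw [hh, star_sub, hp.isSelfAdjoint.star_eq,
        show a - p + (star a - p) = (a + star a) - (2 : ℂ) • p by rw [two_smul]; abel,
        smul_sub, smul_smul]
      norm_num
    rw [e, norm_smul]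
    have := norm_add_le (a - p) (star (a - p))
    rw [norm_star] at this
    rw [show ‖(2⁻¹ : ℂ)‖ = 2⁻¹ by norm_num]
    linarith
  obtain ⟨T, hTR, hT, hhT⟩ := hR.exists_mem hhR
  have hfin := finite_real_spectrum_of_mem hhT
  have hcont : ∀ f : ℝ → ℝ, ContinuousOn f (spectrum ℝ h) := fun f => hfin.continuousOn f
  have hp1 := norm_projection_le hp
  have hnh : ‖h‖ ≤ 17 / 16 := by
    have := norm_le_norm_sub_add h p
    linarith
  -- The bound is `(17/16 + 1 + 1) / 16`, from `‖h‖ ≤ 17/16`, `‖p‖ ≤ 1` and `‖h - p‖ < 1/16`.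
  have hsq : ‖h * h - h‖ ≤ 49 / 256 := by
    have e : h * h - h = h * (h - p) + (h - p) * p - (h - p) := by
      rw [mul_sub, sub_mul, hp.isIdempotentElem.eq]; abel
    rw [e]
    have i1 := norm_mul_le h (h - p)
    have i2 := norm_mul_le (h - p) p
    have i3 := norm_sub_le (h * (h - p) + (h - p) * p) (h - p)
    have i4 := norm_add_le (h * (h - p)) ((h - p) * p)
    nlinarith [norm_nonneg (h - p), norm_nonneg h, norm_nonneg p]
  have hspec : ∀ t ∈ spectrum ℝ h, |t * t - t| ≤ 49 / 256 := by
    intro t ht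
    have e : cfc (fun t : ℝ => t * t - t) h = h * h - h := by
      rw [cfc_sub _ _ h (hcont _) (hcont _), cfc_mul _ _ h (hcont _) (hcont _), cfc_id' ℝ h]
    have := norm_apply_le_norm_cfc (fun t : ℝ => t * t - t) h ht (hcont _) hsa
    rw [e] at this
    exact this.trans hsq
  set f : ℝ → ℝ := fun t => if 1 / 2 < t then 1 else 0 with hf
  have hTc := isClosed_of_finiteDimensional T
  refine ⟨cfc f h, hTR (cfc_mem (𝕜' := ℂ) (hs := hTc) f hhT), ⟨?_, cfc_predicate f h⟩, ?_⟩
  · show cfc f h * cfc f h = cfc f h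
    rw [← cfc_mul _ _ h (hcont _) (hcont _)]
    refine cfc_congr fun t _ => ?_
    simp only [hf]
    split_ifs <;> simp
  · have e : h - cfc f h = cfc (fun t => t - f t) h := by
      rw [cfc_sub _ _ h (hcont _) (hcont _), cfc_id' ℝ h]
    -- One of `|t|`, `|t - 1|` is at least `1 / 2`, so the other is at most twice `49 / 256`.
    have b : ‖h - cfc f h‖ ≤ 49 / 128 := by
      rw [e]
      refine norm_cfc_le (by norm_num) fun t ht => ?_
      have := abs_le.1 (hspec t ht)
      rw [Real.norm_eq_abs, abs_le]
      simp only [hf]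
      split_ifs with h1
      · constructor <;> nlinarith
      · push Not at h1
        constructor <;> nlinarith
    calc ‖p - cfc f h‖ = ‖(h - cfc f h) - (h - p)‖ := by congr 1; abel
      _ ≤ _ := norm_sub_le _ _
      _ < 1 := by linarith

theorem exists_projection_eqvIn (hR : LocallyFD R) (hd : Dense (R : Set C)) {p : C}
    (hp : IsStarProjection p) : ∃ p' ∈ R, IsStarProjection p' ∧ EqvIn ⊤ p' p := by
  obtain ⟨p', h1, h2, h3⟩ := exists_projection_near hR hd hp
  obtain ⟨v, v1, v2, v3⟩ := exists_unitary_of_norm_sub_lt_one hp h2 h3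
  exact ⟨p', h1, h2, EqvIn.of_unitary hp trivial trivial v1 v2 v3⟩

/-- Approximate the partial isometry by an element of `R`, cut it down to `x = p a q`, and divide by
the square root of `star x * x` in the corner of `q`. The functional calculus takes place in a
finite-dimensional, hence closed, subalgebra, so the result stays in `R` although `R` need not be
closed. -/
theorem EqvIn.of_top (hR : LocallyFD R) (hd : Dense (R : Set C)) {p q : C}
    (hp : IsStarProjection p) (hq : IsStarProjection q) (hpR : p ∈ R) (hqR : q ∈ R)
    (h : EqvIn ⊤ p q) : EqvIn R p q := by
  obtain ⟨w, -, h1, h2⟩ := h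
  obtain ⟨a, ha, haw⟩ := exists_near hd w (show (0 : ℝ) < 1 / 8 by norm_num)
  have hp1 : star p = p := hp.isSelfAdjoint
  have hp2 : p * p = p := hp.isIdempotentElem
  have hq1 : star q = q := hq.isSelfAdjoint
  have hq2 : q * q = q := hq.isIdempotentElem
  set x := p * a * q with hx
  have hxR : x ∈ R := mul_mem (mul_mem hpR ha) hqR
  have px : p * x = x := by rw [hx, ← mul_assoc, ← mul_assoc, hp2]
  have xq : x * q = x := by rw [hx, mul_assoc, hq2]
  have xp : star x * p = star x := by have := congrArg star px; rwa [star_mul, hp1] at this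
  have qx : q * star x = star x := by have := congrArg star xq; rwa [star_mul, hq1] at this
  have hxw : ‖x - w‖ < 1 / 8 := by
    have e : x - w = p * (a - w) * q := by
      rw [mul_sub, sub_mul, mul_eq_self_of_mul_star_eq hp h1, mul_eq_self_of_star_mul_eq hq h2]
    rw [e]
    have i1 := norm_mul_le (p * (a - w)) q
    have i2 := norm_mul_le p (a - w)
    nlinarith [norm_nonneg (a - w), norm_nonneg p, norm_nonneg q, norm_projection_le hp,
      norm_projection_le hq, norm_nonneg (p * (a - w))]
  have hw1 := norm_le_one_of_star_mul_projection hq h2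
  have d1 := norm_star_mul_self_sub_le (x := x) hw1
  have d2 := norm_star_mul_self_sub_le (x := star x) (w := star w) (by rwa [norm_star])
  rw [← star_sub, norm_star, star_star, star_star, h1] at d2
  rw [h2] at d1
  have hb : 2 * ‖x - w‖ + ‖x - w‖ ^ 2 < 1 := by nlinarith [norm_nonneg (x - w)]
  -- Adding the complement turns an element invertible in the corner of `q` into one close to `1`
  -- and invertible in the whole algebra.
  set y := star x * x + (1 - q) with hy
  set z := x * star x + (1 - p) with hz
  have hy1 : ‖y - 1‖ < 1 := by
    rw [hy, show star x * x + (1 - q) - 1 = star x * x - q by abel]; linarith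
  have hz1 : IsUnit z := isUnit_of_norm_sub_one_lt (by
    rw [hz, show x * star x + (1 - p) - 1 = x * star x - p by abel]; linarith)
  have hys : IsSelfAdjoint y := (IsSelfAdjoint.star_mul_self x).add hq.one_sub.isSelfAdjoint
  have hyR : y ∈ R := add_mem (mul_mem (star_mem hxR) hxR) (sub_mem (one_mem R) hqR)
  obtain ⟨T, hTR, hT, hyT⟩ := hR.exists_mem hyR
  obtain ⟨s, hs, s1, s2, s3, s4⟩ := exists_inv_sqrt hys (spectrum_pos_of_norm_sub_one_lt hy1)
  have hs' : star s = s := hs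
  have hsR : s ∈ R := hTR (s3 T (isClosed_of_finiteDimensional T) hyT)
  have yq : y * q = star x * x := by
    rw [hy, add_mul, hq.one_sub_mul_self, mul_assoc, xq, add_zero]
  have qy : q * y = star x * x := by
    rw [hy, mul_add, hq.mul_one_sub_self, ← mul_assoc, qx, add_zero]
  have qs := (s4 q (show q * y = y * q by rw [yq, qy])).eq
  have sy := (s4 y (Commute.refl y)).eq
  have ys : y * (s * s) = 1 := by rw [← mul_assoc, sy, mul_assoc, sy, ← mul_assoc, s1]
  refine ⟨x * s, mul_mem hxR hsR, ?_, ?_⟩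
  · rw [star_mul, hs']
    refine hz1.mul_left_cancel ?_
    have zx : z * x = x * y := by
      rw [hz, hy, add_mul, mul_add, sub_mul, mul_sub, px, xq]; noncomm_ring
    have zp : z * p = x * star x := by
      rw [hz, add_mul, hp.one_sub_mul_self, mul_assoc, xp, add_zero]
    calc z * (x * s * (s * star x)) = (z * x) * (s * s) * star x := by noncomm_ring
      _ = x * (y * (s * s)) * star x := by rw [zx]; noncomm_ring
      _ = z * p := by rw [ys, zp, mul_one]
  · rw [star_mul, hs']
    calc s * star x * (x * s) = s * (star x * x) * s := by noncomm_ring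
      _ = (s * q) * y * s := by rw [← qy]; noncomm_ring
      _ = q * (s * y * s) := by rw [← qs]; noncomm_ring
      _ = q := by rw [s2, mul_one]

end EqvIn
-- Minimal projections of finite-dimensional subalgebras
section FiniteDim
variable {C : Type u} [CStarAlgebra C]

/-- A minimal projection of the star subalgebra `T`. -/
structure IsMinimalProj (T : StarSubalgebra ℂ C) (p : C) : Prop where
  mem : p ∈ T
  proj : IsStarProjection p
  ne_zero : p ≠ 0
  scalar : ∀ x ∈ T, ∃ c : ℂ, p * x * p = c • p

/-- If `p` is not minimal, some self-adjoint `h` under `p` is not a multiple of `p`; a spectral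
projection of `h` is the required proper subprojection. -/
theorem exists_subprojection {T : StarSubalgebra ℂ C} [FiniteDimensional ℂ T] {p : C}
    (hpT : p ∈ T) (hp : IsStarProjection p) (h0 : p ≠ 0) (hn : ¬ IsMinimalProj T p) :
    ∃ q ∈ T, IsStarProjection q ∧ q ≠ 0 ∧ q ≠ p ∧ p * q = q := by
  have hpp := hp.isIdempotentElem.eq
  have hps := hp.isSelfAdjoint.star_eq
  obtain ⟨h, hhT, hsa, hph, hnp⟩ : ∃ h ∈ T, IsSelfAdjoint h ∧ p * h = h ∧
      ∀ c : ℂ, h ≠ c • p := by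
    -- Otherwise the real and imaginary parts of every `p x p` would be multiples of `p`, making `p`
    -- minimal.
    by_contra! hcon
    refine hn ⟨hpT, hp, h0, fun x hx => ?_⟩
    set z := p * x * p with hz
    have hzT : z ∈ T := mul_mem (mul_mem hpT hx) hpT
    have pz : p * z = z := by rw [hz, ← mul_assoc, ← mul_assoc, hpp]
    have pz' : p * star z = star z := by
      rw [hz, star_mul, star_mul, hps, ← mul_assoc, hpp]
    obtain ⟨a, ha⟩ := hcon (z + star z) (add_mem hzT (star_mem hzT))
      (by show star _ = _; rw [star_add, star_star, add_comm]) (by rw [mul_add, pz, pz'])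
    obtain ⟨b, hb⟩ := hcon (Complex.I • (z - star z)) (T.smul_mem (sub_mem hzT (star_mem hzT)) _)
      (by show star _ = _
          rw [star_smul, star_sub, star_star, Complex.star_def, Complex.conj_I, neg_smul,
            ← smul_neg, neg_sub])
      (by rw [mul_smul_comm, mul_sub, pz, pz'])
    refine ⟨2⁻¹ * (a - Complex.I * b), ?_⟩
    have h2 : z = (2⁻¹ : ℂ) • ((z + star z) - Complex.I • (Complex.I • (z - star z))) := by
      rw [smul_smul, Complex.I_mul_I, neg_one_smul, sub_neg_eq_add,
        show z + star z + (z - star z) = (2 : ℂ) • z by rw [two_smul]; abel, smul_smul]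
      norm_num
    rw [h2, ha, hb, smul_smul, ← sub_smul, smul_smul]
  have hfin := finite_real_spectrum_of_mem hhT
  have hcont : ∀ f : ℝ → ℝ, ContinuousOn f (spectrum ℝ h) := fun f => hfin.continuousOn f
  -- The point has to be nonzero: only then is its spectral projection a multiple of `h`, and so
  -- lies under `p`.
  obtain ⟨t₀, ht₀, hne⟩ : ∃ t ∈ spectrum ℝ h, t ≠ 0 := by
    by_contra! hcon
    refine hnp 0 ?_
    rw [zero_smul, ← cfc_id' ℝ h]
    rw [← cfc_zero ℝ h]
    exact cfc_congr fun t ht => hcon t ht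
  set f : ℝ → ℝ := fun t => if t = t₀ then 1 else 0 with hf
  have hTc := isClosed_of_finiteDimensional T
  have e1 : cfc f h = h * cfc (fun t => t₀⁻¹ * f t) h := by
    conv_rhs =>
      enter [1]
      rw [← cfc_id' ℝ h]
    rw [← cfc_mul _ _ h (hcont _) (hcont _)]
    refine cfc_congr fun t _ => ?_
    simp only [hf]
    split_ifs with h1
    · rw [h1]; field_simp
    · simp
  have e2 : h * cfc f h = t₀ • cfc f h := by
    conv_lhs =>
      enter [1]
      rw [← cfc_id' ℝ h]
    rw [← cfc_mul _ _ h (hcont _) (hcont _), ← cfc_smul _ _ h (hcont _)]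
    refine cfc_congr fun t _ => ?_
    simp only [hf, smul_eq_mul]
    split_ifs with h1
    · rw [h1]
    · simp
  refine ⟨cfc f h, cfc_mem (𝕜' := ℂ) (hs := hTc) f hhT, ⟨?_, cfc_predicate f h⟩, ?_, ?_, ?_⟩
  · show cfc f h * cfc f h = cfc f h
    rw [← cfc_mul _ _ h (hcont _) (hcont _)]
    refine cfc_congr fun t _ => ?_
    simp only [hf]
    split_ifs <;> simp
  · intro h0
    have := norm_apply_le_norm_cfc f h ht₀ (hcont _) hsa
    rw [h0, norm_zero] at this
    simp only [hf, if_true, norm_one] at this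
    linarith
  · intro hq
    refine hnp (t₀ : ℂ) ?_
    have hhp : h * p = h := by
      have := congrArg star hph
      rwa [star_mul, hsa.star_eq, hps] at this
    rw [hq, hhp] at e2
    rw [e2]
    exact (Complex.coe_smul t₀ p).symm
  · rw [e1, ← mul_assoc, hph]

/-- The elements `x` of `T` with `x * p = x`. -/
def rightCorner (T : StarSubalgebra ℂ C) (p : C) : Submodule ℂ C where
  carrier := {x | x ∈ T ∧ x * p = x}
  add_mem' := fun ha hb => ⟨add_mem ha.1 hb.1, by rw [add_mul, ha.2, hb.2]⟩
  zero_mem' := ⟨zero_mem T, zero_mul p⟩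
  smul_mem' := fun c x hx => ⟨T.smul_mem hx.1 c, by rw [smul_mul_assoc, hx.2]⟩

theorem finrank_rightCorner_lt {T : StarSubalgebra ℂ C} [FiniteDimensional ℂ T] {p q : C}
    (hpT : p ∈ T) (hp : IsStarProjection p) (hne : q ≠ p) (h : q * p = q) (h' : p * q = q) :
    Module.finrank ℂ (rightCorner T q) < Module.finrank ℂ (rightCorner T p) := by
  have hfd : FiniteDimensional ℂ (Subalgebra.toSubmodule T.toSubalgebra) :=
    inferInstanceAs (FiniteDimensional ℂ T)
  have hle : rightCorner T p ≤ Subalgebra.toSubmodule T.toSubalgebra := fun x hx => hx.1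
  have : FiniteDimensional ℂ (rightCorner T p) := Submodule.finiteDimensional_of_le hle
  refine Submodule.finrank_lt_finrank_of_lt (lt_of_le_of_ne (fun x hx => ⟨hx.1, ?_⟩) ?_)
  · rw [← hx.2, mul_assoc, h]
  · intro heq
    have : p ∈ rightCorner T q := heq ▸ ⟨hpT, hp.isIdempotentElem.eq⟩
    exact hne (h'.symm.trans this.2)

/-- Induction on the dimension of `T p`, which drops strictly for both summands when `p` is split as
`q + (p - q)`. -/
theorem exists_sum_minimalProj (T : StarSubalgebra ℂ C) [FiniteDimensional ℂ T] {p : C}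
    (hpT : p ∈ T) (hp : IsStarProjection p) :
    ∃ (X : Type) (_ : Fintype X) (f : X → C), (∀ i, IsMinimalProj T (f i)) ∧
      (∀ i j, i ≠ j → f i * f j = 0) ∧ ∑ i, f i = p := by
  induction hn : Module.finrank ℂ (rightCorner T p) using Nat.strong_induction_on generalizing p with
  | _ n ih =>
    by_cases h0 : p = 0
    · exact ⟨Empty, inferInstance, Empty.elim, fun i => i.elim, fun i => i.elim, by simp [h0]⟩
    by_cases hmin : IsMinimalProj T p
    · exact ⟨Unit, inferInstance, fun _ => p, fun _ => hmin,
        fun i j hij => absurd (Subsingleton.elim i j) hij, by simp⟩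
    obtain ⟨q, hqT, hq, hq0, hqp, hpq⟩ := exists_subprojection hpT hp h0 hmin
    have hqp' : q * p = q := by
      have := congrArg star hpq
      rwa [star_mul, hq.isSelfAdjoint.star_eq, hp.isSelfAdjoint.star_eq] at this
    have hr : IsStarProjection (p - q) := hq.sub_of_mul_eq_left hp hqp'
    have hqr : q * (p - q) = 0 := by rw [mul_sub, hqp', hq.isIdempotentElem.eq, sub_self]
    obtain ⟨X, _, f, f1, f2, f3⟩ := ih _ (hn ▸ finrank_rightCorner_lt hpT hp hqp hqp' hpq)
      hqT hq rfl
    obtain ⟨Y, _, g, g1, g2, g3⟩ := ih _ (hn ▸ finrank_rightCorner_lt hpT hp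
      (by rwa [Ne, sub_eq_self]) (by rw [sub_mul, hp.isIdempotentElem.eq, hqp'])
      (by rw [mul_sub, hp.isIdempotentElem.eq, hpq])) (sub_mem hpT hqT) hr rfl
    have hfq : ∀ i, f i * q = f i := fun i => by
      classical
      rw [← f3, Finset.mul_sum, Finset.sum_eq_single i, (f1 i).proj.isIdempotentElem.eq]
      · exact fun j _ hj => f2 i j hj.symm
      · simp
    have hgq : ∀ i, (p - q) * g i = g i := fun i => by
      classical
      rw [← g3, Finset.sum_mul, Finset.sum_eq_single i, (g1 i).proj.isIdempotentElem.eq]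
      · exact fun j _ hj => g2 j i hj
      · simp
    have hfg : ∀ i j, f i * g j = 0 := fun i j => by
      rw [← hfq, ← hgq, show f i * q * ((p - q) * g j) = f i * (q * (p - q)) * g j by
        noncomm_ring, hqr]
      simp
    have hgf : ∀ i j, g j * f i = 0 := fun i j => by
      have := congrArg star (hfg i j)
      rwa [star_mul, (f1 i).proj.isSelfAdjoint.star_eq, (g1 j).proj.isSelfAdjoint.star_eq,
        star_zero] at this
    refine ⟨X ⊕ Y, inferInstance, Sum.elim f g, ?_, ?_, ?_⟩
    · rintro (i | i)
      exacts [f1 i, g1 i]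
    · rintro (i | i) (j | j) hij
      · exact f2 i j fun h => hij (by rw [h])
      · exact hfg i j
      · exact hgf j i
      · exact g2 i j fun h => hij (by rw [h])
    · rw [Fintype.sum_sum_type]
      simp only [Sum.elim_inl, Sum.elim_inr]
      rw [f3, g3]; abel

/-- For `z = p x q` minimality makes `star z * z` and `z * star z` scalar multiples of `q` and `p`.
The two scalars agree and are positive, so `z` can be rescaled to a partial isometry. -/
theorem IsMinimalProj.eqvIn {T : StarSubalgebra ℂ C} {p q x : C} (hp : IsMinimalProj T p)
    (hq : IsMinimalProj T q) (hx : x ∈ T) (h : p * x * q ≠ 0) : EqvIn T p q := by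
  have hps := hp.proj.isSelfAdjoint.star_eq
  have hqs := hq.proj.isSelfAdjoint.star_eq
  have hpp := hp.proj.isIdempotentElem.eq
  have hqq := hq.proj.isIdempotentElem.eq
  set z := p * x * q with hz
  have hzT : z ∈ T := mul_mem (mul_mem hp.mem hx) hq.mem
  have pz : p * z = z := by rw [hz, ← mul_assoc, ← mul_assoc, hpp]
  have zq : z * q = z := by rw [hz, mul_assoc, hqq]
  have zp : star z * p = star z := by have := congrArg star pz; rwa [star_mul, hps] at this
  have qz : q * star z = star z := by have := congrArg star zq; rwa [star_mul, hqs] at this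
  obtain ⟨c, hc⟩ := hq.scalar (star z * z) (mul_mem (star_mem hzT) hzT)
  obtain ⟨d, hd⟩ := hp.scalar (z * star z) (mul_mem hzT (star_mem hzT))
  rw [← mul_assoc, qz, mul_assoc, zq] at hc
  rw [← mul_assoc, pz, mul_assoc, zp] at hd
  have hcd : c = d := by
    have h1 : c • z = d • z := by
      calc c • z = z * (c • q) := by rw [mul_smul_comm, zq]
        _ = (z * star z) * z := by rw [← hc]; exact (mul_assoc _ _ _).symm
        _ = d • z := by rw [hd, smul_mul_assoc, pz]
    exact smul_left_injective ℂ h h1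
  have hc0 : c ≠ 0 := by
    rintro rfl
    rw [zero_smul] at hc
    exact h ((CStarRing.star_mul_self_eq_zero_iff z).1 hc)
  have hcr : (starRingEnd ℂ) c = c := by
    have := congrArg star hc
    rw [star_mul, star_star, star_smul, hqs, hc] at this
    exact (smul_left_injective ℂ hq.ne_zero this).symm
  obtain ⟨r, rfl⟩ := Complex.conj_eq_iff_real.1 hcr
  have hr0 : r ≠ 0 := by simpa using hc0
  have hr : 0 < r := by
    -- Since `r - star z * z` annihilates `q ≠ 0`, the number `r` lies in the spectrum of `star z *
    -- z`, which is nonnegative.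
    refine lt_of_le_of_ne (spectrum_star_mul_self_nonneg (b := z) r ?_) hr0.symm
    rw [hc, spectrum.mem_iff]
    intro hu
    refine hq.ne_zero (hu.mul_right_eq_zero.1 ?_)
    rw [sub_mul, smul_mul_assoc, hqq, Algebra.algebraMap_eq_smul_one, smul_mul_assoc, one_mul]
    exact sub_eq_zero.2 (Complex.coe_smul r q).symm
  have hs : ((Real.sqrt r)⁻¹ : ℂ) * ((Real.sqrt r)⁻¹ : ℂ) * (r : ℂ) = 1 := by
    have := Real.mul_self_sqrt hr.le
    have h2 : (Real.sqrt r : ℂ) * (Real.sqrt r : ℂ) = r := by exact_mod_cast this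
    rw [← mul_inv, h2]
    exact inv_mul_cancel₀ hc0
  have hst : star ((Real.sqrt r : ℂ)⁻¹) = (Real.sqrt r : ℂ)⁻¹ := by simp
  refine ⟨((Real.sqrt r : ℂ)⁻¹) • z, T.smul_mem hzT _, ?_, ?_⟩
  · rw [star_smul, smul_mul_smul_comm, hst, hd, ← hcd, smul_smul, hs, one_smul]
  · rw [star_smul, smul_mul_smul_comm, hst, hc, smul_smul, hs, one_smul]

end FiniteDim
-- Systems of matrix units
section MatrixUnits

/-- A complete system of matrix units in a star ring. The indices are partitioned by `c`, which
picks a representative of each part, and `e j k` is a matrix unit if `c j = c k`, and `0` if not. -/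
structure MatrixUnits {C : Type u} [Ring C] [StarRing C] {X : Type} [Fintype X] (c : X → X)
    (e : X → X → C) : Prop where
  idem : ∀ j, c (c j) = c j
  star_eq : ∀ j k, star (e j k) = e k j
  zero : ∀ j k, c j ≠ c k → e j k = 0
  mul : ∀ j k l, c j = c k → c k = c l → e j k * e k l = e j l
  mul_ne : ∀ j k k' l, k ≠ k' → e j k * e k' l = 0
  sum : ∑ j, e j j = 1

section Ring
variable {C : Type u} [Ring C] [StarRing C] {X : Type} [Fintype X] {c : X → X} {e : X → X → C}

theorem MatrixUnits.mul_cases (h : MatrixUnits c e) (j k k' l : X) :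
    e j k * e k' l = 0 ∨ e j k * e k' l = e j l := by
  by_cases hk : k = k'
  · subst hk
    by_cases h1 : c j = c k
    · by_cases h2 : c k = c l
      · exact Or.inr (h.mul j k l h1 h2)
      · left; rw [h.zero k l h2, mul_zero]
    · left; rw [h.zero j k h1, zero_mul]
  · exact Or.inl (h.mul_ne j k k' l hk)

theorem MatrixUnits.mul_left (h : MatrixUnits c e) (j k l : X) (h1 : c j = c k) :
    e j k * e k l = e j l := by
  by_cases h2 : c k = c l
  · exact h.mul j k l h1 h2
  · rw [h.zero k l h2, h.zero j l (by rwa [h1]), mul_zero]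

theorem MatrixUnits.mul_right (h : MatrixUnits c e) (j k l : X) (h1 : c k = c l) :
    e j k * e k l = e j l := by
  by_cases h2 : c j = c k
  · exact h.mul j k l h2 h1
  · rw [h.zero j k h2, h.zero j l (by rwa [← h1]), zero_mul]

theorem MatrixUnits.proj (h : MatrixUnits c e) (j : X) : IsStarProjection (e j j) :=
  ⟨h.mul j j j rfl rfl, h.star_eq j j⟩

/-- Each `w j` is a partial isometry from the representative `p (c j)` onto `p j`; going from `k` to
`j` through the common representative gives `w j * star (w k)`, and distinct representatives are
orthogonal. -/
theorem MatrixUnits.of_proj_sum {w : X → C} (hidem : ∀ j, c (c j) = c j) {p : X → C}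
    (hp : ∀ j, IsStarProjection (p j)) (hpp : ∀ j k, j ≠ k → p j * p k = 0)
    (hsum : ∑ j, p j = 1) (h1 : ∀ j, w j * star (w j) = p j)
    (h2 : ∀ j, star (w j) * w j = p (c j)) (h3 : ∀ j, p j * w j = w j)
    (h4 : ∀ j, w j * p (c j) = w j) :
    MatrixUnits c (fun j k => w j * star (w k)) where
  idem := hidem
  star_eq j k := by simp
  zero j k hjk := by
    have h5 : p (c k) * star (w k) = star (w k) := by
      have := congrArg star (h4 k)
      rwa [star_mul, (hp _).isSelfAdjoint.star_eq] at this
    rw [← h4 j, ← h5, show w j * p (c j) * (p (c k) * star (w k)) =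
      w j * (p (c j) * p (c k)) * star (w k) by noncomm_ring, hpp _ _ hjk]
    simp
  mul j k l hjk _ := by
    rw [show w j * star (w k) * (w k * star (w l)) = w j * (star (w k) * w k) * star (w l) by
      noncomm_ring, h2 k, ← hjk, h4]
  mul_ne j k k' l hk := by
    have h5 : star (w k) * p k = star (w k) := by
      have := congrArg star (h3 k)
      rwa [star_mul, (hp _).isSelfAdjoint.star_eq] at this
    rw [← h3 k', ← h5, show w j * (star (w k) * p k) * (p k' * w k' * star (w l)) =
      w j * star (w k) * (p k * p k') * (w k' * star (w l)) by noncomm_ring, hpp _ _ hk]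
    simp
  sum := by simp_rw [h1]; exact hsum

theorem MatrixUnits.eqv (h : MatrixUnits c e) (j k : X) (hjk : c j = c k) :
    e j k * star (e j k) = e j j ∧ star (e j k) * e j k = e k k := by
  rw [h.star_eq]
  exact ⟨h.mul _ _ _ hjk hjk.symm, h.mul _ _ _ hjk.symm hjk⟩

/-- Two systems of matrix units with equivalent diagonal entries are unitarily conjugate. -/
theorem MatrixUnits.exists_unitary {f : X → X → C} (hf : MatrixUnits c f) (he : MatrixUnits c e)
    {v : X → C} (h1 : ∀ i, v i * star (v i) = f i i) (h2 : ∀ i, star (v i) * v i = e i i) :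
    let u := ∑ j, f j (c j) * v (c j) * e (c j) j
    u * star u = 1 ∧ star u * u = 1 ∧ ∀ j k, u * e j k = f j k * u := by
  classical
  intro u
  have hcc := he.idem
  have hu : star u = ∑ j, e j (c j) * star (v (c j)) * f (c j) j := by
    simp only [u, star_sum, star_mul, he.star_eq, hf.star_eq, mul_assoc]
  -- Only one summand of `u` survives multiplication by a unit. Each summand moves `j` to its
  -- representative, applies `v` there, and returns; using `v` at representatives alone makes `u`
  -- compatible with the off-diagonal units.
  have right : ∀ j k, u * e j k = f j (c j) * v (c j) * e (c j) k := by
    intro j k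
    simp only [u, Finset.sum_mul]
    rw [Finset.sum_eq_single j]
    · rw [mul_assoc, he.mul_left _ _ _ (hcc j)]
    · intro i _ hij
      rw [mul_assoc, he.mul_ne _ _ _ _ hij, mul_zero]
    · simp
  have left : ∀ j k, f j k * u = f j (c k) * v (c k) * e (c k) k := by
    intro j k
    simp only [u, Finset.mul_sum]
    rw [Finset.sum_eq_single k]
    · rw [← mul_assoc, ← mul_assoc, hf.mul_right _ _ _ (hcc k).symm]
    · intro i _ hik
      rw [← mul_assoc, ← mul_assoc, hf.mul_ne _ _ _ _ hik.symm, zero_mul, zero_mul]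
    · simp
  have hv : ∀ i, v i * e i i * star (v i) = f i i := fun i => by
    rw [← h2, show v i * (star (v i) * v i) * star (v i) = v i * star (v i) * (v i * star (v i)) by
      noncomm_ring, h1, (hf.proj i).isIdempotentElem.eq]
  have hv' : ∀ i, star (v i) * f i i * v i = e i i := fun i => by
    rw [← h1, show star (v i) * (v i * star (v i)) * v i = star (v i) * v i * (star (v i) * v i) by
      noncomm_ring, h2, (he.proj i).isIdempotentElem.eq]
  refine ⟨?_, ?_, ?_⟩
  · rw [hu, Finset.mul_sum]
    rw [← hf.sum]
    refine Finset.sum_congr rfl fun j _ => ?_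
    rw [← mul_assoc, ← mul_assoc, right, mul_assoc (f j (c j)), mul_assoc (f j (c j)), hv,
      hf.mul_right _ _ _ rfl, hf.mul_right _ _ _ (hcc j)]
  · have : star u * u = ∑ j, e j (c j) * star (v (c j)) * (f (c j) j * u) := by
      rw [hu, Finset.sum_mul]
      exact Finset.sum_congr rfl fun j _ => mul_assoc _ _ _
    rw [this, ← he.sum]
    refine Finset.sum_congr rfl fun j _ => ?_
    rw [left, show e j (c j) * star (v (c j)) * (f (c j) (c j) * v (c j) * e (c j) j) =
      e j (c j) * (star (v (c j)) * f (c j) (c j) * v (c j)) * e (c j) j by noncomm_ring, hv',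
      he.mul_right _ _ _ rfl, he.mul_right _ _ _ (hcc j)]
  · intro j k
    rw [right, left]
    by_cases hjk : c j = c k
    · rw [hjk]
    · rw [he.zero (c j) k (by rwa [hcc]), hf.zero j (c k) (by rwa [hcc]), mul_zero, zero_mul,
        zero_mul]

end Ring

section Algebra
variable {C : Type u} [CStarAlgebra C] {X : Type} [Fintype X] {c : X → X} {e : X → X → C}

/-- The star subalgebra spanned by a system of matrix units. -/
noncomputable def MatrixUnits.span (h : MatrixUnits c e) : StarSubalgebra ℂ C where
  toSubalgebra := (Submodule.span ℂ (Set.range fun x : X × X => e x.1 x.2)).toSubalgebra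
    (by rw [← h.sum]
        exact Submodule.sum_mem _ fun j _ => Submodule.subset_span ⟨(j, j), rfl⟩)
    (by intro x y hx hy
        refine Submodule.span_induction₂ (p := fun x y _ _ => x * y ∈ _) ?_ ?_ ?_ ?_ ?_ ?_ ?_ hx hy
        · rintro _ _ ⟨⟨j, k⟩, rfl⟩ ⟨⟨k', l⟩, rfl⟩
          rcases h.mul_cases j k k' l with h0 | h0
          · simp only [h0]; exact Submodule.zero_mem _
          · simp only [h0]; exact Submodule.subset_span ⟨(j, l), rfl⟩
        · intro y _; rw [zero_mul]; exact Submodule.zero_mem _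
        · intro y _; rw [mul_zero]; exact Submodule.zero_mem _
        · intro x y z _ _ _ h1 h2; rw [add_mul]; exact Submodule.add_mem _ h1 h2
        · intro x y z _ _ _ h1 h2; rw [mul_add]; exact Submodule.add_mem _ h1 h2
        · intro r x y _ _ h1; rw [smul_mul_assoc]; exact Submodule.smul_mem _ _ h1
        · intro r x y _ _ h1; rw [mul_smul_comm]; exact Submodule.smul_mem _ _ h1)
  star_mem' := by
    intro x hx
    refine Submodule.span_induction (p := fun x _ => star x ∈ Submodule.span ℂ
      (Set.range fun x : X × X => e x.1 x.2)) ?_ ?_ ?_ ?_ hx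
    · rintro _ ⟨⟨j, k⟩, rfl⟩
      simp only [h.star_eq]
      exact Submodule.subset_span ⟨(k, j), rfl⟩
    · rw [star_zero]; exact Submodule.zero_mem _
    · intro x y _ _ h1 h2; rw [star_add]; exact Submodule.add_mem _ h1 h2
    · intro r x _ h1; rw [star_smul]; exact Submodule.smul_mem _ _ h1

theorem MatrixUnits.mem_span (h : MatrixUnits c e) {x : C} :
    x ∈ h.span ↔ x ∈ Submodule.span ℂ (Set.range fun x : X × X => e x.1 x.2) := Iff.rfl

theorem MatrixUnits.unit_mem_span (h : MatrixUnits c e) (j k : X) : e j k ∈ h.span :=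
  Submodule.subset_span ⟨(j, k), rfl⟩

theorem MatrixUnits.finiteDimensional_span (h : MatrixUnits c e) : FiniteDimensional ℂ h.span :=
  FiniteDimensional.span_of_finite ℂ (Set.finite_range fun x : X × X => e x.1 x.2)

theorem MatrixUnits.span_le (h : MatrixUnits c e) {T : StarSubalgebra ℂ C}
    (hT : ∀ j k, e j k ∈ T) : h.span ≤ T := by
  intro x hx
  have : Submodule.span ℂ (Set.range fun x : X × X => e x.1 x.2) ≤
      Subalgebra.toSubmodule T.toSubalgebra := by
    rw [Submodule.span_le]
    rintro _ ⟨⟨j, k⟩, rfl⟩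
    exact hT j k
  exact this hx

theorem MatrixUnits.exists_coeff (h : MatrixUnits c e) {x : C} (hx : x ∈ h.span) :
    ∃ M : X → X → ℂ, x = ∑ j, ∑ k, M j k • e j k := by
  rw [h.mem_span, Submodule.mem_span_range_iff_exists_fun] at hx
  obtain ⟨M, hM⟩ := hx
  exact ⟨fun j k => M (j, k), by rw [← hM, Fintype.sum_prod_type]⟩

theorem MatrixUnits.corner (h : MatrixUnits c e) (M : X → X → ℂ) (j k : X) :
    e j j * (∑ j, ∑ k, M j k • e j k) * e k k = M j k • e j k := by
  classical
  rw [Finset.mul_sum, Finset.sum_eq_single j, Finset.mul_sum, Finset.sum_mul,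
    Finset.sum_eq_single k]
  · rw [mul_smul_comm, smul_mul_assoc, h.mul_left _ _ _ rfl, h.mul_right _ _ _ rfl]
  · intro i _ hi
    rw [mul_smul_comm, smul_mul_assoc, h.mul_left _ _ _ rfl, h.mul_ne _ _ _ _ hi, smul_zero]
  · simp
  · intro i _ hi
    rw [Finset.mul_sum]
    refine Finset.sum_eq_zero fun l _ => ?_
    rw [mul_smul_comm, h.mul_ne _ _ _ _ hi.symm, smul_zero]
  · simp

/-- A coefficient of the zero element vanishes wherever the matrix unit is meant to be nonzero. -/
theorem MatrixUnits.coeff_eq_zero (h : MatrixUnits c e) (h0 : ∀ j, e j j ≠ 0) {M : X → X → ℂ}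
    (hM : ∑ j, ∑ k, M j k • e j k = 0) {j k : X} (hjk : c j = c k) : M j k = 0 := by
  have h1 := h.corner M j k
  rw [hM, mul_zero, zero_mul] at h1
  rcases smul_eq_zero.1 h1.symm with h2 | h2
  · exact h2
  · refine absurd ?_ (h0 j)
    rw [← h.mul j k j hjk hjk.symm, h2, zero_mul]

/-- Decompose `1` into minimal projections and group them by equivalence in `T`. Corners `p j * x *
p k` between inequivalent minimal projections vanish, and between equivalent ones they are
one-dimensional, so the units exhaust `T`. -/
theorem exists_matrixUnits (T : StarSubalgebra ℂ C) [FiniteDimensional ℂ T] :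
    ∃ (X : Type) (_ : Fintype X) (c : X → X) (e : X → X → C) (h : MatrixUnits c e),
      h.span = T ∧ ∀ j, IsMinimalProj T (e j j) := by
  classical
  obtain ⟨X, _, p, hp, hpp, hsum⟩ := exists_sum_minimalProj T (one_mem T) (IsStarProjection.one C)
  have hproj := fun j => (hp j).proj
  let s : Setoid X :=
    { r := fun j k => EqvIn T (p j) (p k)
      iseqv := ⟨fun j => EqvIn.refl (hproj j) (hp j).mem, fun h => h.symm,
        fun {j _ l} h h' => h.trans (hproj j) (hproj l) h'⟩ }
  let c : X → X := fun j => (Quotient.mk s j).out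
  have hc : ∀ j, EqvIn T (p j) (p (c j)) := fun j => (Quotient.mk_out (s := s) j).symm
  have hcc : ∀ j k, c j = c k ↔ EqvIn T (p j) (p k) := by
    intro j k
    constructor
    · intro h
      have h1 := hc j
      rw [h] at h1
      exact h1.trans (hproj j) (hproj k) (hc k).symm
    · intro h
      simp only [c]
      rw [Quotient.sound (s := s) h]
  choose w hwT h1 h2 using hc
  have h3 : ∀ j, p j * w j = w j := fun j => mul_eq_self_of_mul_star_eq (hproj j) (h1 j)
  have h4 : ∀ j, w j * p (c j) = w j := fun j => mul_eq_self_of_star_mul_eq (hproj _) (h2 j)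
  have hidem : ∀ j, c (c j) = c j := fun j => (hcc _ _).2 ⟨star (w j), star_mem (hwT j),
    by rw [star_star, h2], by rw [star_star, h1]⟩
  have hMU := MatrixUnits.of_proj_sum hidem hproj hpp hsum h1 h2 h3 h4
  refine ⟨X, inferInstance, c, _, hMU, le_antisymm ?_ ?_, ?_⟩
  · exact hMU.span_le fun j k => mul_mem (hwT j) (star_mem (hwT k))
  · intro x hx
    have hx' : x = ∑ j, ∑ k, p j * x * p k := by
      simp_rw [← Finset.mul_sum, hsum, mul_one, ← Finset.sum_mul, hsum, one_mul]
    rw [hx']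
    refine sum_mem fun j _ => sum_mem fun k _ => ?_
    by_cases hjk : c j = c k
    · obtain ⟨l, hl⟩ := (hp (c j)).scalar (star (w j) * x * w k)
        (mul_mem (mul_mem (star_mem (hwT j)) hx) (hwT k))
      have : p j * x * p k = l • (w j * star (w k)) := by
        calc p j * x * p k = (w j * star (w j)) * x * (w k * star (w k)) := by rw [h1, h1]
          _ = (w j * p (c j)) * star (w j) * x * (w k * p (c k)) * star (w k) := by
            rw [h4, h4]; noncomm_ring
          _ = w j * (p (c j) * (star (w j) * x * w k) * p (c j)) * star (w k) := by
            rw [hjk]; noncomm_ring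
          _ = l • (w j * p (c j) * star (w k)) := by
            rw [hl, mul_smul_comm, smul_mul_assoc]
          _ = _ := by rw [h4]
      rw [this]
      exact hMU.span.smul_mem (hMU.unit_mem_span j k) l
    · have : p j * x * p k = 0 := by
        by_contra h0
        exact hjk ((hcc _ _).2 ((hp j).eqvIn (hp k) hx h0))
      rw [this]
      exact zero_mem _
  · intro j
    simp only [h1]
    exact hp j

/-- A projection of the span decomposes into projections equivalent to the diagonal
units. -/
theorem exists_proj_decomposition {T : StarSubalgebra ℂ C} [FiniteDimensional ℂ T]
    (h : MatrixUnits c e) (hmin : ∀ j, IsMinimalProj T (e j j)) {p : C}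
    (hpT : p ∈ T) (hp : IsStarProjection p) :
    ∃ (Y : Type) (_ : Fintype Y) (f : Y → C) (κ : Y → X), (∀ y, IsStarProjection (f y)) ∧
      (∀ y z, y ≠ z → f y * f z = 0) ∧ ∑ y, f y = p ∧
      ∀ y, EqvIn T (f y) (e (κ y) (κ y)) := by
  obtain ⟨Y, _, f, f1, f2, f3⟩ := exists_sum_minimalProj T hpT hp
  have : ∀ y, ∃ k, EqvIn T (f y) (e k k) := by
    intro y
    by_contra! hcon
    refine (f1 y).ne_zero ?_
    have h0 : ∀ k, f y * 1 * e k k = 0 := fun k => by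
      by_contra hne
      exact hcon k ((f1 y).eqvIn (hmin k) (one_mem T) hne)
    rw [← mul_one (f y), ← h.sum, Finset.mul_sum]
    exact Finset.sum_eq_zero fun k _ => by simpa using h0 k
  choose κ hκ using this
  exact ⟨Y, inferInstance, f, κ, fun y => (f1 y).proj, f2, f3, hκ⟩

end Algebra
end MatrixUnits
-- Cancellation, and passage to matrix algebras
open Matrix

/-- Take complements of `r + p` and `r + q`, add `r` to get `1 - p` and `1 - q`, and take
complements again. -/
theorem EqvIn.cancel {C : Type u} [CStarAlgebra C]
    (hd : ∀ (w : C) (ε : ℝ), 0 < ε → ∃ x : C, IsUnit x ∧ ‖x - w‖ < ε) {p q r : C}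
    (hp : IsStarProjection p) (hq : IsStarProjection q) (hr : IsStarProjection r)
    (hrp : r * p = 0) (hrq : r * q = 0) (h : EqvIn ⊤ (r + p) (r + q)) : EqvIn ⊤ p q := by
  have h1 := h.one_sub hd (hr.add hp hrp) (hr.add hq hrq)
  have h2 := EqvIn.add hr (hr.add hp hrp).one_sub hr (hr.add hq hrq).one_sub
    (by rw [mul_sub, mul_add, hr.isIdempotentElem.eq, hrp]; simp)
    (by rw [mul_sub, mul_add, hr.isIdempotentElem.eq, hrq]; simp)
    (EqvIn.refl (R := ⊤) hr trivial) h1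
  rw [show r + (1 - (r + p)) = 1 - p by abel, show r + (1 - (r + q)) = 1 - q by abel] at h2
  have h3 := h2.one_sub hd hp.one_sub hq.one_sub
  rwa [sub_sub_cancel, sub_sub_cancel] at h3

section MatrixAlg
variable {B : Type u} [CStarAlgebra B]

/-- All entries of the matrix lie in `R`. -/
def EntriesIn {m n : Type} (R : StarSubalgebra ℂ B) (M : Matrix m n B) : Prop :=
  ∀ i j, M i j ∈ R

theorem EntriesIn.mul {l m n : Type} [Fintype m] {R : StarSubalgebra ℂ B} {M : Matrix l m B}
    {N : Matrix m n B} (hM : EntriesIn R M) (hN : EntriesIn R N) : EntriesIn R (M * N) := by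
  intro i j
  rw [Matrix.mul_apply]
  exact sum_mem fun k _ => mul_mem (hM i k) (hN k j)

theorem EntriesIn.conjTranspose {m n : Type} {R : StarSubalgebra ℂ B} {M : Matrix m n B}
    (hM : EntriesIn R M) : EntriesIn R Mᴴ :=
  fun i j => star_mem (hM j i)

noncomputable section
attribute [local instance] CStarAlgebra.spectralOrder CStarAlgebra.spectralOrderedRing

/-- The star subalgebra of the matrices with entries in `R`. -/
def matSub (R : StarSubalgebra ℂ B) (n : Type) [Fintype n] [DecidableEq n] :
    StarSubalgebra ℂ (CStarMatrix n n B) where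
  carrier := {M | ∀ i j, M i j ∈ R}
  mul_mem' := fun {M N} hM hN i j => by
    rw [CStarMatrix.mul_apply]
    exact sum_mem fun k _ => mul_mem (hM i k) (hN k j)
  add_mem' := fun hM hN i j => add_mem (hM i j) (hN i j)
  algebraMap_mem' := fun r i j => by
    rw [CStarMatrix.algebraMap_apply]
    split_ifs
    · exact R.algebraMap_mem r
    · exact zero_mem R
  star_mem' := fun hM i j => star_mem (hM j i)

theorem LocallyFD.matSub {R : StarSubalgebra ℂ B} (hR : LocallyFD R) (n : Type) [Fintype n]
    [DecidableEq n] : LocallyFD (matSub R n) := by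
  intro s hs hsR
  obtain ⟨T, hTR, hT, hsT⟩ := hR (⋃ M ∈ s, ⋃ i, ⋃ j, {M i j})
    (hs.biUnion fun M _ => Set.finite_iUnion fun i => Set.finite_iUnion fun j =>
      Set.finite_singleton _)
    (by
      simp only [Set.iUnion_subset_iff, Set.singleton_subset_iff]
      exact fun M hM i j => hsR hM i j)
  refine ⟨AFK0.matSub T n, fun M hM i j => hTR (hM i j), ?_, fun M hM i j => hsT ?_⟩
  · let f : AFK0.matSub T n →ₗ[ℂ] (n → n → T) :=
      { toFun := fun M i j => ⟨M.1 i j, M.2 i j⟩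
        map_add' := fun _ _ => rfl
        map_smul' := fun _ _ => rfl }
    refine FiniteDimensional.of_injective f fun M N h => ?_
    apply Subtype.ext
    ext i j
    exact congrArg Subtype.val (congrFun (congrFun h i) j)
  · simp only [Set.mem_iUnion]
    exact ⟨M, hM, i, j, rfl⟩

theorem dense_matSub {R : StarSubalgebra ℂ B} (hR : Dense (R : Set B)) (n : Type) [Fintype n]
    [DecidableEq n] : Dense (matSub R n : Set (CStarMatrix n n B)) := by
  have h1 : Dense (Set.pi Set.univ fun _ : n => Set.pi Set.univ fun _ : n => (R : Set B)) :=
    dense_pi _ fun _ _ => dense_pi _ fun _ _ => hR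
  have h2 : (Set.pi Set.univ fun _ : n => Set.pi Set.univ fun _ : n => (R : Set B)) =
      (matSub R n : Set (CStarMatrix n n B)) := by
    ext M
    simp only [Set.mem_pi, Set.mem_univ, true_implies]
    rfl
  rw [h2] at h1
  exact h1

/-- `CStarMatrix` is `Matrix` equipped with the C*-norm. This identification lets the C*-algebraic
lemmas speak about the purely algebraic relation `MvN` that defines `V`. -/
theorem mvN_iff_eqvIn {n : Type} [Fintype n] [DecidableEq n] {p q : Matrix n n B} :
    MvN p q ↔ EqvIn (⊤ : StarSubalgebra ℂ (CStarMatrix n n B)) p q :=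
  ⟨fun ⟨w, h1, h2⟩ => ⟨w, trivial, h1, h2⟩, fun ⟨w, _, h1, h2⟩ => ⟨w, h1, h2⟩⟩

theorem MvN.exists_normalized {R : StarSubalgebra ℂ B} (hR : LocallyFD R)
    (hd : Dense (R : Set B)) {n : Type} [Fintype n] [DecidableEq n] {p q : Matrix n n B}
    (hp : IsStarProjection p) (hq : IsStarProjection q) (hpR : EntriesIn R p)
    (hqR : EntriesIn R q) (h : MvN p q) :
    ∃ w : Matrix n n B, EntriesIn R w ∧ w * wᴴ = p ∧ wᴴ * w = q ∧ p * w = w ∧ w * q = w := by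
  have hp' : IsStarProjection (p : CStarMatrix n n B) := ⟨hp.1, hp.2⟩
  have hq' : IsStarProjection (q : CStarMatrix n n B) := ⟨hq.1, hq.2⟩
  obtain ⟨w, h1, h2, h3⟩ := EqvIn.of_top (hR.matSub n) (dense_matSub hd n) hp' hq' hpR hqR
    (mvN_iff_eqvIn.1 h)
  exact ⟨w, h1, h2, h3, mul_eq_self_of_mul_star_eq hp' h2, mul_eq_self_of_star_mul_eq hq' h3⟩

theorem exists_matProjection_entriesIn {R : StarSubalgebra ℂ B} (hR : LocallyFD R)
    (hd : Dense (R : Set B)) {n : Type} [Fintype n] [DecidableEq n] {p : Matrix n n B}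
    (hp : IsStarProjection p) :
    ∃ q : Matrix n n B, EntriesIn R q ∧ IsStarProjection q ∧ MvN q p := by
  have hp' : IsStarProjection (p : CStarMatrix n n B) := ⟨hp.1, hp.2⟩
  obtain ⟨q, h1, h2, h3⟩ := exists_projection_eqvIn (hR.matSub n) (dense_matSub hd n) hp'
  exact ⟨q, h1, ⟨h2.1, h2.2⟩, mvN_iff_eqvIn.2 h3⟩

theorem MvN.cancel {R : StarSubalgebra ℂ B} (hR : LocallyFD R)
    (hd : Dense (R : Set B)) {n : Type} [Fintype n] [DecidableEq n] {p q r : Matrix n n B}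
    (hp : IsStarProjection p) (hq : IsStarProjection q) (hr : IsStarProjection r)
    (hrp : r * p = 0) (hrq : r * q = 0) (h : MvN (r + p) (r + q)) : MvN p q := by
  have hp' : IsStarProjection (p : CStarMatrix n n B) := ⟨hp.1, hp.2⟩
  have hq' : IsStarProjection (q : CStarMatrix n n B) := ⟨hq.1, hq.2⟩
  have hr' : IsStarProjection (r : CStarMatrix n n B) := ⟨hr.1, hr.2⟩
  rw [mvN_iff_eqvIn] at h ⊢
  exact EqvIn.cancel (exists_isUnit_near (hR.matSub n) (dense_matSub hd n)) hp' hq' hr' hrp hrq h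

end
end MatrixAlg
-- Classes of matrix projections in `K₀`
section KClass
variable {B : Type u} [CStarAlgebra B]

/-- The matrix of the map of free modules induced by a map of index sets. -/
def indexMatrix (B : Type u) [CStarAlgebra B] {m n : Type} [DecidableEq n] (f : m → n) :
    Matrix n m B :=
  (1 : Matrix n n B).submatrix id f

theorem entriesIn_indexMatrix {m n : Type} [DecidableEq n] (R : StarSubalgebra ℂ B) (f : m → n) :
    EntriesIn R (indexMatrix B f) := by
  intro i j
  simp only [indexMatrix, submatrix_apply, Matrix.one_apply]
  split_ifs
  exacts [one_mem R, zero_mem R]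

section indexMatrix
variable {l m n : Type} [DecidableEq n] [Fintype n]

theorem indexMatrix_conjTranspose_mul_of_disjoint (f : m → n) (g : l → n)
    (h : ∀ i j, f i ≠ g j) : (indexMatrix B f)ᴴ * indexMatrix B g = 0 := by
  rw [indexMatrix, indexMatrix, conjTranspose_submatrix, conjTranspose_one,
    ← submatrix_mul _ _ f id g Function.bijective_id, mul_one]
  ext i j
  exact Matrix.one_apply_ne (h i j)

theorem indexMatrix_conjTranspose_mul_self [DecidableEq m] (f : m → n)
    (h : Function.Injective f) : (indexMatrix B f)ᴴ * indexMatrix B f = 1 := by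
  rw [indexMatrix, conjTranspose_submatrix, conjTranspose_one,
    ← submatrix_mul _ _ f id f Function.bijective_id, mul_one, submatrix_one _ h]

theorem isStarProjection_pad [Fintype m] [DecidableEq m] {f : m → n} (hf : Function.Injective f)
    {p : Matrix m m B} (hp : IsStarProjection p) :
    IsStarProjection (indexMatrix B f * p * (indexMatrix B f)ᴴ) := by
  have h1 : pᴴ = p := hp.isSelfAdjoint
  have h2 : p * p = p := hp.isIdempotentElem
  have h3 := indexMatrix_conjTranspose_mul_self (B := B) f hf
  constructor
  · show indexMatrix B f * p * (indexMatrix B f)ᴴ * (indexMatrix B f * p * (indexMatrix B f)ᴴ) = _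
    calc _ = indexMatrix B f * p * ((indexMatrix B f)ᴴ * indexMatrix B f) * p *
        (indexMatrix B f)ᴴ := by simp only [Matrix.mul_assoc]
      _ = indexMatrix B f * (p * p) * (indexMatrix B f)ᴴ := by
        rw [h3, Matrix.mul_one]; simp only [Matrix.mul_assoc]
      _ = _ := by rw [h2]
  · show (indexMatrix B f * p * (indexMatrix B f)ᴴ)ᴴ = _
    rw [conjTranspose_mul, conjTranspose_mul, conjTranspose_conjTranspose, h1, Matrix.mul_assoc]

theorem mvN_pad [Fintype m] [DecidableEq m] {f : m → n} (hf : Function.Injective f)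
    {p : Matrix m m B} (hp : IsStarProjection p) :
    MvN (indexMatrix B f * p * (indexMatrix B f)ᴴ) p := by
  have h1 : pᴴ = p := hp.isSelfAdjoint
  have h2 : p * p = p := hp.isIdempotentElem
  have h3 := indexMatrix_conjTranspose_mul_self (B := B) f hf
  refine ⟨indexMatrix B f * p, ?_, ?_⟩
  · rw [conjTranspose_mul, h1]
    calc indexMatrix B f * p * (p * (indexMatrix B f)ᴴ) =
        indexMatrix B f * (p * p) * (indexMatrix B f)ᴴ := by simp only [Matrix.mul_assoc]
      _ = _ := by rw [h2]
  · rw [conjTranspose_mul, h1]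
    calc p * (indexMatrix B f)ᴴ * (indexMatrix B f * p) =
        p * ((indexMatrix B f)ᴴ * indexMatrix B f) * p := by simp only [Matrix.mul_assoc]
      _ = p := by rw [h3, Matrix.mul_one, h2]

end indexMatrix

/-- The class in `K₀(B)` of a projection in a matrix algebra (`0` for other matrices). -/
noncomputable def kclass {n : Type} [Fintype n] (p : Matrix n n B) : K0 B :=
  open Classical in
  if hp : IsStarProjection p then
    Algebra.GrothendieckAddGroup.of (V.mk ⟨Fintype.card n,
      p.submatrix (Fintype.equivFin n).symm (Fintype.equivFin n).symm,
      isStarProjection_submatrix hp _⟩)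
  else 0

theorem kclass_eq_of_mvN {n : Type} [Fintype n] {p : Matrix n n B} (hp : IsStarProjection p)
    (P : MatProj B) (h : MvN p P.mat) :
    kclass p = Algebra.GrothendieckAddGroup.of (V.mk P) := by
  rw [kclass, dif_pos hp]
  congr 1
  exact V.mk_eq ((MvN.submatrix hp _).symm.trans (isStarProjection_submatrix hp _) P.isProj h)

theorem kclass_mat (P : MatProj B) :
    kclass P.mat = Algebra.GrothendieckAddGroup.of (V.mk P) :=
  kclass_eq_of_mvN P.isProj P (MvN.refl P.isProj)

theorem exists_matProj {n : Type} [Fintype n] {p : Matrix n n B} (hp : IsStarProjection p) :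
    ∃ P : MatProj B, MvN p P.mat ∧ kclass p = Algebra.GrothendieckAddGroup.of (V.mk P) := by
  have h := MvN.submatrix hp (Fintype.equivFin n).symm
  exact ⟨⟨_, _, isStarProjection_submatrix hp _⟩, h, kclass_eq_of_mvN hp _ h⟩

theorem MvN.kclass_eq {m n : Type} [Fintype m] [Fintype n] {p : Matrix m m B} {q : Matrix n n B}
    (hp : IsStarProjection p) (hq : IsStarProjection q) (h : MvN p q) : kclass p = kclass q := by
  obtain ⟨Q, h1, h2⟩ := exists_matProj hq
  rw [h2]
  exact kclass_eq_of_mvN hp Q (h.trans hp Q.isProj h1)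

theorem kclass_mem_K0Pos {n : Type} [Fintype n] {p : Matrix n n B} (hp : IsStarProjection p) :
    kclass p ∈ K0Pos B := by
  obtain ⟨P, -, h⟩ := exists_matProj hp
  exact ⟨_, h.symm⟩

theorem mvN_add_fromBlocks {n : Type} [Fintype n] {p q : Matrix n n B} (hp : IsStarProjection p)
    (hq : IsStarProjection q) (h : p * q = 0) : MvN (p + q) (fromBlocks p 0 0 q) := by
  have h1 : pᴴ = p := hp.isSelfAdjoint
  have h2 : p * p = p := hp.isIdempotentElem
  have h3 : qᴴ = q := hq.isSelfAdjoint
  have h4 : q * q = q := hq.isIdempotentElem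
  have h' : q * p = 0 := by
    have := congrArg conjTranspose h
    rwa [conjTranspose_mul, h1, h3, conjTranspose_zero] at this
  refine ⟨fromCols p q, ?_, ?_⟩
  · rw [conjTranspose_fromCols_eq_fromRows_conjTranspose, fromCols_mul_fromRows, h1, h2, h3, h4]
  · rw [conjTranspose_fromCols_eq_fromRows_conjTranspose, fromRows_mul_fromCols, h1, h2, h3, h4,
      h, h']

theorem kclass_fromBlocks {m n : Type} [Fintype m] [Fintype n] {p : Matrix m m B}
    {q : Matrix n n B} (hp : IsStarProjection p) (hq : IsStarProjection q) :
    kclass (fromBlocks p 0 0 q) = kclass p + kclass q := by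
  obtain ⟨P, h1, h2⟩ := exists_matProj hp
  obtain ⟨Q, h3, h4⟩ := exists_matProj hq
  have hpq := isStarProjection_fromBlocks hp hq
  rw [h2, h4, ← map_add]
  exact kclass_eq_of_mvN hpq (P.diag Q) ((h1.fromBlocks h3).trans hpq (P.diag Q).isProj
    (P.mvN_diag Q))

theorem kclass_add {n : Type} [Fintype n] {p q : Matrix n n B} (hp : IsStarProjection p)
    (hq : IsStarProjection q) (h : p * q = 0) : kclass (p + q) = kclass p + kclass q := by
  rw [← kclass_fromBlocks hp hq]
  exact (mvN_add_fromBlocks hp hq h).kclass_eq (hp.add hq h) (isStarProjection_fromBlocks hp hq)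

theorem kclass_zero {n : Type} [Fintype n] : kclass (0 : Matrix n n B) = 0 := by
  have h := kclass_add (IsStarProjection.zero (Matrix n n B)) (IsStarProjection.zero _)
    (mul_zero _)
  rw [add_zero] at h
  exact left_eq_add.1 h

theorem isStarProjection_sum {C ι : Type*} [Ring C] [StarRing C] (s : Finset ι) {p : ι → C}
    (hp : ∀ i, IsStarProjection (p i)) (hpp : ∀ i j, i ≠ j → p i * p j = 0) :
    IsStarProjection (∑ i ∈ s, p i) := by
  classical
  induction s using Finset.induction_on with
  | empty => simp
  | insert a s ha ih =>
    rw [Finset.sum_insert ha]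
    refine (hp a).add ih ?_
    rw [Finset.mul_sum]
    exact Finset.sum_eq_zero fun i hi => hpp _ _ fun h => ha (h ▸ hi)

theorem kclass_sum {ι n : Type} [Fintype n] (s : Finset ι) {p : ι → Matrix n n B}
    (hp : ∀ i, IsStarProjection (p i)) (hpp : ∀ i j, i ≠ j → p i * p j = 0) :
    kclass (∑ i ∈ s, p i) = ∑ i ∈ s, kclass (p i) := by
  classical
  induction s using Finset.induction_on with
  | empty => simp [kclass_zero]
  | insert a s ha ih =>
    rw [Finset.sum_insert ha, Finset.sum_insert ha, ← ih]
    refine kclass_add (hp a) (isStarProjection_sum s hp hpp) ?_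
    rw [Finset.mul_sum]
    exact Finset.sum_eq_zero fun i hi => hpp _ _ fun h => ha (h ▸ hi)

/-- Equal classes in the Grothendieck group agree in `V` after adding some `r`. Realizing `r`, `p`
and `q` in one matrix algebra, with `r` orthogonal to the other two, allows `r` to be cancelled
there. -/
theorem exists_mvN_of_kclass_eq {R : StarSubalgebra ℂ B} (hR : LocallyFD R)
    (hd : Dense (R : Set B)) {m n : Type} [Fintype m] [Fintype n] [DecidableEq m] [DecidableEq n]
    {p : Matrix m m B} {q : Matrix n n B}
    (hp : IsStarProjection p) (hq : IsStarProjection q) (hpR : EntriesIn R p)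
    (hqR : EntriesIn R q) (h : kclass p = kclass q) :
    ∃ w : Matrix m n B, EntriesIn R w ∧ w * wᴴ = p ∧ wᴴ * w = q := by
  obtain ⟨P, hP1, hP2⟩ := exists_matProj hp
  obtain ⟨Q, hQ1, hQ2⟩ := exists_matProj hq
  rw [hP2, hQ2] at h
  obtain ⟨⟨r, _⟩, hr⟩ := ((AddLocalization.addMonoidOf
    (⊤ : AddSubmonoid (V B))).eq_iff_exists).1 h
  obtain ⟨r, rfl⟩ := Quotient.exists_rep r
  have hrPQ : MvN (r.diag P).mat (r.diag Q).mat := Quotient.exact hr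
  have hrp := isStarProjection_fromBlocks r.isProj hp
  have hrq := isStarProjection_fromBlocks r.isProj hq
  have hblocks : MvN (fromBlocks r.mat 0 0 p) (fromBlocks r.mat 0 0 q) := by
    have a1 := ((MvN.refl r.isProj).fromBlocks hP1).trans hrp (r.diag P).isProj (r.mvN_diag P)
    have a2 := ((MvN.refl r.isProj).fromBlocks hQ1).trans hrq (r.diag Q).isProj (r.mvN_diag Q)
    exact (a1.trans hrp (r.diag Q).isProj hrPQ).trans hrp hrq a2.symm
  -- Three disjoint diagonal blocks: one for `r`, one for `p`, one for `q`.
  let fr : Fin r.size → Fin r.size ⊕ (m ⊕ n) := Sum.inl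
  let fp : m → Fin r.size ⊕ (m ⊕ n) := Sum.inr ∘ Sum.inl
  let fq : n → Fin r.size ⊕ (m ⊕ n) := Sum.inr ∘ Sum.inr
  have ir : Function.Injective fr := Sum.inl_injective
  have ip : Function.Injective fp := Sum.inr_injective.comp Sum.inl_injective
  have iq : Function.Injective fq := Sum.inr_injective.comp Sum.inr_injective
  have orp : (indexMatrix B fr)ᴴ * indexMatrix B fp = 0 :=
    indexMatrix_conjTranspose_mul_of_disjoint _ _ (by simp [fr, fp])
  have orq : (indexMatrix B fr)ᴴ * indexMatrix B fq = 0 :=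
    indexMatrix_conjTranspose_mul_of_disjoint _ _ (by simp [fr, fq])
  have jp := indexMatrix_conjTranspose_mul_self (B := B) fp ip
  have jq := indexMatrix_conjTranspose_mul_self (B := B) fq iq
  have pr := isStarProjection_pad ir r.isProj
  have pp := isStarProjection_pad ip hp
  have pq := isStarProjection_pad iq hq
  have mr := mvN_pad ir r.isProj
  have mp := mvN_pad ip hp
  have mq := mvN_pad iq hq
  have ep := entriesIn_indexMatrix R fp
  have eq := entriesIn_indexMatrix R fq
  generalize indexMatrix B fr = Jr at *
  generalize indexMatrix B fp = Jp at *
  generalize indexMatrix B fq = Jq at *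
  have zrp : Jr * r.mat * Jrᴴ * (Jp * p * Jpᴴ) = 0 := by
    calc _ = Jr * r.mat * (Jrᴴ * Jp) * p * Jpᴴ := by simp only [Matrix.mul_assoc]
      _ = 0 := by rw [orp]; simp
  have zrq : Jr * r.mat * Jrᴴ * (Jq * q * Jqᴴ) = 0 := by
    calc _ = Jr * r.mat * (Jrᴴ * Jq) * q * Jqᴴ := by simp only [Matrix.mul_assoc]
      _ = 0 := by rw [orq]; simp
  have hadd : MvN (Jr * r.mat * Jrᴴ + Jp * p * Jpᴴ) (Jr * r.mat * Jrᴴ + Jq * q * Jqᴴ) := by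
    have sp := pr.add pp zrp
    have sq := pr.add pq zrq
    have b1 := (mvN_add_fromBlocks pr pp zrp).trans sp hrp (mr.fromBlocks mp)
    have b2 := (mvN_add_fromBlocks pr pq zrq).trans sq hrq (mr.fromBlocks mq)
    exact (b1.trans sp hrq hblocks).trans sp sq b2.symm
  have hpq := MvN.cancel hR hd pp pq pr zrp zrq hadd
  obtain ⟨w, w1, w2, w3, w4, w5⟩ := MvN.exists_normalized hR hd pp pq
    ((ep.mul hpR).mul ep.conjTranspose) ((eq.mul hqR).mul eq.conjTranspose) hpq
  -- The partial isometry obtained has range in the block of `p` and support in the block of `q`, so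
  -- compressing it to the rectangle between them loses nothing.
  have w6 : w * Jq * Jqᴴ = w := by
    calc w * Jq * Jqᴴ = w * (Jq * q * Jqᴴ) * Jq * Jqᴴ := by rw [w5]
      _ = w * (Jq * q * (Jqᴴ * Jq) * Jqᴴ) := by simp only [Matrix.mul_assoc]
      _ = w := by rw [jq, Matrix.mul_one, w5]
  have w7 : Jp * Jpᴴ * w = w := by
    calc Jp * Jpᴴ * w = Jp * Jpᴴ * (Jp * p * Jpᴴ * w) := by rw [w4]
      _ = Jp * (Jpᴴ * Jp) * p * Jpᴴ * w := by simp only [Matrix.mul_assoc]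
      _ = w := by rw [jp, Matrix.mul_one, w4]
  refine ⟨Jpᴴ * w * Jq, (ep.conjTranspose.mul w1).mul eq, ?_, ?_⟩
  · calc Jpᴴ * w * Jq * (Jpᴴ * w * Jq)ᴴ = Jpᴴ * (w * Jq * Jqᴴ) * wᴴ * Jp := by
          simp only [conjTranspose_mul, conjTranspose_conjTranspose, Matrix.mul_assoc]
      _ = Jpᴴ * (w * wᴴ) * Jp := by rw [w6]; simp only [Matrix.mul_assoc]
      _ = (Jpᴴ * Jp) * p * (Jpᴴ * Jp) := by rw [w2]; simp only [Matrix.mul_assoc]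
      _ = p := by rw [jp, Matrix.mul_one, Matrix.one_mul]
  · calc (Jpᴴ * w * Jq)ᴴ * (Jpᴴ * w * Jq) = Jqᴴ * wᴴ * (Jp * Jpᴴ * w) * Jq := by
          simp only [conjTranspose_mul, conjTranspose_conjTranspose, Matrix.mul_assoc]
      _ = Jqᴴ * (wᴴ * w) * Jq := by rw [w7]; simp only [Matrix.mul_assoc]
      _ = (Jqᴴ * Jq) * q * (Jqᴴ * Jq) := by rw [w3]; simp only [Matrix.mul_assoc]
      _ = q := by rw [jq, Matrix.mul_one, Matrix.one_mul]

/-- Finitely many positive elements of `K₀` are represented by projections of the same size with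
entries in a dense locally finite-dimensional star subalgebra. -/
theorem exists_kclass_eq {R : StarSubalgebra ℂ B} (hR : LocallyFD R)
    (hd : Dense (R : Set B)) {X : Type} [Fintype X] {x : X → K0 B} (hx : ∀ j, x j ∈ K0Pos B) :
    ∃ (Y : Type) (_ : Fintype Y) (_ : DecidableEq Y) (q : X → Matrix Y Y B),
      ∀ j, IsStarProjection (q j) ∧ EntriesIn R (q j) ∧ kclass (q j) = x j := by
  classical
  have : ∀ j, ∃ P : MatProj B, kclass P.mat = x j := fun j => by
    obtain ⟨y, hy⟩ := hx j
    obtain ⟨P, rfl⟩ := Quotient.exists_rep y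
    exact ⟨P, (kclass_mat P).trans hy⟩
  choose P hP using this
  -- The disjoint union of all index sets is a common size; padding by zeros keeps the class, and
  -- perturbing afterwards puts the entries into `R`.
  have key : ∀ j, ∃ q : Matrix (Σ j, Fin (P j).size) (Σ j, Fin (P j).size) B,
      IsStarProjection q ∧ EntriesIn R q ∧ kclass q = x j := by
    intro j
    have inj : Function.Injective (Sigma.mk (β := fun j => Fin (P j).size) j) :=
      sigma_mk_injective
    have h1 := isStarProjection_pad (B := B) inj (P j).isProj
    have h2 := mvN_pad (B := B) inj (P j).isProj
    obtain ⟨q, q1, q2, q3⟩ := exists_matProjection_entriesIn hR hd h1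
    exact ⟨q, q2, q1, by rw [← hP j, ← h2.kclass_eq h1 (P j).isProj, q3.kclass_eq q2 h1]⟩
  choose q hq using key
  exact ⟨_, inferInstance, inferInstance, q, hq⟩

end KClass
-- Classes of projections of the algebra itself, and realization of classes
section ElementClass
variable {B : Type u}

/-- An element of `B` as a `1 × 1` matrix. -/
def oneByOne (b : B) : Matrix (Fin 1) (Fin 1) B := Matrix.of fun _ _ => b

theorem oneByOne_apply (b : B) (i j : Fin 1) : oneByOne b i j = b := rfl

theorem oneByOne_injective : Function.Injective (oneByOne (B := B)) := fun a b h => by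
  simpa [oneByOne_apply] using congrFun (congrFun h 0) 0

theorem oneByOne_eq (M : Matrix (Fin 1) (Fin 1) B) : oneByOne (M 0 0) = M := by
  ext i j
  rw [Subsingleton.elim i 0, Subsingleton.elim j 0, oneByOne_apply]

variable [CStarAlgebra B]

theorem oneByOne_mul (a b : B) : oneByOne (a * b) = oneByOne a * oneByOne b := by
  ext i j
  simp [oneByOne_apply, Matrix.mul_apply]

theorem oneByOne_star (a : B) : oneByOne (star a) = (oneByOne a)ᴴ := by
  ext i j
  simp [oneByOne_apply]

theorem oneByOne_one : oneByOne (1 : B) = 1 := by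
  ext i j
  rw [Subsingleton.elim i j]
  simp [oneByOne_apply]

theorem oneByOne_zero : oneByOne (0 : B) = 0 := rfl

theorem oneByOne_sum {ι : Type} (s : Finset ι) (f : ι → B) :
    oneByOne (∑ i ∈ s, f i) = ∑ i ∈ s, oneByOne (f i) := by
  ext i j
  simp [oneByOne_apply, Matrix.sum_apply]

theorem isStarProjection_oneByOne {p : B} (hp : IsStarProjection p) :
    IsStarProjection (oneByOne p) :=
  ⟨by rw [IsIdempotentElem, ← oneByOne_mul, hp.isIdempotentElem.eq],
    by rw [IsSelfAdjoint, star_eq_conjTranspose, ← oneByOne_star, hp.isSelfAdjoint.star_eq]⟩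

/-- The class in `K₀(B)` of a projection of `B`. -/
noncomputable def projClass (p : B) : K0 B := kclass (oneByOne p)

theorem projClass_one : projClass (1 : B) = K0Unit B := by
  rw [projClass, oneByOne_one]
  exact kclass_mat ⟨1, 1, IsStarProjection.one _⟩

theorem projClass_mem_K0Pos {p : B} (hp : IsStarProjection p) : projClass p ∈ K0Pos B :=
  kclass_mem_K0Pos (isStarProjection_oneByOne hp)

theorem projClass_sum {ι : Type} (s : Finset ι) {p : ι → B}
    (hp : ∀ i, IsStarProjection (p i)) (hpp : ∀ i j, i ≠ j → p i * p j = 0) :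
    projClass (∑ i ∈ s, p i) = ∑ i ∈ s, projClass (p i) := by
  rw [projClass, oneByOne_sum]
  exact kclass_sum s (fun i => isStarProjection_oneByOne (hp i))
    fun i j hij => by rw [← oneByOne_mul, hpp i j hij, oneByOne_zero]

theorem EqvIn.projClass_eq {R : StarSubalgebra ℂ B} {p q : B} (hp : IsStarProjection p)
    (hq : IsStarProjection q) (h : EqvIn R p q) : projClass p = projClass q := by
  obtain ⟨w, -, h1, h2⟩ := h
  refine MvN.kclass_eq (isStarProjection_oneByOne hp) (isStarProjection_oneByOne hq)
    ⟨oneByOne w, ?_, ?_⟩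
  · rw [← oneByOne_star, ← oneByOne_mul, h1]
  · rw [← oneByOne_star, ← oneByOne_mul, h2]

theorem eqvIn_of_projClass_eq {R : StarSubalgebra ℂ B} (hR : LocallyFD R)
    (hd : Dense (R : Set B)) {p q : B} (hp : IsStarProjection p) (hq : IsStarProjection q)
    (hpR : p ∈ R) (hqR : q ∈ R) (h : projClass p = projClass q) : EqvIn R p q := by
  obtain ⟨w, w1, w2, w3⟩ := exists_mvN_of_kclass_eq hR hd (isStarProjection_oneByOne hp)
    (isStarProjection_oneByOne hq) (fun _ _ => hpR) (fun _ _ => hqR) h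
  rw [← oneByOne_eq w, ← oneByOne_star, ← oneByOne_mul] at w2 w3
  exact ⟨w 0 0, w1 0 0, oneByOne_injective w2, oneByOne_injective w3⟩

theorem projClass_zero : projClass (0 : B) = 0 := by
  rw [projClass, oneByOne_zero, kclass_zero]

/-- By cancellation `p` is equivalent to `0`, so the partial isometry is zero. Nonzero classes thus
detect nonzero projections, which keeps the matched algebras isomorphic. -/
theorem eq_zero_of_projClass_eq_zero {R : StarSubalgebra ℂ B} (hR : LocallyFD R)
    (hd : Dense (R : Set B)) {p : B} (hp : IsStarProjection p) (hpR : p ∈ R)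
    (h : projClass p = 0) : p = 0 := by
  obtain ⟨w, -, h1, h2⟩ := eqvIn_of_projClass_eq hR hd hp (IsStarProjection.zero B) hpR
    (zero_mem R) (h.trans projClass_zero.symm)
  rw [CStarRing.star_mul_self_eq_zero_iff] at h2
  rw [← h1, h2, zero_mul]

theorem MatrixUnits.of_oneByOne {X : Type} [Fintype X] {c : X → X}
    {F : X → X → Matrix (Fin 1) (Fin 1) B} (h : MatrixUnits c F) :
    MatrixUnits c fun j k => F j k 0 0 where
  idem := h.idem
  star_eq j k := oneByOne_injective (by
    rw [oneByOne_star, oneByOne_eq, oneByOne_eq]; exact h.star_eq j k)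
  zero j k hjk := by rw [h.zero j k hjk]; rfl
  mul j k l h1 h2 := oneByOne_injective (by
    rw [oneByOne_mul, oneByOne_eq, oneByOne_eq, oneByOne_eq, h.mul j k l h1 h2])
  mul_ne j k k' l hk := oneByOne_injective (by
    rw [oneByOne_mul, oneByOne_eq, oneByOne_eq, h.mul_ne j k k' l hk, oneByOne_zero])
  sum := oneByOne_injective (by
    rw [oneByOne_sum, oneByOne_one, ← h.sum]
    simp only [oneByOne_eq])

/-- Positive elements of `K₀` adding up to the unit are the classes of the diagonal entries of a
system of matrix units. -/
theorem exists_matrixUnits_of_K0 {R : StarSubalgebra ℂ B} (hR : LocallyFD R)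
    (hd : Dense (R : Set B)) {X : Type} [Fintype X] {c : X → X} (hc : ∀ j, c (c j) = c j)
    {x : X → K0 B} (hx : ∀ j, x j ∈ K0Pos B) (hxc : ∀ j, x (c j) = x j)
    (hsum : ∑ j, x j = K0Unit B) :
    ∃ f : X → X → B, MatrixUnits c f ∧ (∀ j k, f j k ∈ R) ∧ ∀ j, projClass (f j j) = x j := by
  classical
  obtain ⟨Y, _, _, q, hq⟩ := exists_kclass_eq hR hd hx
  let J : X → Matrix (Y × X) Y B := fun j => indexMatrix B fun y => (y, j)
  have inj : ∀ j : X, Function.Injective fun y : Y => (y, j) := fun j => Prod.mk_left_injective j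
  have hJJ : ∀ j, (J j)ᴴ * J j = 1 := fun j => indexMatrix_conjTranspose_mul_self _ (inj j)
  have hJJ' : ∀ j k, j ≠ k → (J j)ᴴ * J k = 0 := fun j k hjk =>
    indexMatrix_conjTranspose_mul_of_disjoint _ _ fun y z h => hjk (congrArg Prod.snd h)
  have hJR : ∀ j, EntriesIn R (J j) := fun j => entriesIn_indexMatrix R _
  -- Using `q (c j)` rather than `q j` makes the blocks within one part literally equal, so the
  -- off-diagonal units between them are plain block shifts.
  let Q : X → Matrix (Y × X) (Y × X) B := fun j => J j * q (c j) * (J j)ᴴ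
  have hQ : ∀ j, IsStarProjection (Q j) := fun j => isStarProjection_pad (inj j) (hq _).1
  have hQc : ∀ j, kclass (Q j) = x j := fun j => by
    rw [(mvN_pad (inj j) (hq (c j)).1).kclass_eq (hQ j) (hq _).1, (hq _).2.2, hxc]
  have hQQ : ∀ j k, j ≠ k → Q j * Q k = 0 := fun j k hjk => by
    calc Q j * Q k = J j * q (c j) * ((J j)ᴴ * J k) * q (c k) * (J k)ᴴ := by
          simp only [Q, Matrix.mul_assoc]
      _ = 0 := by rw [hJJ' j k hjk]; simp
  have hQR : ∀ j, EntriesIn R (Q j) := fun j =>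
    ((hJR j).mul (hq _).2.1).mul (hJR j).conjTranspose
  have hD := isStarProjection_sum Finset.univ hQ hQQ
  have hDR : EntriesIn R (∑ j, Q j) := fun a b => by
    rw [Matrix.sum_apply]
    exact sum_mem fun j _ => hQR j a b
  have hDc : kclass (∑ j, Q j) = projClass (1 : B) := by
    rw [kclass_sum _ hQ hQQ, projClass_one, ← hsum]
    exact Finset.sum_congr rfl fun j _ => hQc j
  -- The block diagonal sum has class `[1]`, so a row `w` over `R` carries the whole configuration
  -- into `B`.
  obtain ⟨w, w1, w2, w3⟩ := exists_mvN_of_kclass_eq hR hd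
    (isStarProjection_oneByOne (IsStarProjection.one B)) hD (fun _ _ => one_mem R) hDR hDc.symm
  rw [oneByOne_one] at w2
  have hDJ : ∀ k, (J k)ᴴ * (wᴴ * w) * J k = q (c k) := fun k => by
    rw [w3, Matrix.mul_sum, Matrix.sum_mul, Finset.sum_eq_single k]
    · calc (J k)ᴴ * Q k * J k = ((J k)ᴴ * J k) * q (c k) * ((J k)ᴴ * J k) := by
            simp only [Q, Matrix.mul_assoc]
        _ = _ := by rw [hJJ, Matrix.one_mul, Matrix.mul_one]
    · intro j _ hj
      calc (J k)ᴴ * Q j * J k = (J k)ᴴ * J j * q (c j) * ((J j)ᴴ * J k) := by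
            simp only [Q, Matrix.mul_assoc]
        _ = 0 := by rw [hJJ' j k hj]; simp
    · simp
  have hDJ' : ∀ j k, j ≠ k → (J j)ᴴ * (wᴴ * w) * J k = 0 := fun j k hjk => by
    rw [w3, Matrix.mul_sum, Matrix.sum_mul]
    refine Finset.sum_eq_zero fun i _ => ?_
    have e : (J j)ᴴ * Q i * J k = (J j)ᴴ * J i * q (c i) * ((J i)ᴴ * J k) := by
      simp only [Q, Matrix.mul_assoc]
    rw [e]
    by_cases hi : i = k
    · rw [hJJ' j i (hi ▸ hjk)]; simp
    · rw [hJJ' i k hi]; simp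
  have hqq : ∀ j, q j * q j = q j := fun j => (hq j).1.isIdempotentElem
  have hqs : ∀ j, (q j)ᴴ = q j := fun j => (hq j).1.isSelfAdjoint
  let F : X → X → Matrix (Fin 1) (Fin 1) B := fun j k =>
    if c j = c k then w * J j * q (c j) * (J k)ᴴ * wᴴ else 0
  have hF : ∀ j k, c j = c k → F j k = w * J j * q (c j) * (J k)ᴴ * wᴴ := fun j k h => if_pos h
  have hF0 : ∀ j k, c j ≠ c k → F j k = 0 := fun j k h => if_neg h
  have hFmul : ∀ j k k' l, c j = c k → c k' = c l → F j k * F k' l =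
      w * J j * q (c j) * ((J k)ᴴ * (wᴴ * w) * J k') * q (c k') * (J l)ᴴ * wᴴ := by
    intro j k k' l h1 h2
    rw [hF j k h1, hF k' l h2]
    simp only [Matrix.mul_assoc]
  have hMU : MatrixUnits c F :=
    { idem := hc
      star_eq := fun j k => by
        rw [star_eq_conjTranspose]
        by_cases hjk : c j = c k
        · rw [hF j k hjk, hF k j hjk.symm, ← hjk]
          simp only [conjTranspose_mul, conjTranspose_conjTranspose, hqs, Matrix.mul_assoc]
        · rw [hF0 j k hjk, hF0 k j (Ne.symm hjk), conjTranspose_zero]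
      zero := hF0
      mul := fun j k l h1 h2 => by
        rw [hFmul j k k l h1 h2, hDJ, hF j l (h1.trans h2), ← h1]
        congr 2
        rw [Matrix.mul_assoc, Matrix.mul_assoc, hqq, hqq]
      mul_ne := fun j k k' l hk => by
        by_cases h1 : c j = c k
        · by_cases h2 : c k' = c l
          · rw [hFmul j k k' l h1 h2, hDJ' k k' hk]; simp
          · rw [hF0 k' l h2, mul_zero]
        · rw [hF0 j k h1, zero_mul]
      sum := by
        have : ∀ j, F j j = w * Q j * wᴴ := fun j => by
          rw [hF j j rfl]; simp only [Q, Matrix.mul_assoc]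
        simp_rw [this]
        rw [← Matrix.sum_mul, ← Matrix.mul_sum, ← w3,
          show w * (wᴴ * w) * wᴴ = (w * wᴴ) * (w * wᴴ) by simp only [Matrix.mul_assoc], w2,
          mul_one] }
  refine ⟨_, hMU.of_oneByOne, fun j k => ?_, fun j => ?_⟩
  · by_cases hjk : c j = c k
    · rw [hF j k hjk]
      exact ((((w1.mul (hJR j)).mul (hq _).2.1).mul (hJR k).conjTranspose).mul
        w1.conjTranspose) 0 0
    · rw [hF0 j k hjk]; exact zero_mem R
  · have hproj : IsStarProjection (F j j) := hMU.proj j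
    rw [projClass, oneByOne_eq, ← hxc j, ← (hq (c j)).2.2]
    refine MvN.kclass_eq hproj (hq _).1 ⟨w * J j * q (c j), ?_, ?_⟩
    · rw [hF j j rfl]
      calc w * J j * q (c j) * (w * J j * q (c j))ᴴ =
          w * J j * (q (c j) * q (c j)) * (J j)ᴴ * wᴴ := by
            simp only [conjTranspose_mul, hqs, Matrix.mul_assoc]
        _ = _ := by rw [hqq]
    · calc (w * J j * q (c j))ᴴ * (w * J j * q (c j)) =
          q (c j) * ((J j)ᴴ * (wᴴ * w) * J j) * q (c j) := by
            simp only [conjTranspose_mul, hqs, Matrix.mul_assoc]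
        _ = _ := by rw [hDJ, hqq, hqq]

end ElementClass
-- Graphs of partial isomorphisms and their extension
section Extension
variable {A : Type u} {B : Type v} [CStarAlgebra A] [CStarAlgebra B]

/-- The pairs in `G` respect equality and order. -/
structure IsPartialIso (G : AddSubsemigroup (K0 A × K0 B)) : Prop where
  eq_iff : ∀ x ∈ G, ∀ y ∈ G, x.1 = y.1 ↔ x.2 = y.2
  le_iff : ∀ x ∈ G, ∀ y ∈ G, y.1 - x.1 ∈ K0Pos A ↔ y.2 - x.2 ∈ K0Pos B
  unit_mem : (K0Unit A, K0Unit B) ∈ G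

/-- `Γ` is the graph of an isomorphism between finite-dimensional star subalgebras of `RA` and `RB`,
and the pairs of classes of projections matched by `Γ` belong to `G`. -/
structure IsMatching (RA : StarSubalgebra ℂ A) (RB : StarSubalgebra ℂ B)
    (G : AddSubsemigroup (K0 A × K0 B)) (Γ : StarSubalgebra ℂ (A × B)) : Prop where
  finite : FiniteDimensional ℂ Γ
  left_mem : ∀ z ∈ Γ, z.1 ∈ RA
  right_mem : ∀ z ∈ Γ, z.2 ∈ RB
  left_inj : ∀ z ∈ Γ, z.1 = 0 → z = 0
  right_inj : ∀ z ∈ Γ, z.2 = 0 → z = 0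
  class_mem : ∀ z ∈ Γ, IsStarProjection z → z ≠ 0 → (projClass z.1, projClass z.2) ∈ G

theorem isStarProjection_fst {z : A × B} (h : IsStarProjection z) : IsStarProjection z.1 :=
  ⟨congrArg Prod.fst h.1, congrArg Prod.fst h.2⟩

theorem isStarProjection_snd {z : A × B} (h : IsStarProjection z) : IsStarProjection z.2 :=
  ⟨congrArg Prod.snd h.1, congrArg Prod.snd h.2⟩

theorem EqvIn.fst {T : StarSubalgebra ℂ (A × B)} {p q : A × B} (h : EqvIn T p q) :
    EqvIn ⊤ p.1 q.1 := by
  obtain ⟨w, -, h1, h2⟩ := h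
  exact ⟨w.1, trivial, congrArg Prod.fst h1, congrArg Prod.fst h2⟩

theorem EqvIn.snd {T : StarSubalgebra ℂ (A × B)} {p q : A × B} (h : EqvIn T p q) :
    EqvIn ⊤ p.2 q.2 := by
  obtain ⟨w, -, h1, h2⟩ := h
  exact ⟨w.2, trivial, congrArg Prod.snd h1, congrArg Prod.snd h2⟩

/-- Nonemptiness matters: `G` models a substructure for a language without zero, so the empty sum
may be missing. This is also why `IsMatching.class_mem` excludes the zero projection. -/
theorem addSubsemigroup_sum_mem {M ι : Type*} [AddCommMonoid M]
    (G : AddSubsemigroup M) {s : Finset ι} (hs : s.Nonempty) {f : ι → M}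
    (hf : ∀ i ∈ s, f i ∈ G) : ∑ i ∈ s, f i ∈ G :=
  Finset.sum_induction_nonempty f (· ∈ G) (fun _ _ => G.add_mem) hs hf

section Pair
variable {X : Type} [Fintype X] {c : X → X} {e : X → X → A} {f : X → X → B}

theorem MatrixUnits.prod (he : MatrixUnits c e) (hf : MatrixUnits c f) :
    MatrixUnits c fun j k => (e j k, f j k) where
  idem := he.idem
  star_eq j k := Prod.ext (he.star_eq j k) (hf.star_eq j k)
  zero j k h := Prod.ext (he.zero j k h) (hf.zero j k h)
  mul j k l h1 h2 := Prod.ext (he.mul j k l h1 h2) (hf.mul j k l h1 h2)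
  mul_ne j k k' l h := Prod.ext (he.mul_ne j k k' l h) (hf.mul_ne j k k' l h)
  sum := Prod.ext (by rw [Prod.fst_sum]; exact he.sum) (by rw [Prod.snd_sum]; exact hf.sum)

theorem MatrixUnits.fst {g : X → X → A × B} (h : MatrixUnits c g) :
    MatrixUnits c fun j k => (g j k).1 where
  idem := h.idem
  star_eq j k := congrArg Prod.fst (h.star_eq j k)
  zero j k hjk := congrArg Prod.fst (h.zero j k hjk)
  mul j k l h1 h2 := congrArg Prod.fst (h.mul j k l h1 h2)
  mul_ne j k k' l hk := congrArg Prod.fst (h.mul_ne j k k' l hk)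
  sum := by rw [← Prod.fst_sum, h.sum]; rfl

theorem MatrixUnits.snd {g : X → X → A × B} (h : MatrixUnits c g) :
    MatrixUnits c fun j k => (g j k).2 where
  idem := h.idem
  star_eq j k := congrArg Prod.snd (h.star_eq j k)
  zero j k hjk := congrArg Prod.snd (h.zero j k hjk)
  mul j k l h1 h2 := congrArg Prod.snd (h.mul j k l h1 h2)
  mul_ne j k k' l hk := congrArg Prod.snd (h.mul_ne j k k' l hk)
  sum := by rw [← Prod.snd_sum, h.sum]; rfl

/-- Units `e j k` with `c j = c k` have vanishing coefficients in a zero combination; the remaining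
units are zero in both coordinates. -/
theorem MatrixUnits.prod_fst_inj (he : MatrixUnits c e) (hf : MatrixUnits c f)
    (he0 : ∀ j, e j j ≠ 0) : ∀ z ∈ (he.prod hf).span, z.1 = 0 → z = 0 := by
  intro z hz h0
  obtain ⟨M, rfl⟩ := (he.prod hf).exists_coeff hz
  have h1 : ∑ j, ∑ k, M j k • e j k = 0 := by
    rw [← h0, Prod.fst_sum]
    exact Finset.sum_congr rfl fun j _ => by rw [Prod.fst_sum]; rfl
  refine Finset.sum_eq_zero fun j _ => Finset.sum_eq_zero fun k _ => ?_
  by_cases hjk : c j = c k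
  · rw [he.coeff_eq_zero he0 h1 hjk, zero_smul]
  · rw [(he.prod hf).zero j k hjk, smul_zero]

theorem MatrixUnits.prod_snd_inj (he : MatrixUnits c e) (hf : MatrixUnits c f)
    (hf0 : ∀ j, f j j ≠ 0) : ∀ z ∈ (he.prod hf).span, z.2 = 0 → z = 0 := by
  intro z hz h0
  obtain ⟨M, rfl⟩ := (he.prod hf).exists_coeff hz
  have h1 : ∑ j, ∑ k, M j k • f j k = 0 := by
    rw [← h0, Prod.snd_sum]
    exact Finset.sum_congr rfl fun j _ => by rw [Prod.snd_sum]; rfl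
  refine Finset.sum_eq_zero fun j _ => Finset.sum_eq_zero fun k _ => ?_
  by_cases hjk : c j = c k
  · rw [hf.coeff_eq_zero hf0 h1 hjk, zero_smul]
  · rw [(he.prod hf).zero j k hjk, smul_zero]

theorem MatrixUnits.prod_span_fst (he : MatrixUnits c e) (hf : MatrixUnits c f) {z : A × B}
    (hz : z ∈ (he.prod hf).span) : z.1 ∈ he.span := by
  obtain ⟨M, rfl⟩ := (he.prod hf).exists_coeff hz
  rw [Prod.fst_sum]
  refine sum_mem fun j _ => ?_
  rw [Prod.fst_sum]
  exact sum_mem fun k _ => he.span.smul_mem (he.unit_mem_span j k) _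

theorem MatrixUnits.prod_span_snd (he : MatrixUnits c e) (hf : MatrixUnits c f) {z : A × B}
    (hz : z ∈ (he.prod hf).span) : z.2 ∈ hf.span := by
  obtain ⟨M, rfl⟩ := (he.prod hf).exists_coeff hz
  rw [Prod.snd_sum]
  refine sum_mem fun j _ => ?_
  rw [Prod.snd_sum]
  exact sum_mem fun k _ => hf.span.smul_mem (hf.unit_mem_span j k) _

theorem MatrixUnits.exists_mem_prod_span (he : MatrixUnits c e) (hf : MatrixUnits c f) {a : A}
    (ha : a ∈ he.span) : ∃ b, (a, b) ∈ (he.prod hf).span := by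
  obtain ⟨M, rfl⟩ := he.exists_coeff ha
  refine ⟨∑ j, ∑ k, M j k • f j k, ?_⟩
  have : (∑ j, ∑ k, M j k • e j k, ∑ j, ∑ k, M j k • f j k) =
      ∑ j, ∑ k, M j k • (e j k, f j k) := by
    refine Prod.ext ?_ ?_
    · rw [Prod.fst_sum]
      exact Finset.sum_congr rfl fun j _ => by rw [Prod.fst_sum]; rfl
    · rw [Prod.snd_sum]
      exact Finset.sum_congr rfl fun j _ => by rw [Prod.snd_sum]; rfl
  rw [this]
  exact sum_mem fun j _ => sum_mem fun k _ =>
    (he.prod hf).span.smul_mem ((he.prod hf).unit_mem_span j k) _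

/-- Checking `class_mem` on the diagonal suffices: a nonzero projection of the graph is a nonempty
orthogonal sum of projections equivalent, within the graph, to diagonal units. -/
theorem MatrixUnits.isMatching {RA : StarSubalgebra ℂ A} {RB : StarSubalgebra ℂ B}
    {G : AddSubsemigroup (K0 A × K0 B)} (he : MatrixUnits c e) (hf : MatrixUnits c f)
    (hmin : ∀ j, IsMinimalProj he.span (e j j)) (heR : he.span ≤ RA) (hfR : ∀ j k, f j k ∈ RB)
    (hf0 : ∀ j, f j j ≠ 0) (hG : ∀ j, (projClass (e j j), projClass (f j j)) ∈ G) :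
    IsMatching RA RB G (he.prod hf).span := by
  have hfd := (he.prod hf).finiteDimensional_span
  have linj := he.prod_fst_inj hf fun j => (hmin j).ne_zero
  have hmin' : ∀ j, IsMinimalProj (he.prod hf).span (e j j, f j j) := fun j =>
    { mem := (he.prod hf).unit_mem_span j j
      proj := (he.prod hf).proj j
      ne_zero := fun h => (hmin j).ne_zero (congrArg Prod.fst h)
      scalar := fun z hz => by
        obtain ⟨l, hl⟩ := (hmin j).scalar z.1 (he.prod_span_fst hf hz)
        have hm := (he.prod hf).unit_mem_span j j
        refine ⟨l, sub_eq_zero.1 (linj _ (sub_mem (mul_mem (mul_mem hm hz) hm)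
          ((he.prod hf).span.smul_mem hm l)) ?_)⟩
        exact sub_eq_zero.2 hl }
  refine ⟨hfd, fun z hz => heR (he.prod_span_fst hf hz),
    fun z hz => hf.span_le hfR (he.prod_span_snd hf hz), linj, he.prod_snd_inj hf hf0, ?_⟩
  intro z hz hzp hz0
  obtain ⟨Y, _, p, κ, p1, p2, p3, p4⟩ := exists_proj_decomposition (he.prod hf) hmin' hz hzp
  have hY : (Finset.univ : Finset Y).Nonempty := by
    by_contra hne
    rw [Finset.not_nonempty_iff_eq_empty] at hne
    rw [hne, Finset.sum_empty] at p3
    exact hz0 p3.symm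
  have e1 : projClass z.1 = ∑ y, projClass (e (κ y) (κ y)) := by
    rw [← p3, Prod.fst_sum, projClass_sum _ (fun y => (isStarProjection_fst (p1 y)))
      fun i j hij => congrArg Prod.fst (p2 i j hij)]
    exact Finset.sum_congr rfl fun y _ => (p4 y).fst.projClass_eq (isStarProjection_fst (p1 y)) (he.proj _)
  have e2 : projClass z.2 = ∑ y, projClass (f (κ y) (κ y)) := by
    rw [← p3, Prod.snd_sum, projClass_sum _ (fun y => (isStarProjection_snd (p1 y)))
      fun i j hij => congrArg Prod.snd (p2 i j hij)]
    exact Finset.sum_congr rfl fun y _ => (p4 y).snd.projClass_eq (isStarProjection_snd (p1 y)) (hf.proj _)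
  have e3 : (projClass z.1, projClass z.2) =
      ∑ y, (projClass (e (κ y) (κ y)), projClass (f (κ y) (κ y))) := by
    rw [e1, e2]
    exact Prod.ext (by rw [Prod.fst_sum]) (by rw [Prod.snd_sum])
  rw [e3]
  exact addSubsemigroup_sum_mem G hY fun y _ => hG _

theorem MatrixUnits.conj (hf : MatrixUnits c f) {w : B} (h1 : w * star w = 1)
    (h2 : star w * w = 1) : MatrixUnits c fun j k => w * f j k * star w where
  idem := hf.idem
  star_eq j k := by simp [hf.star_eq, mul_assoc]
  zero j k h := by rw [hf.zero j k h]; simp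
  mul j k l h h' := by
    rw [show w * f j k * star w * (w * f k l * star w) = w * (f j k * (star w * w) * f k l) *
      star w by noncomm_ring, h2, mul_one, hf.mul j k l h h']
  mul_ne j k k' l h := by
    rw [show w * f j k * star w * (w * f k' l * star w) = w * (f j k * (star w * w) * f k' l) *
      star w by noncomm_ring, h2, mul_one, hf.mul_ne j k k' l h]
    simp
  sum := by rw [← Finset.sum_mul, ← Finset.mul_sum, hf.sum, mul_one, h1]

end Pair

/-- Enlarging a matching so that its first projection covers `T`, provided that the classes of
suitable projections of `T` have been matched in `K₀`. -/
theorem IsMatching.extend [Nontrivial A] {RA : StarSubalgebra ℂ A} {RB : StarSubalgebra ℂ B}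
    (hA : LocallyFD RA) (hdA : Dense (RA : Set A)) (hB : LocallyFD RB)
    (hdB : Dense (RB : Set B)) {G : AddSubsemigroup (K0 A × K0 B)}
    {Γ : StarSubalgebra ℂ (A × B)} (hΓ : IsMatching RA RB G Γ) {T : StarSubalgebra ℂ A}
    [FiniteDimensional ℂ T] (hTR : T ≤ RA) (hΓT : ∀ z ∈ Γ, z.1 ∈ T) :
    ∃ (X : Type) (_ : Fintype X) (a : X → K0 A), ∀ (G' : AddSubsemigroup (K0 A × K0 B))
      (b : X → K0 B), G ≤ G' → IsPartialIso G' → (∀ j, (a j, b j) ∈ G') →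
      ∃ Γ', IsMatching RA RB G' Γ' ∧ Γ ≤ Γ' ∧ ∀ t ∈ T, ∃ s, (t, s) ∈ Γ' := by
  obtain ⟨X, _, c, e, he, heT, hmin⟩ := exists_matrixUnits T
  refine ⟨X, inferInstance, fun j => projClass (e j j), fun G' b hGG hG' hab => ?_⟩
  subst heT
  have hX : (Finset.univ : Finset X).Nonempty := by
    by_contra hne
    rw [Finset.not_nonempty_iff_eq_empty] at hne
    have := he.sum
    rw [hne, Finset.sum_empty] at this
    exact zero_ne_one this
  have ha0 : ∀ j, projClass (e j j) ≠ 0 := fun j h => (hmin j).ne_zero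
    (eq_zero_of_projClass_eq_zero hA hdA (he.proj j) (hTR (hmin j).mem) h)
  -- Being zero is expressed as `b + b = b`, and positivity below as `b ≤ b + b`, since `0` itself
  -- need not be matched.
  have hb0 : ∀ j, b j ≠ 0 := fun j h => by
    have := (hG'.eq_iff _ (G'.add_mem (hab j) (hab j)) _ (hab j)).2
      (show b j + b j = b j by rw [h, add_zero])
    exact ha0 j (left_eq_add.1 (Eq.symm this))
  have hbpos : ∀ j, b j ∈ K0Pos B := fun j => by
    have := (hG'.le_iff _ (hab j) _ (G'.add_mem (hab j) (hab j))).1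
      (show projClass (e j j) + projClass (e j j) - projClass (e j j) ∈ K0Pos A by
        rw [add_sub_cancel_right]; exact projClass_mem_K0Pos (he.proj j))
    have h2 : b j + b j - b j ∈ K0Pos B := this
    rwa [add_sub_cancel_right] at h2
  have hbc : ∀ j, b (c j) = b j := fun j => by
    refine (hG'.eq_iff _ (hab (c j)) _ (hab j)).1 ?_
    obtain ⟨h1, h2⟩ := he.eqv (c j) j (he.idem j)
    exact EqvIn.projClass_eq (R := ⊤) (he.proj _) (he.proj _) ⟨e (c j) j, trivial, h1, h2⟩
  have hbsum : ∑ j, b j = K0Unit B := by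
    have h1 := addSubsemigroup_sum_mem G' hX fun j _ => hab j
    have h2 := (hG'.eq_iff _ h1 _ hG'.unit_mem).1 (by
      rw [Prod.fst_sum]
      show ∑ j, projClass (e j j) = K0Unit A
      rw [← projClass_sum _ he.proj fun i j hij => he.mul_ne _ _ _ _ hij, he.sum, projClass_one])
    rwa [Prod.snd_sum] at h2
  obtain ⟨f₀, hf₀, hf₀R, hf₀b⟩ := exists_matrixUnits_of_K0 hB hdB he.idem hbpos hbc hbsum
  have hf₀0 : ∀ j, f₀ j j ≠ 0 := fun j h => hb0 j (by rw [← hf₀b j, h, projClass_zero])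
  have hΓ₀ := he.isMatching hf₀ (RA := RA) (RB := RB) (G := G') hmin hTR hf₀R hf₀0
    fun j => by rw [hf₀b]; exact hab j
  -- The copy of `T` found so far ignores `Γ`. Below, `g` are matrix units of `Γ`, and `h` are the
  -- images of their left coordinates under the new isomorphism, to be compared with the right
  -- coordinates.
  have := hΓ.finite
  obtain ⟨X', _, c', g, hg, hgΓ, hgmin⟩ := exists_matrixUnits Γ
  have hgm : ∀ j k, g j k ∈ Γ := fun j k => hgΓ ▸ hg.unit_mem_span j k
  choose h hh using fun j k => he.exists_mem_prod_span hf₀ (hΓT _ (hgm j k))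
  have uniq : ∀ {x y y'}, (x, y) ∈ (he.prod hf₀).span → (x, y') ∈ (he.prod hf₀).span → y = y' := by
    intro x y y' h1 h2
    have := hΓ₀.left_inj _ (sub_mem h1 h2) (sub_self x)
    exact sub_eq_zero.1 (congrArg Prod.snd this)
  have hg1 := hg.fst
  have hhU : MatrixUnits c' h :=
    { idem := hg.idem
      star_eq := fun j k => by
        have h1 := star_mem (hh j k)
        have h2 := hh k j
        rw [← hg1.star_eq j k] at h2
        exact uniq h1 h2
      zero := fun j k hjk => by
        have h1 := hh j k
        rw [hg1.zero j k hjk] at h1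
        exact uniq h1 (zero_mem _)
      mul := fun j k l h1 h2 => by
        have h3 := mul_mem (hh j k) (hh k l)
        have h4 := hh j l
        rw [← hg1.mul j k l h1 h2] at h4
        exact uniq h3 h4
      mul_ne := fun j k k' l hk => by
        have h3 := mul_mem (hh j k) (hh k' l)
        rw [Prod.mk_mul_mk, hg1.mul_ne j k k' l hk] at h3
        exact uniq h3 (zero_mem _)
      sum := by
        have h3 := sum_mem (t := Finset.univ) fun j _ => hh j j
        have h4 : (∑ j, ((g j j).1, h j j)) = ((1 : A), ∑ j, h j j) :=
          Prod.ext (by rw [Prod.fst_sum]; exact hg1.sum) (by rw [Prod.snd_sum])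
        rw [h4] at h3
        exact uniq h3 (one_mem _) }
  -- Both classes are partners in `G'` of the same class in `K₀(A)`.
  have hcls : ∀ j, projClass (g j j).2 = projClass (h j j) := fun j => by
    have m1 := hGG (hΓ.class_mem _ (hgm j j) (hg.proj j) (hgmin j).ne_zero)
    have m2 := hΓ₀.class_mem _ (hh j j)
      ⟨Prod.ext (hg1.proj j).1 (hhU.proj j).1, Prod.ext (hg1.proj j).2 (hhU.proj j).2⟩
      (fun h0 => (hgmin j).ne_zero (hΓ.left_inj _ (hgm j j) (congrArg Prod.fst h0)))
    exact (hG'.eq_iff _ m1 _ m2).1 rfl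
  have hgR : ∀ j k, (g j k).2 ∈ RB := fun j k => hΓ.right_mem _ (hgm j k)
  have hhR : ∀ j k, h j k ∈ RB := fun j k => hΓ₀.right_mem _ (hh j k)
  choose v hvR hv1 hv2 using fun j => eqvIn_of_projClass_eq hB hdB (hg.snd.proj j) (hhU.proj j)
    (hgR j j) (hhR j j) (hcls j)
  -- This unitary of `RB` conjugates `h` to the right coordinates of `g`. Replacing `f₀` by its
  -- conjugate makes the new graph contain `Γ` and leaves the classes `b` unchanged.
  obtain ⟨u1, u2, u3⟩ := hg.snd.exists_unitary hhU hv1 hv2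
  have huR : ∑ j, (g j (c' j)).2 * v (c' j) * h (c' j) j ∈ RB :=
    sum_mem fun j _ => mul_mem (mul_mem (hgR _ _) (hvR _)) (hhR _ _)
  generalize ∑ j, (g j (c' j)).2 * v (c' j) * h (c' j) j = w at u1 u2 u3 huR
  have hf := hf₀.conj u1 u2
  have hfb : ∀ j, projClass (w * f₀ j j * star w) = b j := fun j => by
    rw [← hf₀b]
    refine EqvIn.projClass_eq (R := ⊤) (hf.proj j) (hf₀.proj j)
      (EqvIn.of_unitary (hf₀.proj j) trivial (v := w) trivial u2 u1 ?_)
    rw [mul_assoc, u2, mul_one]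
  refine ⟨(he.prod hf).span, he.isMatching hf hmin hTR
    (fun j k => mul_mem (mul_mem huR (hf₀R j k)) (star_mem huR))
    (fun j h0 => hb0 j (by rw [← hfb, h0, projClass_zero]))
    (fun j => by rw [hfb]; exact hab j), ?_, fun t ht => he.exists_mem_prod_span hf ht⟩
  have key : ∀ z ∈ (he.prod hf₀).span, (z.1, w * z.2 * star w) ∈ (he.prod hf).span := by
    intro z hz
    refine Submodule.span_induction (p := fun z _ => (z.1, w * z.2 * star w) ∈ (he.prod hf).span)
      ?_ ?_ ?_ ?_ ((he.prod hf₀).mem_span.1 hz)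
    · rintro _ ⟨⟨j, k⟩, rfl⟩
      exact (he.prod hf).unit_mem_span j k
    · simp only [Prod.fst_zero, Prod.snd_zero, mul_zero, zero_mul]
      exact zero_mem _
    · intro x y _ _ hx hy
      have := add_mem hx hy
      rwa [Prod.mk_add_mk, ← add_mul, ← mul_add] at this
    · intro r x _ hx
      have := (he.prod hf).span.smul_mem hx r
      rwa [Prod.smul_mk, ← smul_mul_assoc, ← mul_smul_comm] at this
  rw [← hgΓ]
  refine hg.span_le fun j k => ?_
  have h1 := key _ (hh j k)
  rw [u3 j k, mul_assoc, u1, mul_one] at h1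
  exact h1

end Extension

/-! ### The dense locally finite-dimensional subalgebra of an AF-algebra -/

section AF
variable {A : Type u} [CStarAlgebra A]

/-- Multiplication by the invertible `s` is injective on the finite-dimensional `S`, hence
surjective; solving `s * t = s` in `S` forces `t = 1`. -/
theorem one_mem_of_isUnit {S : NonUnitalStarSubalgebra ℂ A} [FiniteDimensional ℂ S] {s : A}
    (hs : s ∈ S) (hu : IsUnit s) : (1 : A) ∈ S := by
  let L : S →ₗ[ℂ] S :=
    { toFun := fun x => ⟨s * x, mul_mem hs x.2⟩
      map_add' := fun x y => Subtype.ext (mul_add _ _ _)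
      map_smul' := fun r x => Subtype.ext (mul_smul_comm _ _ _) }
  have hinj : Function.Injective L := fun x y h =>
    Subtype.ext (hu.mul_left_cancel (congrArg Subtype.val h))
  obtain ⟨t, ht⟩ := LinearMap.injective_iff_surjective.1 hinj ⟨s, hs⟩
  have h1 : s * (t : A) = s * 1 := by rw [mul_one]; exact congrArg Subtype.val ht
  rw [← hu.mul_left_cancel h1]
  exact t.2

/-- The union of the sequence serves. Some member contains an element near `1`, which is invertible,
so from that member on all of them contain the unit. -/
theorem IsAF.exists_locallyFD (h : IsAF A) :
    ∃ R : StarSubalgebra ℂ A, LocallyFD R ∧ Dense (R : Set A) := by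
  obtain ⟨S, hmono, hfd, hd⟩ := h
  obtain ⟨n₀, hn₀⟩ : ∃ n, (1 : A) ∈ S n := by
    obtain ⟨s, hs, h1⟩ := hd.exists_dist_lt (1 : A) one_pos
    obtain ⟨n, hn⟩ := Set.mem_iUnion.1 hs
    have := hfd n
    refine ⟨n, one_mem_of_isUnit hn (isUnit_of_norm_sub_one_lt ?_)⟩
    rwa [← dist_eq_norm, dist_comm]
  let R : StarSubalgebra ℂ A :=
    { carrier := ⋃ n, (S n : Set A)
      mul_mem' := by
        intro a b ha hb
        obtain ⟨m, hm⟩ := Set.mem_iUnion.1 ha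
        obtain ⟨n, hn⟩ := Set.mem_iUnion.1 hb
        exact Set.mem_iUnion.2 ⟨max m n, mul_mem (hmono (le_max_left m n) hm)
          (hmono (le_max_right m n) hn)⟩
      add_mem' := by
        intro a b ha hb
        obtain ⟨m, hm⟩ := Set.mem_iUnion.1 ha
        obtain ⟨n, hn⟩ := Set.mem_iUnion.1 hb
        exact Set.mem_iUnion.2 ⟨max m n, add_mem (hmono (le_max_left m n) hm)
          (hmono (le_max_right m n) hn)⟩
      algebraMap_mem' := fun r => Set.mem_iUnion.2 ⟨n₀, by
        rw [Algebra.algebraMap_eq_smul_one]; exact SMulMemClass.smul_mem r hn₀⟩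
      star_mem' := by
        intro a ha
        obtain ⟨m, hm⟩ := Set.mem_iUnion.1 ha
        exact Set.mem_iUnion.2 ⟨m, star_mem hm⟩ }
  refine ⟨R, fun s hs hsR => ?_, hd⟩
  choose! f hf using fun x (hx : x ∈ s) => Set.mem_iUnion.1 (hsR hx)
  obtain ⟨N, hN⟩ := (hs.image f).bddAbove
  let T : StarSubalgebra ℂ A := (S (max N n₀)).toStarSubalgebra (hmono (le_max_right _ _) hn₀)
  refine ⟨T, fun x hx => Set.mem_iUnion.2 ⟨_, hx⟩, hfd (max N n₀), fun x hx => ?_⟩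
  exact hmono ((hN ⟨x, hx, rfl⟩).trans (le_max_left _ _)) (hf x hx)

end AF

/-! ### Exchanging the two algebras -/

section Swap
variable {A : Type u} {B : Type v} [CStarAlgebra A] [CStarAlgebra B]

/-- The set of the pairs `(b, a)` with `(a, b)` in `Γ`. -/
def swapSub (Γ : StarSubalgebra ℂ (A × B)) : StarSubalgebra ℂ (B × A) :=
  Γ.comap ((StarAlgHom.snd ℂ B A).prod (StarAlgHom.fst ℂ B A))

/-- The set of the pairs `(y, x)` with `(x, y)` in `G`. -/
def swapPairs {M N : Type*} [Add M] [Add N] (G : AddSubsemigroup (M × N)) :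
    AddSubsemigroup (N × M) where
  carrier := {z | (z.2, z.1) ∈ G}
  add_mem' := fun ha hb => G.add_mem ha hb

theorem IsPartialIso.swap {G : AddSubsemigroup (K0 A × K0 B)} (h : IsPartialIso G) :
    IsPartialIso (swapPairs G) where
  eq_iff _ hx _ hy := (h.eq_iff _ hx _ hy).symm
  le_iff _ hx _ hy := (h.le_iff _ hx _ hy).symm
  unit_mem := h.unit_mem

theorem IsMatching.swap {RA : StarSubalgebra ℂ A} {RB : StarSubalgebra ℂ B}
    {G : AddSubsemigroup (K0 A × K0 B)} {Γ : StarSubalgebra ℂ (A × B)}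
    (h : IsMatching RA RB G Γ) : IsMatching RB RA (swapPairs G) (swapSub Γ) where
  finite := by
    have := h.finite
    let f : swapSub Γ →ₗ[ℂ] Γ :=
      { toFun := fun z => ⟨(z.1.2, z.1.1), z.2⟩
        map_add' := fun _ _ => rfl
        map_smul' := fun _ _ => rfl }
    refine FiniteDimensional.of_injective f fun z w hzw => Subtype.ext ?_
    have := congrArg Subtype.val hzw
    exact Prod.ext (congrArg Prod.snd this) (congrArg Prod.fst this)
  left_mem z hz := h.right_mem _ hz
  right_mem z hz := h.left_mem _ hz
  left_inj z hz h0 := by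
    have := h.right_inj _ hz h0
    exact Prod.ext (congrArg Prod.snd this) (congrArg Prod.fst this)
  right_inj z hz h0 := by
    have := h.left_inj _ hz h0
    exact Prod.ext (congrArg Prod.snd this) (congrArg Prod.fst this)
  class_mem z hz hp h0 := h.class_mem _ hz
    ⟨Prod.ext (congrArg Prod.snd hp.1) (congrArg Prod.fst hp.1),
      Prod.ext (congrArg Prod.snd hp.2) (congrArg Prod.fst hp.2)⟩
    (fun h' => h0 (Prod.ext (congrArg Prod.snd h') (congrArg Prod.fst h')))

end Swap

/-! ### Finite-dimensional covers and the initial matching -/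

section Matching
variable {A : Type u} {B : Type v} [CStarAlgebra A] [CStarAlgebra B]

/-- The left half of a matching and one more element of `RA` lie in a finite-dimensional star
subalgebra of `RA`. -/
theorem IsMatching.exists_cover {RA : StarSubalgebra ℂ A} {RB : StarSubalgebra ℂ B}
    (hA : LocallyFD RA) {G : AddSubsemigroup (K0 A × K0 B)} {Γ : StarSubalgebra ℂ (A × B)}
    (hΓ : IsMatching RA RB G Γ) {a : A} (ha : a ∈ RA) :
    ∃ T : StarSubalgebra ℂ A, T ≤ RA ∧ FiniteDimensional ℂ T ∧ a ∈ T ∧ ∀ z ∈ Γ, z.1 ∈ T := by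
  have hfin : FiniteDimensional ℂ (Subalgebra.toSubmodule Γ.toSubalgebra) := hΓ.finite
  obtain ⟨S, hS⟩ := Module.Finite.iff_fg.1 hfin
  have hSΓ : ∀ z ∈ S, z ∈ Γ := fun z hz => by
    have : z ∈ Submodule.span ℂ (S : Set (A × B)) := Submodule.subset_span hz
    rw [hS] at this
    exact this
  obtain ⟨T, h1, h2, h3⟩ := hA (insert a (Prod.fst '' (S : Set (A × B))))
    ((S.finite_toSet.image _).insert a) (by
      rw [Set.insert_subset_iff]
      refine ⟨ha, ?_⟩
      rintro _ ⟨z, hz, rfl⟩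
      exact hΓ.left_mem z (hSΓ z hz))
  refine ⟨T, h1, h2, h3 (Set.mem_insert _ _), fun z hz => ?_⟩
  have hz' : z ∈ Submodule.span ℂ (S : Set (A × B)) := by rw [hS]; exact hz
  refine Submodule.span_induction (p := fun z _ => z.1 ∈ T) ?_ (zero_mem T)
    (fun x y _ _ hx hy => add_mem hx hy) (fun r x _ hx => T.smul_mem hx r) hz'
  exact fun w hw => h3 (Set.mem_insert_of_mem _ ⟨w, hw, rfl⟩)

/-- The match starts with the scalars: the one-unit system `(1, 1)`, which is nonzero in each
coordinate because both algebras are nontrivial. -/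
theorem exists_isMatching [Nontrivial A] [Nontrivial B] (RA : StarSubalgebra ℂ A)
    (RB : StarSubalgebra ℂ B) {G : AddSubsemigroup (K0 A × K0 B)}
    (hG : (K0Unit A, K0Unit B) ∈ G) : ∃ Γ, IsMatching RA RB G Γ := by
  have he : MatrixUnits (id : Unit → Unit) (fun _ _ => (1 : A)) :=
    ⟨fun _ => rfl, fun _ _ => star_one A, fun _ _ h => absurd rfl h, fun _ _ _ _ _ => mul_one 1,
      fun _ _ _ _ h => absurd rfl h, by simp⟩
  have hf : MatrixUnits (id : Unit → Unit) (fun _ _ => (1 : B)) :=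
    ⟨fun _ => rfl, fun _ _ => star_one B, fun _ _ h => absurd rfl h, fun _ _ _ _ _ => mul_one 1,
      fun _ _ _ _ h => absurd rfl h, by simp⟩
  refine ⟨_, he.isMatching hf (RA := RA) (RB := RB) (G := G) (fun _ => ⟨one_mem _,
    IsStarProjection.one A, one_ne_zero, fun x hx => ?_⟩) (he.span_le fun _ _ => one_mem RA)
    (fun _ _ => one_mem RB) (fun _ => one_ne_zero) fun _ => ?_⟩
  · obtain ⟨M, rfl⟩ := he.exists_coeff hx
    exact ⟨M () (), by simp⟩
  · rw [projClass_one, projClass_one]; exact hG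

end Matching

/-! ### What the EFD match provides -/

namespace EFD
variable {A : Type u} {B : Type v} [CStarAlgebra A] [CStarAlgebra B]

/-- The additive semigroup generated by the pair of units and the pairs chosen in the position. -/
def pairs (p : List (EFDRound (K0 A) (K0 B))) : AddSubsemigroup (K0 A × K0 B) :=
  AddSubsemigroup.closure (insert (K0Unit A, K0Unit B) {z | ∃ r ∈ p, (r.left, r.right) = z})

theorem unit_mem_pairs (p : List (EFDRound (K0 A) (K0 B))) : (K0Unit A, K0Unit B) ∈ pairs p :=
  AddSubsemigroup.subset_closure (Set.mem_insert _ _)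

theorem mem_pairs {p : List (EFDRound (K0 A) (K0 B))} {r : EFDRound (K0 A) (K0 B)} (hr : r ∈ p) :
    (r.left, r.right) ∈ pairs p :=
  AddSubsemigroup.subset_closure (Set.mem_insert_of_mem _ ⟨r, hr, rfl⟩)

theorem pairs_le_cons (p : List (EFDRound (K0 A) (K0 B))) (r : EFDRound (K0 A) (K0 B)) :
    pairs p ≤ pairs (r :: p) := by
  refine AddSubsemigroup.closure_mono (Set.insert_subset_insert ?_)
  rintro _ ⟨r', hr', rfl⟩
  exact ⟨r', List.mem_cons_of_mem _ hr', rfl⟩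

theorem _root_.AFK0.IsPartialIso.mono {G G' : AddSubsemigroup (K0 A × K0 B)}
    (h : IsPartialIso G') (hG : G ≤ G') (hu : (K0Unit A, K0Unit B) ∈ G) : IsPartialIso G :=
  ⟨fun x hx y hy => h.eq_iff x (hG hx) y (hG hy), fun x hx y hy => h.le_iff x (hG hx) y (hG hy), hu⟩

/-- An isomorphism of generated substructures preserves `u` and `+`, so its graph contains the
semigroup `pairs p`; injectivity and the relation symbol give the two equivalences. -/
theorem InducesIso.isPartialIso {p : List (EFDRound (K0 A) (K0 B))}
    (h : InducesIso K0Lang p) : IsPartialIso (pairs p) := by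
  obtain ⟨f, hf⟩ := h
  have key : ∀ z ∈ pairs p, ∃ hz : z.1 ∈ genLeft K0Lang p, (f ⟨z.1, hz⟩ : K0 B) = z.2 := by
    intro z hz
    refine AddSubsemigroup.closure_induction (p := fun z _ =>
      ∃ hz : z.1 ∈ genLeft K0Lang p, (f ⟨z.1, hz⟩ : K0 B) = z.2) ?_ ?_ hz
    · rintro z (rfl | ⟨r, hr, rfl⟩)
      · have hm : K0Unit A ∈ genLeft K0Lang p :=
          (genLeft K0Lang p).fun_mem (K0Func.unit : K0Lang.Functions 0) Fin.elim0
            fun i => i.elim0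
        refine ⟨hm, ?_⟩
        have := f.map_fun (K0Func.unit : K0Lang.Functions 0) Fin.elim0
        exact congrArg Subtype.val this
      · exact ⟨left_mem K0Lang hr, hf r hr⟩
    · rintro x y - - ⟨hx, hx'⟩ ⟨hy, hy'⟩
      have hm : x.1 + y.1 ∈ genLeft K0Lang p :=
        (genLeft K0Lang p).fun_mem (K0Func.add : K0Lang.Functions 2) ![x.1, y.1]
          fun i => by fin_cases i; exacts [hx, hy]
      refine ⟨hm, ?_⟩
      have := f.map_fun (K0Func.add : K0Lang.Functions 2) ![⟨x.1, hx⟩, ⟨y.1, hy⟩]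
      have h2 := congrArg Subtype.val this
      show _ = x.2 + y.2
      rw [← hx', ← hy']
      exact h2
  refine ⟨fun x hx y hy => ?_, fun x hx y hy => ?_, unit_mem_pairs p⟩
  · obtain ⟨hx1, hx2⟩ := key x hx
    obtain ⟨hy1, hy2⟩ := key y hy
    rw [← hx2, ← hy2]
    constructor
    · intro h; congr 2; exact Subtype.ext h
    · intro h; exact congrArg Subtype.val (f.injective (Subtype.ext h))
  · obtain ⟨hx1, hx2⟩ := key x hx
    obtain ⟨hy1, hy2⟩ := key y hy
    have := f.map_rel (K0Rel.le : K0Lang.Relations 2) ![⟨x.1, hx1⟩, ⟨y.1, hy1⟩]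
    rw [← hx2, ← hy2]
    exact this.symm

variable {γ : Ordinal.{0}} {σ : Strategy γ (K0 A) (K0 B)}

/-- The position need not be final: Player I could end the match at once by lowering the clock to
`0`, playing any element, here `0`. The pairs of the longer position include the current ones. -/
theorem Follows.isPartialIso (hσ : ∀ p, Follows σ p → clock γ p = 0 → InducesIso K0Lang p)
    {p : List (EFDRound (K0 A) (K0 B))} (hp : Follows σ p) : IsPartialIso (pairs p) := by
  by_cases h0 : clock γ p = 0
  · exact (hσ p hp h0).isPartialIso
  · have hlt : 0 < clock γ p := pos_iff_ne_zero.2 h0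
    have h1 := (hσ _ (hp.left 0 hlt 0) rfl).isPartialIso
    exact h1.mono (pairs_le_cons _ _) (unit_mem_pairs p)

/-- The clock values are `δ` plus the number of elements still to be played, so one unit is spent
per element and at least `δ` remains. -/
theorem Follows.exists_play_left (l : List (K0 A)) (δ : Ordinal.{0})
    {p : List (EFDRound (K0 A) (K0 B))} (hp : Follows σ p) (h : δ + l.length ≤ clock γ p) :
    ∃ q, Follows σ q ∧ pairs p ≤ pairs q ∧ δ ≤ clock γ q ∧ ∀ a ∈ l, ∃ b, (a, b) ∈ pairs q := by
  induction l generalizing p with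
  | nil => exact ⟨p, hp, le_rfl, by simpa using h, by simp⟩
  | cons a l ih =>
    have hlt : δ + l.length < clock γ p := by
      refine lt_of_lt_of_le ?_ h
      rw [List.length_cons, Nat.cast_add, Nat.cast_one, ← add_assoc]
      exact lt_add_one _
    obtain ⟨q, h1, h2, h3, h4⟩ := ih (hp.left _ hlt a) le_rfl
    refine ⟨q, h1, (pairs_le_cons _ _).trans h2, h3, ?_⟩
    rintro x (_ | ⟨_, hx⟩)
    · exact ⟨_, h2 (mem_pairs List.mem_cons_self)⟩
    · exact h4 x hx

theorem Follows.exists_play_right (l : List (K0 B)) (δ : Ordinal.{0})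
    {p : List (EFDRound (K0 A) (K0 B))} (hp : Follows σ p) (h : δ + l.length ≤ clock γ p) :
    ∃ q, Follows σ q ∧ pairs p ≤ pairs q ∧ δ ≤ clock γ q ∧ ∀ b ∈ l, ∃ a, (a, b) ∈ pairs q := by
  induction l generalizing p with
  | nil => exact ⟨p, hp, le_rfl, by simpa using h, by simp⟩
  | cons b l ih =>
    have hlt : δ + l.length < clock γ p := by
      refine lt_of_lt_of_le ?_ h
      rw [List.length_cons, Nat.cast_add, Nat.cast_one, ← add_assoc]
      exact lt_add_one _
    obtain ⟨q, h1, h2, h3, h4⟩ := ih (hp.right _ hlt b) le_rfl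
    refine ⟨q, h1, (pairs_le_cons _ _).trans h2, h3, ?_⟩
    rintro x (_ | ⟨_, hx⟩)
    · exact ⟨_, h2 (mem_pairs List.mem_cons_self)⟩
    · exact h4 x hx

end EFD
-- Strategies from invariants, and reading off the final isomorphism
namespace PI
variable {A : Type u} {B : Type v} [CStarAlgebra A] [CStarAlgebra B]

theorem inducesIso_of_subsingleton [Subsingleton A] [Subsingleton B] (p : List (PIRound A B)) :
    InducesIso p := by
  let f : genLeft p →⋆ₐ[ℂ] genRight p :=
    { toFun := fun _ => 0
      map_one' := Subsingleton.elim _ _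
      map_mul' := fun _ _ => Subsingleton.elim _ _
      map_zero' := rfl
      map_add' := fun _ _ => Subsingleton.elim _ _
      commutes' := fun _ => Subsingleton.elim _ _
      map_star' := fun _ => Subsingleton.elim _ _ }
  exact ⟨StarAlgEquiv.ofBijective f ⟨Function.injective_of_subsingleton _,
    fun y => ⟨0, Subsingleton.elim _ _⟩⟩, fun _ _ => Subsingleton.elim _ _⟩

theorem exists_allowed {A : Type u} {B : Type v} [PseudoMetricSpace A] [PseudoMetricSpace B]
    [Nonempty A] [Nonempty B] (c : A ⊕ B) {ε : ℝ} (hε : 0 < ε) :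
    ∃ z : A × B, Allowed c ε z.1 z.2 := by
  rcases c with a | b
  · exact ⟨(a, Classical.arbitrary B), by simpa [Allowed] using hε⟩
  · exact ⟨(Classical.arbitrary A, b), by simpa [Allowed] using hε⟩

/-- An invariant that holds initially and can be maintained by suitable answers gives a strategy. -/
theorem exists_strategy {A : Type u} {B : Type v} [PseudoMetricSpace A] [PseudoMetricSpace B]
    [Nonempty A] [Nonempty B] {α : Ordinal.{0}} (I : List (PIRound A B) → Prop) (h0 : I [])
    (hstep : ∀ p, I p → ∀ β < clock α p, ∀ (c : A ⊕ B) (ε : ℝ), 0 < ε →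
      ∃ z : A × B, Allowed c ε z.1 z.2 ∧ I (⟨β, c, ε, z.1, z.2⟩ :: p)) :
    ∃ σ : Strategy α A B, ∀ p, Follows σ p → I p := by
  classical
  have : ∀ (p : List (PIRound A B)) (β : Ordinal.{0}), β < clock α p → ∀ (c : A ⊕ B) (ε : ℝ),
      0 < ε → ∃ z : A × B, Allowed c ε z.1 z.2 ∧ (I p → I (⟨β, c, ε, z.1, z.2⟩ :: p)) := by
    intro p β hβ c ε hε
    by_cases hp : I p
    · obtain ⟨z, h1, h2⟩ := hstep p hp β hβ c ε hε
      exact ⟨z, h1, fun _ => h2⟩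
    · obtain ⟨z, hz⟩ := exists_allowed c hε
      exact ⟨z, hz, fun h => absurd h hp⟩
  choose f hf1 hf2 using this
  refine ⟨⟨f, hf1⟩, fun p hp => ?_⟩
  induction hp with
  | nil => exact h0
  | step _ β hβ c ε hε ih => exact hf2 _ β hβ c ε hε ih

theorem IIWins.of_subsingleton [Subsingleton A] [Subsingleton B] (α : Ordinal.{0}) :
    IIWins α A B := by
  obtain ⟨σ, -⟩ := exists_strategy (A := A) (B := B) (α := α) (fun _ => True) trivial
    fun p _ β _ c ε hε => by
      obtain ⟨z, hz⟩ := exists_allowed c hε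
      exact ⟨z, hz, trivial⟩
  exact ⟨σ, fun p _ _ => inducesIso_of_subsingleton p⟩

/-- The star algebra generated by the pairs chosen in the position. -/
noncomputable def graph (p : List (PIRound A B)) : StarSubalgebra ℂ (A × B) :=
  StarAlgebra.adjoin ℂ {z | ∃ r ∈ p, (r.left, r.right) = z}

theorem mem_graph {p : List (PIRound A B)} {r : PIRound A B} (hr : r ∈ p) :
    (r.left, r.right) ∈ graph p :=
  StarAlgebra.subset_adjoin ℂ _ ⟨r, hr, rfl⟩

theorem map_fst_graph (p : List (PIRound A B)) :
    (graph p).map (StarAlgHom.fst ℂ A B) =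
      StarAlgebra.adjoin ℂ {x : A | ∃ r ∈ p, r.left = x} := by
  rw [graph, StarAlgHom.map_adjoin]
  congr 1
  ext x
  simp

theorem map_snd_graph (p : List (PIRound A B)) :
    (graph p).map (StarAlgHom.snd ℂ A B) =
      StarAlgebra.adjoin ℂ {x : B | ∃ r ∈ p, r.right = x} := by
  rw [graph, StarAlgHom.map_adjoin]
  congr 1
  ext x
  simp

theorem finiteDimensional_map {C D : Type*} [CStarAlgebra C] [CStarAlgebra D]
    (f : C →⋆ₐ[ℂ] D) (S : StarSubalgebra ℂ C) [FiniteDimensional ℂ S] :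
    FiniteDimensional ℂ (S.map f) := by
  have h : FiniteDimensional ℂ (Subalgebra.toSubmodule S.toSubalgebra) :=
    inferInstanceAs (FiniteDimensional ℂ S)
  have h2 : FiniteDimensional ℂ
      ((Subalgebra.toSubmodule S.toSubalgebra).map f.toAlgHom.toLinearMap) := inferInstance
  exact h2

/-- The algebra generated by the chosen pairs lies in `Γ`, so both coordinate maps are injective on
it. It is finite-dimensional, so its images are closed and are exactly the generated C*-algebras;
the isomorphism goes back along the first coordinate and out along the second. -/
theorem inducesIso_of_graph {RA : StarSubalgebra ℂ A} {RB : StarSubalgebra ℂ B}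
    {G : AddSubsemigroup (K0 A × K0 B)} {Γ : StarSubalgebra ℂ (A × B)}
    (hΓ : IsMatching RA RB G Γ) {p : List (PIRound A B)}
    (hp : ∀ r ∈ p, (r.left, r.right) ∈ Γ) : InducesIso p := by
  have hle : graph p ≤ Γ := StarAlgebra.adjoin_le (by rintro _ ⟨r, hr, rfl⟩; exact hp r hr)
  have hfd : FiniteDimensional ℂ (graph p) := by
    have : FiniteDimensional ℂ (Subalgebra.toSubmodule Γ.toSubalgebra) := hΓ.finite
    exact Submodule.finiteDimensional_of_le (S₁ := Subalgebra.toSubmodule (graph p).toSubalgebra)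
      (S₂ := Subalgebra.toSubmodule Γ.toSubalgebra) hle
  have hl : genLeft p = (graph p).map (StarAlgHom.fst ℂ A B) := by
    have := finiteDimensional_map (StarAlgHom.fst ℂ A B) (graph p)
    rw [genLeft, ← map_fst_graph]
    exact le_antisymm (StarSubalgebra.topologicalClosure_minimal le_rfl
      (isClosed_of_finiteDimensional _)) (StarSubalgebra.le_topologicalClosure _)
  have hr : genRight p = (graph p).map (StarAlgHom.snd ℂ A B) := by
    have := finiteDimensional_map (StarAlgHom.snd ℂ A B) (graph p)
    rw [genRight, ← map_snd_graph]
    exact le_antisymm (StarSubalgebra.topologicalClosure_minimal le_rfl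
      (isClosed_of_finiteDimensional _)) (StarSubalgebra.le_topologicalClosure _)
  let F : graph p →⋆ₐ[ℂ] genLeft p :=
    ((StarAlgHom.fst ℂ A B).comp (graph p).subtype).codRestrict (genLeft p)
      fun z => hl ▸ ⟨z.1, z.2, rfl⟩
  let K : graph p →⋆ₐ[ℂ] genRight p :=
    ((StarAlgHom.snd ℂ A B).comp (graph p).subtype).codRestrict (genRight p)
      fun z => hr ▸ ⟨z.1, z.2, rfl⟩
  have hF : Function.Bijective F := by
    refine ⟨(injective_iff_map_eq_zero F).2 fun z hz => ?_, fun x => ?_⟩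
    · exact Subtype.ext (hΓ.left_inj _ (hle z.2) (congrArg Subtype.val hz))
    · obtain ⟨z, hz, hzx⟩ := hl.le x.2
      exact ⟨⟨z, hz⟩, Subtype.ext hzx⟩
  have hK : Function.Bijective K := by
    refine ⟨(injective_iff_map_eq_zero K).2 fun z hz => ?_, fun x => ?_⟩
    · exact Subtype.ext (hΓ.right_inj _ (hle z.2) (congrArg Subtype.val hz))
    · obtain ⟨z, hz, hzx⟩ := hr.le x.2
      exact ⟨⟨z, hz⟩, Subtype.ext hzx⟩
  let eF := StarAlgEquiv.ofBijective F hF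
  let eK := StarAlgEquiv.ofBijective K hK
  refine ⟨eF.symm.trans eK, fun r hr => ?_⟩
  have h1 : eF ⟨_, mem_graph hr⟩ = ⟨r.left, left_mem hr⟩ := rfl
  rw [← h1, StarAlgEquiv.trans_apply, StarAlgEquiv.symm_apply_apply]
  rfl

end PI

/-! ### The strategy of Player II -/

section Main
variable {A : Type u} {B : Type v} [CStarAlgebra A] [CStarAlgebra B]

/-- Triviality is expressed by `u + u = u`, so the EFD strategy forces both algebras or neither to
be zero. -/
theorem subsingleton_iff_K0Unit {R : StarSubalgebra ℂ A} (hR : LocallyFD R)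
    (hd : Dense (R : Set A)) : Subsingleton A ↔ K0Unit A + K0Unit A = K0Unit A := by
  rw [add_eq_left, ← projClass_one]
  constructor
  · intro h
    rw [Subsingleton.elim (1 : A) 0, projClass_zero]
  · intro h
    exact subsingleton_of_zero_eq_one (eq_zero_of_projClass_eq_zero hR hd (IsStarProjection.one A)
      (one_mem R) h).symm

/-- The matched algebras can be enlarged to follow a move of Player I in `A`. -/
theorem IsMatching.exists_extension_left [Nontrivial A] {RA : StarSubalgebra ℂ A}
    {RB : StarSubalgebra ℂ B} (hA : LocallyFD RA) (hdA : Dense (RA : Set A)) (hB : LocallyFD RB)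
    (hdB : Dense (RB : Set B)) {G : AddSubsemigroup (K0 A × K0 B)}
    {Γ : StarSubalgebra ℂ (A × B)} (hΓ : IsMatching RA RB G Γ) (a : A) {ε : ℝ} (hε : 0 < ε) :
    ∃ l : List (K0 A), ∀ G' : AddSubsemigroup (K0 A × K0 B), G ≤ G' → IsPartialIso G' →
      (∀ x ∈ l, ∃ y, (x, y) ∈ G') →
      ∃ Γ', IsMatching RA RB G' Γ' ∧ Γ ≤ Γ' ∧ ∃ z ∈ Γ', dist z.1 a < ε := by
  obtain ⟨a', ha', hd⟩ := exists_near hdA a hε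
  obtain ⟨T, hTR, hT, haT, hΓT⟩ := hΓ.exists_cover hA ha'
  obtain ⟨X, _, x, hX⟩ := hΓ.extend hA hdA hB hdB hTR hΓT
  refine ⟨(Finset.univ.toList).map x, fun G' h1 h2 h3 => ?_⟩
  have h4 : ∀ j, ∃ y, (x j, y) ∈ G' := fun j => h3 _ (List.mem_map_of_mem (by simp))
  choose b hb using h4
  obtain ⟨Γ', g1, g2, g3⟩ := hX G' b h1 h2 hb
  obtain ⟨s, hs⟩ := g3 a' haT
  exact ⟨Γ', g1, g2, _, hs, by rwa [dist_eq_norm]⟩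

/-- One step of the PI clock is worth `ω` steps of the EFD clock, enough for any finite number of
auxiliary moves. -/
theorem omega0_mul_add_natCast_le {β γ : Ordinal.{0}} (h : β < γ) (n : ℕ) :
    Ordinal.omega0 * β + n ≤ Ordinal.omega0 * γ := by
  calc Ordinal.omega0 * β + n ≤ Ordinal.omega0 * β + Ordinal.omega0 := by
        gcongr
        exact (Ordinal.natCast_lt_omega0 n).le
    _ = Ordinal.omega0 * Order.succ β := (Ordinal.mul_succ _ _).symm
    _ ≤ _ := by
        gcongr
        exact Order.succ_le_of_lt h

theorem IIWins_PI_of_IIWins_EFD (hA : IsAF A) (hB : IsAF B) (α : Ordinal.{0})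
    (h : EFD.IIWins K0Lang (Ordinal.omega0 * α) (K0 A) (K0 B)) : PI.IIWins α A B := by
  obtain ⟨RA, fA, dA⟩ := hA.exists_locallyFD
  obtain ⟨RB, fB, dB⟩ := hB.exists_locallyFD
  obtain ⟨σ, hσ⟩ := h
  have hnil := (EFD.Follows.nil (σ := σ)).isPartialIso hσ
  have hu := hnil.unit_mem
  have hiff : Subsingleton A ↔ Subsingleton B := by
    rw [subsingleton_iff_K0Unit fA dA, subsingleton_iff_K0Unit fB dB]
    exact hnil.eq_iff _ (AddSubsemigroup.add_mem _ hu hu) _ hu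
  rcases subsingleton_or_nontrivial A with hsA | hnA
  · have := hiff.1 hsA
    exact PI.IIWins.of_subsingleton α
  have hnB : Nontrivial B := by
    rw [← not_subsingleton_iff_nontrivial] at hnA ⊢
    rwa [← hiff]
  obtain ⟨Γ₀, hΓ₀⟩ := exists_isMatching RA RB hu
  -- The invariant only bounds the EFD clock from below, since the auxiliary match may have time to
  -- spare.
  obtain ⟨τ, hτ⟩ := PI.exists_strategy (α := α)
    (fun p : List (PIRound A B) => ∃ q Γ, EFD.Follows σ q ∧
      Ordinal.omega0 * PI.clock α p ≤ EFD.clock (Ordinal.omega0 * α) q ∧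
      IsMatching RA RB (EFD.pairs q) Γ ∧ ∀ r ∈ p, (r.left, r.right) ∈ Γ)
    ⟨[], Γ₀, EFD.Follows.nil, le_rfl, hΓ₀, by simp⟩ (by
      rintro p ⟨q, Γ, hq, hclock, hΓ, hp⟩ β hβ c ε hε
      have room : ∀ n : ℕ, Ordinal.omega0 * β + n ≤ EFD.clock (Ordinal.omega0 * α) q :=
        fun n => (omega0_mul_add_natCast_le hβ n).trans hclock
      have done : ∀ {q' Γ'} {z : A × B}, EFD.Follows σ q' →
          Ordinal.omega0 * β ≤ EFD.clock (Ordinal.omega0 * α) q' →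
          IsMatching RA RB (EFD.pairs q') Γ' → Γ ≤ Γ' → z ∈ Γ' → PI.Allowed c ε z.1 z.2 →
          ∃ z : A × B, PI.Allowed c ε z.1 z.2 ∧ ∃ q Γ, EFD.Follows σ q ∧
            Ordinal.omega0 * PI.clock α (⟨β, c, ε, z.1, z.2⟩ :: p) ≤
              EFD.clock (Ordinal.omega0 * α) q ∧ IsMatching RA RB (EFD.pairs q) Γ ∧
            ∀ r ∈ (⟨β, c, ε, z.1, z.2⟩ :: p : List (PIRound A B)), (r.left, r.right) ∈ Γ := by
        intro q' Γ' z h1 h2 h3 h4 h5 h6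
        refine ⟨z, h6, q', Γ', h1, h2, h3, ?_⟩
        rintro r (_ | ⟨_, hr⟩)
        · exact h5
        · exact h4 (hp r hr)
      -- The list of classes to play is fixed before the EFD moves are made; the answers then enter
      -- through the enlarged semigroup of pairs.
      rcases c with a | b
      · obtain ⟨l, hl⟩ := hΓ.exists_extension_left fA dA fB dB a hε
        obtain ⟨q', h1, h2, h3, h4⟩ := hq.exists_play_left l _ (room l.length)
        obtain ⟨Γ', g1, g2, z, g3, g4⟩ := hl _ h2 (h1.isPartialIso hσ) h4
        exact done h1 h3 g1 g2 g3 g4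
      · obtain ⟨l, hl⟩ := hΓ.swap.exists_extension_left fB dB fA dA b hε
        obtain ⟨q', h1, h2, h3, h4⟩ := hq.exists_play_right l _ (room l.length)
        obtain ⟨Γ', g1, g2, z, g3, g4⟩ := hl (swapPairs (EFD.pairs q')) (fun x hx => h2 hx)
          (h1.isPartialIso hσ).swap h4
        exact done (z := (z.2, z.1)) h1 h3 g1.swap (fun x hx => g2 (show (x.2, x.1) ∈ swapSub Γ
          from hx)) g3 g4)
  -- The invariant yields the isomorphism in every position, final or not.
  refine ⟨τ, fun p hp _ => ?_⟩
  obtain ⟨q, Γ, -, -, hΓ, hpΓ⟩ := hτ p hp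
  exact PI.inducesIso_of_graph hΓ hpΓ

end Main
end AFK0

theorem theorem3p1 {A : Type u} {B : Type v} [CStarAlgebra A] [CStarAlgebra B]
    (hA : AFK0.IsAF A) (hB : AFK0.IsAF B) (α : Ordinal.{0}) (hα : α < Ordinal.omega 1)
    (h : AFK0.EFD.IIWins AFK0.K0Lang (Ordinal.omega0 * α) (AFK0.K0 A) (AFK0.K0 B)) :
    AFK0.PI.IIWins α A B :=
  AFK0.IIWins_PI_of_IIWins_EFD hA hB α h
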